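/- Let $F$ be a closed connected surface embedded in a 3-manifold $Y$ (possibly with boundary) with a product neighbourhood $F\times\mathbb R\subset Y$, $F=F\times\{0\}$. Let $K\subset F\times \mathbb R$ be a knot whose projection $\pi(K)\subset F$ is a generic immersed curve (finitely many transverse double points, the crossings), with the over/under information at each crossing. An *essential curve* on $F$ is a simple closed curve that bounds no disk in $F$; a *compression disk* for $F$ is an embedded disk $D\subset Y$ with $D\cap F=\partial D$ such that $\partial D$ is essential on $F$. The edge representativity $e(\pi(K),F)\in\mathbb N\cup\{\infty\}$ is the minimal number of points in which an essential curve that is transverse to $\pi(K)$ and avoids the crossings meets $\pi(K)$. The representativity $r(\pi(K),F)$ is the minimal number of such intersections of $\pi(K)$ with $\partial D$, over all compression disks $D$. Each of them is $\infty$ if there are no such curves, respectively disks. The diagram $\pi(K)$ is *weakly generalized alternating* on $F$ if (1) over- and under-crossings alternate along $K$; (2) it is weakly prime: whenever $D\subset F$ is a disk whose boundary meets $\pi(K)$ transversely (away from the crossings) in exactly two points, $\pi(K)\cap D$ is a single arc, or $F$ is a 2-sphere and $\pi(K)\cap (F\setminus D)$ is a single arc; (3) $\pi(K)\ne\emptyset$;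 (4) there is at least one crossing; (5) the regions of $F\setminus\pi(K)$ can be coloured with two colours so that the two sides of each edge have different colours; (6) $r(\pi(K),F)\ge 4$. A *twist region* of $\pi(K)$ is a maximal row of crossings in which consecutive crossings are joined by bigons, contained in an open disk of $F$ that the diagram meets only in the two strands forming the row. Suppose that $\pi(K)$ is weakly generalized alternating on $F$, with $e(\pi(K),F)\ge 4$ and $r(\pi(K),F)>4$. Choose finitely many twist regions of $\pi(K)$ lying in pairwise disjoint such disks, and in each of them remove crossings in pairs, so that one or two crossings are left there (with their over/under information); leave the rest of the diagram unchanged. Then the result is the diagram $\pi(K')$ of a knot $K'$, and $\pi(K')$ is weakly generalized alternating on $F$, with $e(\pi(K'),F)\ge 4$ and $r(\pi(K'),F)>4$. -/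

import Mathlib

open Set Topology

/-! Everything takes place in the topological category, where curves on a surface are tame. A closed
surface `F` sits in a 3-manifold `Y` through a product neighbourhood, i.e. an open embedding
`c : F × ℝ → Y`; the surface itself is `c '' (F × {0})`. -/

/-- Two parametrized curves `α`, `β` on a surface pass through a common point at the parameters
`s`, `t` and cross there transversely: in a suitable local chart of the surface `α` runs (injectively)
along the horizontal axis and `β` runs (injectively) along the vertical axis. -/
def TransverseAt {A B F : Type*} [TopologicalSpace A] [TopologicalSpace B] [TopologicalSpace F]
    (α : A → F) (s : A) (β : B → F) (t : B) : Prop :=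
  α s = β t ∧ ∃ ψ : OpenPartialHomeomorph F (ℝ × ℝ), α s ∈ ψ.source ∧ ψ (α s) = 0 ∧
    (∃ U ∈ 𝓝 s, InjOn α U ∧ MapsTo α U ψ.source ∧ ∀ u ∈ U, (ψ (α u)).2 = 0) ∧
    (∃ V ∈ 𝓝 t, InjOn β V ∧ MapsTo β V ψ.source ∧ ∀ v ∈ V, (ψ (β v)).1 = 0)

/-- A knot in `F × ℝ`, namely `s ↦ (proj s, height s)`, in general position with respect to the
projection to `F`: the projected curve is a locally flat immersion whose only self-intersections are
finitely many transverse double points. At a double point the strand of larger height is the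
over-strand. With a product neighbourhood `c : F × ℝ → Y` of the surface `F`, the knot in `Y` is
`s ↦ c (proj s, height s)`. -/
structure KnotDiagram (F : Type*) [TopologicalSpace F] where
  proj : Circle → F
  height : Circle → ℝ
  continuous_proj : Continuous proj
  continuous_height : Continuous height
  injective : Function.Injective fun s => (proj s, height s)
  flat : ∀ s, ∃ ψ : OpenPartialHomeomorph F (ℝ × ℝ), proj s ∈ ψ.source ∧
    ∃ U ∈ 𝓝 s, InjOn proj U ∧ MapsTo proj U ψ.source ∧ ∀ u ∈ U, (ψ (proj u)).2 = 0
  finite_double : {s | ∃ t, t ≠ s ∧ proj t = proj s}.Finite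
  no_triple : ∀ s t u, proj s = proj t → proj t = proj u → s = t ∨ t = u ∨ s = u
  transverse : ∀ s t, s ≠ t → proj s = proj t → TransverseAt proj s proj t

/-- The closed curve `α` meets the (immersed) curve `γ` transversely, and away from the double points
of `γ`. -/
def MeetsTransversely {F : Type*} [TopologicalSpace F] (α γ : Circle → F) : Prop :=
  ∀ s t, α s = γ t → (∀ t', γ t' = γ t → t' = t) ∧ TransverseAt α s γ t

/-- The number of points of the simple closed curve `α` that lie on `γ`. -/
noncomputable def numIntersections {F : Type*} (α γ : Circle → F) : ℕ∞ :=
  {s | α s ∈ range γ}.encard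

/-- A closed disk in a surface is the image of the closed unit disk of `ℂ` under an open embedding
`δ : ℂ → F`. An essential curve on a closed surface is a simple closed curve that does not bound a
disk in the surface. -/
def IsEssential {F : Type*} [TopologicalSpace F] (α : Circle → F) : Prop :=
  Continuous α ∧ Function.Injective α ∧
    ¬ ∃ δ : ℂ → F, IsOpenEmbedding δ ∧ δ '' Metric.sphere 0 1 = range α

/-- `δ` restricted to the closed unit disk is a compression disk, with boundary curve `α`, for the
surface `c '' (F × {0})` in `Y`: an embedded disk that meets the surface exactly in its boundary, and
whose boundary is essential on the surface. -/
def IsCompressionDisk {F Y : Type*} [TopologicalSpace F] [TopologicalSpace Y]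
    (c : F × ℝ → Y) (δ : ℂ → Y) (α : Circle → F) : Prop :=
  ContinuousOn δ (Metric.closedBall 0 1) ∧ InjOn δ (Metric.closedBall 0 1) ∧
    (∀ z : Circle, δ z = c (α z, 0)) ∧
    (∀ z ∈ Metric.ball (0 : ℂ) 1, ∀ x : F, δ z ≠ c (x, 0)) ∧
    IsEssential α

/-- A subset that is an embedded closed arc. -/
def IsArc {F : Type*} [TopologicalSpace F] (S : Set F) : Prop :=
  ∃ f : ℝ → F, ContinuousOn f (Icc 0 1) ∧ InjOn f (Icc 0 1) ∧ f '' Icc 0 1 = S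

/-- The surface is a 2-sphere. (A closed connected orientable surface has positive genus exactly when
it is not.) -/
def IsTwoSphere (F : Type*) [TopologicalSpace F] : Prop :=
  Nonempty (F ≃ₜ Metric.sphere (0 : EuclideanSpace ℝ (Fin 3)) 1)

namespace KnotDiagram

variable {F : Type*} [TopologicalSpace F]

/-- The edge representativity: the least number of intersections of the projection with an essential
curve on `F` (`⊤` if there is no essential curve). -/
noncomputable def edgeRepresentativity (K : KnotDiagram F) : ℕ∞ :=
  ⨅ (α : Circle → F) (_ : IsEssential α) (_ : MeetsTransversely α K.proj),
    numIntersections α K.proj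

/-- The representativity: the least number of intersections of the projection with (the boundary of) a
compression disk (`⊤` if there is no compression disk). -/
noncomputable def representativity {Y : Type*} [TopologicalSpace Y] (K : KnotDiagram F)
    (c : F × ℝ → Y) : ℕ∞ :=
  ⨅ (δ : ℂ → Y) (α : Circle → F) (_ : IsCompressionDisk c δ α)
    (_ : MeetsTransversely α K.proj), numIntersections α K.proj

/-- The knot passes through a crossing at the parameter `s`. -/
def IsCrossingAt (K : KnotDiagram F) (s : Circle) : Prop :=
  ∃ t, t ≠ s ∧ K.proj t = K.proj s

/-- The knot passes over a crossing at the parameter `s`. -/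
def IsOverAt (K : KnotDiagram F) (s : Circle) : Prop :=
  ∃ t, t ≠ s ∧ K.proj t = K.proj s ∧ K.height t < K.height s

/-- Along the knot, over- and under-crossings alternate. -/
def IsAlternating (K : KnotDiagram F) : Prop :=
  ∀ a b : ℝ, a < b → K.IsCrossingAt (Circle.exp a) → K.IsCrossingAt (Circle.exp b) →
    (∀ x ∈ Ioo a b, ¬ K.IsCrossingAt (Circle.exp x)) →
    (K.IsOverAt (Circle.exp a) ↔ ¬ K.IsOverAt (Circle.exp b))

/-- Weak primeness: if the boundary of a disk `D ⊆ F` meets the projection transversely exactly twice,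
then the projection meets `D` in a single arc or, when `F` is a sphere, it meets `D` or the
complementary disk in a single arc. -/
def IsWeaklyPrime (K : KnotDiagram F) : Prop :=
  ∀ δ : ℂ → F, IsOpenEmbedding δ →
    MeetsTransversely (fun z : Circle => δ z) K.proj →
    numIntersections (fun z : Circle => δ z) K.proj = 2 →
    IsArc (range K.proj ∩ δ '' Metric.closedBall 0 1) ∨
      (IsTwoSphere F ∧ IsArc (range K.proj \ δ '' Metric.ball 0 1))

/-- The regions of the complement of the projection can be coloured with two colours (`P` and `Q` are
the unions of the regions of either colour) so that the two sides of every edge have different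
colours. -/
def IsCheckerboardColorable (K : KnotDiagram F) : Prop :=
  ∃ P Q : Set F, IsOpen P ∧ IsOpen Q ∧ Disjoint P Q ∧ P ∪ Q = (range K.proj)ᶜ ∧
    range K.proj ⊆ closure P ∩ closure Q

/-- Reduced alternating diagrams. -/
structure IsReducedAlternating (K : KnotDiagram F) : Prop where
  alternating : K.IsAlternating
  weaklyPrime : K.IsWeaklyPrime
  nonempty : (range K.proj).Nonempty
  crossing : ∃ s, K.IsCrossingAt s

/-- Weakly generalized alternating diagrams on the surface `F` with product neighbourhood `c`
in `Y`. -/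
structure IsWeaklyGeneralizedAlternating {Y : Type*} [TopologicalSpace Y] (K : KnotDiagram F)
    (c : F × ℝ → Y) : Prop extends K.IsReducedAlternating where
  checkerboard : K.IsCheckerboardColorable
  four_le_representativity : 4 ≤ K.representativity c

end KnotDiagram

/-! The standard picture of `n` crossings in a row consists of the two graphs
`y = twistWave n x` (strand `true`) and `y = - twistWave n x` (strand `false`) in the plane: they cross
exactly at the `n` points with `x = twistParam n j`, `j < n`, all in `0 < x < 1`, consecutive crossings
bound a bigon between the strands, and both graphs are horizontal for `x ≤ 0` and for `x ≥ 1`. -/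

noncomputable def twistWave (n : ℕ) (x : ℝ) : ℝ := Real.cos (n * Real.pi * max 0 (min 1 x))

noncomputable def twistParam (n j : ℕ) : ℝ := (2 * j + 1) / (2 * n)

noncomputable def twistPoint (n : ℕ) (b : Bool) (x : ℝ) : ℝ × ℝ :=
  (x, (if b then 1 else -1) * twistWave n x)

/-- An open disk in `F` in which the diagram `K` is the standard picture of `n` crossings in a row.
`strand b x` is the parameter at which the knot passes the point with abscissa `x` on strand `b`. -/
structure TwistChart {F : Type*} [TopologicalSpace F] (K : KnotDiagram F) (n : ℕ) where
  chart : ℝ × ℝ → F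
  isOpenEmbedding : IsOpenEmbedding chart
  strand : Bool → ℝ → Circle
  continuous_strand : ∀ b, Continuous (strand b)
  injective_strand : Function.Injective fun p : Bool × ℝ => strand p.1 p.2
  proj_strand : ∀ b x, K.proj (strand b x) = chart (twistPoint n b x)
  exists_strand : ∀ s, K.proj s ∈ range chart → ∃ b x, strand b x = s

namespace TwistChart

variable {F : Type*} [TopologicalSpace F] {K : KnotDiagram F}

/-- The set of the crossings in the disk. -/
def crossings {n : ℕ} (T : TwistChart K n) : Set F :=
  {p | ∃ j < n, p = T.chart (twistParam n j, 0)}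

/-- A twist region: a maximal row of crossings joined by bigons. -/
def IsTwistRegion {n : ℕ} (T : TwistChart K n) : Prop :=
  ∀ (l : ℕ) (T' : TwistChart K l), T.crossings ⊆ T'.crossings → l ≤ n

/-- The parameter `s` belongs to one of the two arcs of the knot that contain the crossings of `T`. -/
def InTwist {n : ℕ} (T : TwistChart K n) (s : Circle) : Prop :=
  ∃ b, ∃ x ∈ Icc (0 : ℝ) 1, T.strand b x = s

end TwistChart

/-- `K'` is obtained from `K` by replacing, for each `i`, the row of `n i` crossings in the disk of
`T i` by a row of `n' i` crossings: `K'` keeps the over/under information of the first `n' i`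
crossings of the row, and agrees with `K` (projection and over/under information) outside the
rows. -/
structure KnotDiagram.IsTwistReplacement {F : Type*} [TopologicalSpace F] (K : KnotDiagram F)
    {m : ℕ} {n : Fin m → ℕ} (T : ∀ i, TwistChart K (n i)) (n' : Fin m → ℕ)
    (K' : KnotDiagram F) : Prop where
  proj_outside : ∀ s, (∀ i, ¬ (T i).InTwist s) → K'.proj s = K.proj s
  over_outside : ∀ s t, (∀ i, ¬ (T i).InTwist s) → (∀ i, ¬ (T i).InTwist t) →
    s ≠ t → K.proj s = K.proj t → (K'.height s < K'.height t ↔ K.height s < K.height t)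
  proj_inside : ∀ i b, ∀ x ∈ Icc (0 : ℝ) 1,
    K'.proj ((T i).strand b x) = (T i).chart (twistPoint (n' i) b x)
  over_inside : ∀ i, ∀ j < n' i,
    (K'.height ((T i).strand false (twistParam (n' i) j)) <
        K'.height ((T i).strand true (twistParam (n' i) j)) ↔
      K.height ((T i).strand false (twistParam (n i) j)) <
        K.height ((T i).strand true (twistParam (n i) j)))

/-! ### The standard waves -/

/-! Let `K` have rows of `n i` crossings and `K'` rows of `n' i` crossings, with `1 ≤ n' i ≤ n i`
and equal parities. The bounds and weak primeness for `K'` come from moving test curves for `K'` to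
test curves for `K`.

A closed curve transverse to `K'` and away from its crossings misses a small neighbourhood `N i` of
the first crossing of each row. A compactly supported isotopy of the plane blows `N i` up until it
covers the surplus crossings of the long row, and carries the rest of the short picture onto the
rest of the long one (`exists_isotopy_twistGraph`). The resulting homeomorphism `f` of `F` matches
`K'` with `K` off the `N i`, so it turns the curve into one transverse to `K` with equally many
intersections (`IsTwistSystem.exists_transport`). It preserves essential curves and, coming from an
isotopy, extends over `Y` through the product neighbourhood, so it also moves compression disks
(`IsCompressionDisk.exists_comp`). Hence neither representativity drops.

If the boundary of a disk meets `K'` twice, its image under `f` meets `K` twice, and `K` is a single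
arc on one side. Each `N i` is connected and misses the boundary, so it lies on one side; not on the
arc side, because `f '' N i` contains three arms of a crossing of `K`, and a triod does not embed in
an arc (`IsArc.false_of_triod`). So `f` identifies the two diagrams on that side.

Alternation is encoded, on the universal cover of the circle, by a two-valued label of the edges
that switches at every crossing in a way dictated by over or under. Along a strand of a row the sign
of the wave also switches at every crossing, so comparing label and sign gives a constant;
substituting the sign of the short wave for that of the long one yields a label for `K'`. Equal
parity makes the two signs agree at the ends of the row.

A row has only two checkerboard colourings, determined by the colour above and below the strands,
and they are visible at the edge of the disk; each disk can therefore be recoloured independently.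
The diagram `K'` itself exists by gluing the short waves, with reparametrized heights, into `K`. -/

theorem continuous_twistWave (n : ℕ) : Continuous (twistWave n) := by
  unfold twistWave; fun_prop

theorem abs_twistWave_le_one (n : ℕ) (x : ℝ) : |twistWave n x| ≤ 1 :=
  Real.abs_cos_le_one _

theorem twistWave_of_nonpos (n : ℕ) {x : ℝ} (hx : x ≤ 0) : twistWave n x = 1 := by
  have : max 0 (min 1 x) = 0 := max_eq_left ((min_le_right _ _).trans hx)
  simp [twistWave, this]

theorem twistWave_of_one_le (n : ℕ) {x : ℝ} (hx : 1 ≤ x) : twistWave n x = (-1) ^ n := by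
  have : max 0 (min 1 x) = 1 := by rw [min_eq_left hx]; simp
  rw [twistWave, this, mul_one, Real.cos_nat_mul_pi]

theorem twistWave_eq_cos (n : ℕ) {x : ℝ} (h0 : 0 ≤ x) (h1 : x ≤ 1) :
    twistWave n x = Real.cos (n * Real.pi * x) := by
  rw [twistWave, min_eq_right h1, max_eq_right h0]

theorem abs_twistWave_of_nonpos (n : ℕ) {x : ℝ} (hx : x ≤ 0) : |twistWave n x| = 1 := by
  simp [twistWave_of_nonpos n hx]

theorem abs_twistWave_of_one_le (n : ℕ) {x : ℝ} (hx : 1 ≤ x) : |twistWave n x| = 1 := by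
  simp [twistWave_of_one_le n hx]

/-- The right end of a row sees only `(-1) ^ n`. This is why crossings are removed in pairs: the
short row can then be glued to the unchanged ends of the strands. -/
theorem twistWave_congr_of_parity {n n' k : ℕ} (h : n = n' + 2 * k) {x : ℝ}
    (hx : x ∉ Ioo (0 : ℝ) 1) : twistWave n x = twistWave n' x := by
  rcases le_or_gt x 0 with h0 | h0
  · rw [twistWave_of_nonpos _ h0, twistWave_of_nonpos _ h0]
  · have h1 : 1 ≤ x := by
      by_contra h1
      exact hx ⟨h0, not_le.1 h1⟩
    rw [twistWave_of_one_le _ h1, twistWave_of_one_le _ h1, h, pow_add, pow_mul]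
    simp

theorem twistParam_pos {n j : ℕ} (h : j < n) : 0 < twistParam n j := by
  have : (0 : ℝ) < n := by exact_mod_cast (Nat.zero_le j).trans_lt h
  unfold twistParam; positivity

theorem twistParam_lt_one {n j : ℕ} (h : j < n) : twistParam n j < 1 := by
  have h0 : (0 : ℝ) < n := by exact_mod_cast (Nat.zero_le j).trans_lt h
  have h1 : (j : ℝ) + 1 ≤ n := by exact_mod_cast h
  unfold twistParam
  rw [div_lt_one (by positivity)]
  linarith

theorem twistParam_mem_Icc {n j : ℕ} (h : j < n) : twistParam n j ∈ Icc (0 : ℝ) 1 :=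
  ⟨(twistParam_pos h).le, (twistParam_lt_one h).le⟩

/-- The wave near its `j`-th zero. -/
theorem twistWave_eq_sin {n : ℕ} (hn : 0 < n) (j : ℕ) {x : ℝ} (h0 : 0 ≤ x) (h1 : x ≤ 1) :
    twistWave n x = -(-1) ^ j * Real.sin (n * Real.pi * (x - twistParam n j)) := by
  have hn' : (n : ℝ) ≠ 0 := by exact_mod_cast hn.ne'
  rw [twistWave_eq_cos n h0 h1]
  have : n * Real.pi * x =
      (n * Real.pi * (x - twistParam n j) + Real.pi / 2) + j * Real.pi := by
    unfold twistParam; field_simp; ring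
  rw [this, Real.cos_add_nat_mul_pi, Real.cos_add_pi_div_two]
  ring

theorem twistWave_twistParam {n j : ℕ} (h : j < n) : twistWave n (twistParam n j) = 0 := by
  rw [twistWave_eq_sin (by omega) j (twistParam_pos h).le (twistParam_lt_one h).le]
  simp

theorem twistWave_eq_zero_iff {n : ℕ} {x : ℝ} :
    twistWave n x = 0 ↔ ∃ j < n, x = twistParam n j := by
  constructor
  · intro h
    have hx : x ∈ Ioo (0 : ℝ) 1 := by
      constructor
      · by_contra h0
        simp [twistWave_of_nonpos n (not_lt.1 h0)] at h
      · by_contra h0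
        simp [twistWave_of_one_le n (not_lt.1 h0)] at h
    have hn : 0 < n := by
      rcases Nat.eq_zero_or_pos n with rfl | hn
      · simp [twistWave] at h
      · exact hn
    have hn' : (0 : ℝ) < n := by exact_mod_cast hn
    rw [twistWave_eq_cos n hx.1.le hx.2.le, Real.cos_eq_zero_iff] at h
    obtain ⟨k, hk⟩ := h
    have hk' : n * x = (2 * k + 1) / 2 := by
      have := Real.pi_pos.ne'
      field_simp at hk ⊢
      linarith
    have hk0 : 0 ≤ k := by
      have : (0 : ℝ) < 2 * k + 1 := by nlinarith [mul_pos hn' hx.1]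
      have : (0 : ℤ) < 2 * k + 1 := by exact_mod_cast this
      omega
    lift k to ℕ using hk0
    refine ⟨k, ?_, ?_⟩
    · have : (2 * k + 1 : ℝ) < 2 * n := by
        push_cast at hk'; nlinarith [mul_lt_mul_of_pos_left hx.2 hn']
      have : 2 * k + 1 < 2 * n := by exact_mod_cast this
      omega
    · unfold twistParam
      push_cast at hk'
      rw [eq_div_iff (by positivity)]
      linarith
  · rintro ⟨j, hj, rfl⟩
    exact twistWave_twistParam hj

theorem eventually_neg_one_pow_mul_twistWave {n j : ℕ} (h : j < n) :
    (∀ᶠ x in 𝓝[<] twistParam n j, 0 < (-1) ^ j * twistWave n x) ∧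
      ∀ᶠ x in 𝓝[>] twistParam n j, (-1) ^ j * twistWave n x < 0 := by
  have hn : 0 < n := by omega
  have hn' : (0 : ℝ) < n := by exact_mod_cast hn
  set p := twistParam n j
  have hlt : ∀ᶠ x in 𝓝 p, x ∈ Ioo (0 : ℝ) 1 :=
    Ioo_mem_nhds (twistParam_pos h) (twistParam_lt_one h)
  -- Within distance `1 / n` of the zero, the argument of the sine stays between `-π` and `π`.
  have hlt' : ∀ᶠ x in 𝓝 p, x ∈ Ioo (p - 1 / n) (p + 1 / n) :=
    Ioo_mem_nhds (by simp [hn]) (by simp [hn])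
  have key : ∀ x ∈ Ioo (0 : ℝ) 1, (-1) ^ j * twistWave n x = - Real.sin (n * Real.pi * (x - p)) := by
    intro x hx
    rw [twistWave_eq_sin hn j hx.1.le hx.2.le, ← mul_assoc, mul_neg, ← mul_pow]
    simp [p]
  have hpi := Real.pi_pos
  constructor
  · filter_upwards [nhdsWithin_le_nhds hlt, nhdsWithin_le_nhds hlt', self_mem_nhdsWithin]
      with x hx hx' hxp
    rw [key x hx, neg_pos]
    have hd : x - p < 0 := sub_neg.2 hxp
    refine Real.sin_neg_of_neg_of_neg_pi_lt (by nlinarith [mul_pos hn' hpi]) ?_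
    have h1 : -1 < n * (x - p) := by
      have := mul_lt_mul_of_pos_left (show -(1 / n : ℝ) < x - p by linarith [hx'.1]) hn'
      rwa [mul_neg, mul_one_div_cancel hn'.ne'] at this
    nlinarith
  · filter_upwards [nhdsWithin_le_nhds hlt, nhdsWithin_le_nhds hlt', self_mem_nhdsWithin]
      with x hx hx' hxp
    rw [key x hx, neg_lt_zero]
    have hd : 0 < x - p := sub_pos.2 hxp
    refine Real.sin_pos_of_pos_of_lt_pi (by positivity) ?_
    have h1 : n * (x - p) < 1 := by
      have := mul_lt_mul_of_pos_left (show x - p < (1 / n : ℝ) by linarith [hx'.2]) hn'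
      rwa [mul_one_div_cancel hn'.ne'] at this
    nlinarith

/-- The sign is recorded as a proposition depending on the parity of `j`, the form needed to combine
it with labels in the proof of alternation. -/
theorem eventually_twistWave_neg_iff {n j : ℕ} (h : j < n) :
    (∀ᶠ x in 𝓝[<] twistParam n j, (twistWave n x < 0 ↔ Odd j)) ∧
      ∀ᶠ x in 𝓝[>] twistParam n j, (twistWave n x < 0 ↔ ¬ Odd j) := by
  obtain ⟨h1, h2⟩ := eventually_neg_one_pow_mul_twistWave h
  rcases Nat.even_or_odd j with hj | hj
  · have hj' : ¬ Odd j := Nat.not_odd_iff_even.2 hj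
    simp only [hj.neg_one_pow, one_mul] at h1 h2
    exact ⟨h1.mono fun x hx => by simp [hj', hx.le], h2.mono fun x hx => by simp [hj', hx]⟩
  · simp only [hj.neg_one_pow, neg_mul, one_mul, neg_pos, neg_lt_zero] at h1 h2
    exact ⟨h1.mono fun x hx => by simp [hj, hx], h2.mono fun x hx => by simp [hj, hx.le]⟩

/-- The zeros are simple. The strict derivative feeds the inverse function theorem, which produces
the charts for transversality of the new crossings. -/
theorem exists_hasStrictDerivAt_twistWave {n j : ℕ} (h : j < n) :
    ∃ d : ℝ, d ≠ 0 ∧ HasStrictDerivAt (twistWave n) d (twistParam n j) := by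
  have hn : 0 < n := by omega
  have hn' : (n : ℝ) ≠ 0 := by exact_mod_cast hn.ne'
  set p := twistParam n j
  have hd : HasStrictDerivAt (fun x => -(-1) ^ j * Real.sin (n * Real.pi * (x - p)))
      (-(-1) ^ j * (Real.cos (n * Real.pi * (p - p)) * (n * Real.pi * 1))) p :=
    (HasStrictDerivAt.const_mul (n * Real.pi) ((hasStrictDerivAt_id p).sub_const p)).sin.const_mul _
  refine ⟨_, ?_, hd.congr_of_eventuallyEq ?_⟩
  · simp [hn', Real.pi_ne_zero]
  · filter_upwards [Ioo_mem_nhds (twistParam_pos h) (twistParam_lt_one h)] with x hx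
    rw [twistWave_eq_sin hn j hx.1.le hx.2.le]

/-! ### Compactly supported isotopies of the plane -/

theorem StrictMono.bijective_of_eq_self {f : ℝ → ℝ} (hf : StrictMono f) (hc : Continuous f) (R : ℝ)
    (h : ∀ x, R ≤ |x| → f x = x) : Function.Bijective f := by
  refine ⟨hf.injective, hc.surjective ?_ ?_⟩
  · refine Filter.tendsto_id.congr' ?_
    filter_upwards [Filter.eventually_ge_atTop R] with x hx
    exact (h x (hx.trans (le_abs_self x))).symm
  · refine Filter.tendsto_id.congr' ?_
    filter_upwards [Filter.eventually_le_atBot (-R)] with x hx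
    exact (h x (by linarith [neg_abs_le x])).symm

/-- For every `t : ℝ`, `x ↦ P (x, t)` is a continuous bijection; it is the identity outside a fixed
compact set, and for `1 ≤ |t|`. -/
structure IsCompactIsotopy {X : Type*} [TopologicalSpace X] (P : X × ℝ → X) : Prop where
  continuous : Continuous P
  bijective : ∀ t, Function.Bijective fun x => P (x, t)
  eq_off_compact : ∃ C, IsCompact C ∧ ∀ x t, x ∉ C → P (x, t) = x
  eq_of_one_le : ∀ x t, 1 ≤ |t| → P (x, t) = x

/-- The increasing piecewise linear function of `y` with `0 ↦ 0`, `± a ↦ ± u` that is the identity for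
`2 ≤ |y|` (for `0 < a ≤ u ≤ 1`). -/
noncomputable def stretch (a u y : ℝ) : ℝ :=
  max (min y (-2 + (2 - u) / (2 - a) * (2 + y)))
    (min (u / a * y) (max y (2 - (2 - u) / (2 - a) * (2 - y))))

section stretch

variable {a u : ℝ}

/-- All constituents of the max-min formula are increasing affine functions, so no case distinction
is needed; the same form gives continuity jointly in the parameters. -/
theorem stretch_strictMono (ha : 0 < a) (hau : a ≤ u) (hu : u ≤ 1) : StrictMono (stretch a u) := by
  have hs : 0 < u / a := div_pos (ha.trans_le hau) ha
  have hk : 0 < (2 - u) / (2 - a) := div_pos (by linarith) (by linarith)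
  intro y z h
  unfold stretch
  have h1 := mul_lt_mul_of_pos_left h hs
  have h2 := mul_lt_mul_of_pos_left h hk
  refine max_lt_max (min_lt_min h ?_) (min_lt_min h1 (max_lt_max h ?_)) <;> nlinarith

theorem stretch_zero (_ : 0 < a) (hau : a ≤ u) (hu : u ≤ 1) : stretch a u 0 = 0 := by
  have hk : (2 - u) / (2 - a) ≤ 1 := (div_le_one (by linarith)).2 (by linarith)
  unfold stretch
  rw [mul_zero, min_eq_left (le_max_left _ _), max_eq_right]
  exact min_le_left _ _

theorem stretch_self (ha : 0 < a) (hau : a ≤ u) (hu : u ≤ 1) : stretch a u a = u := by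
  have h2 : (2 - u) / (2 - a) * (2 - a) = 2 - u := div_mul_cancel₀ _ (by linarith)
  unfold stretch
  rw [div_mul_cancel₀ _ ha.ne', h2, sub_sub_cancel, max_eq_right hau, min_self, max_eq_right]
  exact (min_le_left _ _).trans hau

theorem stretch_neg_self (ha : 0 < a) (hau : a ≤ u) (hu : u ≤ 1) : stretch a u (-a) = -u := by
  have h2 : (2 - u) / (2 - a) * (2 - a) = 2 - u := div_mul_cancel₀ _ (by linarith)
  unfold stretch
  rw [mul_neg, div_mul_cancel₀ _ ha.ne', ← sub_eq_add_neg 2 a, h2,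
    min_eq_left (b := max _ _) ((neg_le_neg hau).trans (le_max_left _ _)), max_eq_right]
  exact (min_le_right _ _).trans (by linarith)

theorem stretch_of_two_le (ha : 0 < a) (hau : a ≤ u) (hu : u ≤ 1) {y : ℝ} (hy : 2 ≤ |y|) :
    stretch a u y = y := by
  have hk : (2 - u) / (2 - a) ≤ 1 := (div_le_one (by linarith)).2 (by linarith)
  have hs : 1 ≤ u / a := (one_le_div ha).2 hau
  unfold stretch
  rcases le_abs'.1 hy with h | h
  · rw [min_eq_left (a := y), max_eq_left]
    · exact (min_le_left _ _).trans (by nlinarith)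
    · nlinarith
  · rw [max_eq_left (a := y) (b := 2 - _), min_eq_right (b := y), max_eq_right]
    · exact min_le_left _ _
    · nlinarith
    · nlinarith

theorem stretch_of_eq (ha : 0 < a) (ha1 : a ≤ 1) (y : ℝ) : stretch a a y = y := by
  have hk : (2 - a) / (2 - a) = 1 := div_self (by linarith)
  simp [stretch, hk, div_self ha.ne']

/-- Monotonicity together with the values at `± a`. This and its two companions track the position
of a point relative to the strands. -/
theorem abs_stretch_le_iff (ha : 0 < a) (hau : a ≤ u) (hu : u ≤ 1) {y : ℝ} :
    |stretch a u y| ≤ u ↔ |y| ≤ a := by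
  have hm := stretch_strictMono ha hau hu
  have h1 := hm.le_iff_le (a := y) (b := a)
  have h2 := hm.le_iff_le (a := -a) (b := y)
  rw [stretch_self ha hau hu] at h1
  rw [stretch_neg_self ha hau hu] at h2
  rw [abs_le, abs_le, h1, h2]

theorem abs_stretch_lt_iff (ha : 0 < a) (hau : a ≤ u) (hu : u ≤ 1) {y : ℝ} :
    |stretch a u y| < u ↔ |y| < a := by
  have hm := stretch_strictMono ha hau hu
  have h1 := hm.lt_iff_lt (a := y) (b := a)
  have h2 := hm.lt_iff_lt (a := -a) (b := y)
  rw [stretch_self ha hau hu] at h1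
  rw [stretch_neg_self ha hau hu] at h2
  rw [abs_lt, abs_lt, h1, h2]

theorem abs_stretch_eq_iff (ha : 0 < a) (hau : a ≤ u) (hu : u ≤ 1) {y : ℝ} :
    |stretch a u y| = u ↔ |y| = a := by
  rw [le_antisymm_iff, le_antisymm_iff, ← not_lt (a := |stretch a u y|), ← not_lt (a := |y|),
    not_lt, not_lt, abs_stretch_le_iff ha hau hu, ← not_lt (b := u), ← not_lt (b := a),
    abs_stretch_lt_iff ha hau hu]

theorem stretch_bijective (ha : 0 < a) (hau : a ≤ u) (hu : u ≤ 1) :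
    Function.Bijective (stretch a u) :=
  (stretch_strictMono ha hau hu).bijective_of_eq_self (by unfold stretch; fun_prop) 2
    fun _ => stretch_of_two_le ha hau hu

end stretch

theorem strictMono_lineMap {f : ℝ → ℝ} (hf : StrictMono f) {c : ℝ} (h0 : 0 ≤ c) (h1 : c ≤ 1) :
    StrictMono fun x => f x + c * (x - f x) := by
  intro x y h
  have := hf h
  rcases h0.eq_or_lt with rfl | h0
  · simpa using this
  · nlinarith [mul_lt_mul_of_pos_left h h0, mul_nonneg (sub_nonneg.2 h1) (sub_pos.2 this).le]

/-- The vertical stretch `stretch (a x) (u x)` followed by the horizontal map `φ`, cut off outside a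
compact set; `t` is the parameter of an isotopy to the identity. -/
noncomputable def planeIsotopy (φ a u : ℝ → ℝ) (p : (ℝ × ℝ) × ℝ) : ℝ × ℝ :=
  let v := stretch (a p.1.1) (u p.1.1) p.1.2
  let w := v + min 1 |p.2| * (p.1.2 - v)
  (φ p.1.1 + max (max 0 (min 1 (|w| - 1))) (min 1 |p.2|) * (p.1.1 - φ p.1.1), w)

/-- At each time the map is a composition `(x, y) ↦ (x, w) ↦ (x', w)`: the first factor is strictly
increasing in `y` for fixed `x`, the second strictly increasing in `x` for fixed `w`. Both
interpolate between an increasing map and the identity, and everything is fixed outside `[-1, 1] ×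
[-2, 2]`. -/
theorem isCompactIsotopy_planeIsotopy {φ a u : ℝ → ℝ} (hφ : StrictMono φ) (hφc : Continuous φ)
    (hφ1 : ∀ x, 1 ≤ |x| → φ x = x) (hac : Continuous a) (huc : Continuous u)
    (ha : ∀ x, 0 < a x) (hau : ∀ x, a x ≤ u x) (hu : ∀ x, u x ≤ 1)
    (hau1 : ∀ x, 1 ≤ |x| → a x = u x) : IsCompactIsotopy (planeIsotopy φ a u) := by
  have h2 : ∀ x, 2 - a x ≠ 0 := fun x => by linarith [hau x, hu x]
  have ht : ∀ t : ℝ, 0 ≤ min 1 |t| := fun t => le_min zero_le_one (abs_nonneg t)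
  have ht1 : ∀ t : ℝ, min 1 |t| ≤ 1 := fun t => min_le_left _ _
  have hc : ∀ w t : ℝ, 0 ≤ max (max 0 (min 1 (|w| - 1))) (min 1 |t|) := fun w t =>
    (ht t).trans (le_max_right _ _)
  have hc1 : ∀ w t : ℝ, max (max 0 (min 1 (|w| - 1))) (min 1 |t|) ≤ 1 := fun w t =>
    max_le (max_le zero_le_one (min_le_left _ _)) (ht1 t)
  constructor
  · unfold planeIsotopy stretch
    have ha' : ∀ p : (ℝ × ℝ) × ℝ, a p.1.1 ≠ 0 := fun p => (ha _).ne'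
    have h2' : ∀ p : (ℝ × ℝ) × ℝ, 2 - a p.1.1 ≠ 0 := fun p => h2 _
    have hk : Continuous fun p : (ℝ × ℝ) × ℝ => (2 - u p.1.1) / (2 - a p.1.1) :=
      Continuous.div (by fun_prop) (by fun_prop) h2'
    have hs : Continuous fun p : (ℝ × ℝ) × ℝ => u p.1.1 / a p.1.1 :=
      Continuous.div (by fun_prop) (by fun_prop) ha'
    fun_prop
  · intro t
    have hv : ∀ x, Function.Bijective fun y =>
        stretch (a x) (u x) y + min 1 |t| * (y - stretch (a x) (u x) y) := fun x =>
      (strictMono_lineMap (stretch_strictMono (ha x) (hau x) (hu x)) (ht t) (ht1 t)).bijective_of_eq_self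
        (by unfold stretch; fun_prop) 2 fun y hy => by
          simp [stretch_of_two_le (ha x) (hau x) (hu x) hy]
    have hh : ∀ w, Function.Bijective fun x =>
        φ x + max (max 0 (min 1 (|w| - 1))) (min 1 |t|) * (x - φ x) := fun w =>
      (strictMono_lineMap hφ (hc w t) (hc1 w t)).bijective_of_eq_self (by fun_prop) 1 fun x hx => by
          simp [hφ1 x hx]
    constructor
    · rintro ⟨x, y⟩ ⟨x', y'⟩ h
      simp only [planeIsotopy, Prod.mk.injEq] at h
      obtain ⟨h1, h2⟩ := h
      rw [← h2] at h1
      obtain rfl := (hh _).1 h1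
      rw [(hv x).1 h2]
    · rintro ⟨x, y⟩
      obtain ⟨x', hx'⟩ := (hh y).2 x
      obtain ⟨y', hy'⟩ := (hv x').2 y
      refine ⟨(x', y'), ?_⟩
      simp only at hx' hy'
      simp only [planeIsotopy, hy', hx']
  · refine ⟨Icc (-1) 1 ×ˢ Icc (-2) 2, isCompact_Icc.prod isCompact_Icc, ?_⟩
    rintro ⟨x, y⟩ t hxy
    rw [mem_prod, not_and_or, mem_Icc, mem_Icc, ← abs_le, ← abs_le, not_le, not_le] at hxy
    rcases hxy with h | h
    · simp only at h
      simp [planeIsotopy, hφ1 x h.le, ← hau1 x h.le, stretch_of_eq (ha x) ((hau x).trans (hu x))]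
    · simp only at h
      have h1 : (1 : ℝ) ≤ |y| - 1 := by linarith
      simp [planeIsotopy, stretch_of_two_le (ha x) (hau x) (hu x) h.le, min_eq_left h1]
  · rintro ⟨x, y⟩ t ht
    simp [planeIsotopy, min_eq_left ht]

theorem planeIsotopy_zero (φ a u : ℝ → ℝ) (x y : ℝ) :
    planeIsotopy φ a u ((x, y), 0) =
      (φ x + max 0 (min 1 (|stretch (a x) (u x) y| - 1)) * (x - φ x), stretch (a x) (u x) y) := by
  simp [planeIsotopy]

theorem planeIsotopy_zero_of_le_one {φ a u : ℝ → ℝ} {x y : ℝ} (h : |stretch (a x) (u x) y| ≤ 1) :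
    planeIsotopy φ a u ((x, y), 0) = (φ x, stretch (a x) (u x) y) := by
  rw [planeIsotopy_zero, max_eq_left]
  · simp
  · exact (min_le_right _ _).trans (by linarith)

/-- The union of the two strands of the standard picture of `n` crossings. -/
def twistGraph (n : ℕ) : Set (ℝ × ℝ) := {z | |z.2| = |twistWave n z.1|}

/-- Counted from the right end, both rows are cosines, of frequencies `n'` and `n`, so scaling about
`1` by `n' / n` matches them up to sign. The sign only swaps the strands, and `twistGraph` does not
see it. -/
theorem abs_twistWave_comp_right {n n' : ℕ} (hn : 0 < n) (h : n' ≤ n) {x : ℝ}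
    (hx : 0 ≤ 1 - (1 - x) * (n' / n)) (hx0 : 0 ≤ x) :
    |twistWave n (max x (1 - (1 - x) * (n' / n)))| = |twistWave n' x| := by
  have hn' : (n : ℝ) ≠ 0 := by exact_mod_cast hn.ne'
  rcases le_total 1 x with h1 | h1
  · rw [abs_twistWave_of_one_le _ (h1.trans (le_max_left _ _)), abs_twistWave_of_one_le _ h1]
  · have hle : (n' / n : ℝ) ≤ 1 := by
      rw [div_le_one (by positivity)]; exact_mod_cast h
    have h0 : (0 : ℝ) ≤ n' / n := by positivity
    rw [max_eq_right (by nlinarith), twistWave_eq_cos _ hx (by nlinarith),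
      twistWave_eq_cos _ hx0 h1]
    have e1 : n * Real.pi * (1 - (1 - x) * (n' / n)) = n * Real.pi - n' * Real.pi * (1 - x) := by
      field_simp
    have e2 : n' * Real.pi * x = n' * Real.pi - n' * Real.pi * (1 - x) := by ring
    rw [e1, e2, Real.cos_nat_mul_pi_sub, Real.cos_nat_mul_pi_sub]
    simp [abs_mul]

/-- Left of the window `[x₀, x₁]` everything is pushed into the crossing-free part `x ≤ 0`, the
window is spread out from `0`, and right of it the map is the rescaling of
`abs_twistWave_comp_right`. -/
theorem exists_stretching_function {x₀ x₁ ρ : ℝ} (h0 : 0 < x₀) (h01 : x₀ < x₁) (h1 : x₁ ≤ 1)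
    (hρ0 : 0 < ρ) (hρ1 : ρ ≤ 1) :
    ∃ φ : ℝ → ℝ, StrictMono φ ∧ Continuous φ ∧ (∀ x, 1 ≤ |x| → φ x = x) ∧
      (∀ x, x ≤ x₀ → φ x ≤ 0) ∧ φ x₀ = 0 ∧ ∀ x, x₁ ≤ x → φ x = max x (1 - (1 - x) * ρ) := by
  -- The steep middle line rises from `0` at `x₀` to `1` at `x₁`, and so has overtaken the
  -- right-hand branch there.
  set M := 1 / (x₁ - x₀) with hM
  have hd : 0 < x₁ - x₀ := sub_pos.2 h01
  have hM1 : 1 ≤ M := by rw [hM, le_div_iff₀ hd]; linarith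
  have hMd : M * (x₁ - x₀) = 1 := by rw [hM, one_div, inv_mul_cancel₀ hd.ne']
  have hleft : ∀ x, x ≤ x₀ → max (min x ((x - x₀) / 2)) (min (M * (x - x₀)) (max x (1 - (1 - x) * ρ)))
      = min x ((x - x₀) / 2) := by
    intro x hx
    refine max_eq_left ((min_le_left _ _).trans (le_min ?_ ?_)) <;> nlinarith
  have hright : ∀ x, x₁ ≤ x → max (min x ((x - x₀) / 2))
      (min (M * (x - x₀)) (max x (1 - (1 - x) * ρ))) = max x (1 - (1 - x) * ρ) := by
    intro x hx
    have h2 : 1 + (x - x₁) ≤ M * (x - x₀) := by nlinarith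
    have h3 : max x (1 - (1 - x) * ρ) ≤ M * (x - x₀) := by
      refine max_le (by linarith) ?_
      rcases le_total x 1 with h | h <;> nlinarith
    rw [min_eq_right h3, max_eq_right]
    exact (min_le_left _ _).trans (le_max_left _ _)
  refine ⟨fun x => max (min x ((x - x₀) / 2)) (min (M * (x - x₀)) (max x (1 - (1 - x) * ρ))),
    ?_, by fun_prop, ?_, ?_, ?_, hright⟩
  · intro x y h
    refine max_lt_max (min_lt_min h ?_) (min_lt_min ?_ (max_lt_max h ?_)) <;> nlinarith
  · intro x hx
    rcases le_abs'.1 hx with h | h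
    · simp only
      rw [hleft x (by linarith), min_eq_left (by linarith)]
    · simp only
      rw [hright x (by linarith), max_eq_left (by nlinarith)]
  · intro x hx
    simp only
    rw [hleft x hx]
    exact (min_le_right _ _).trans (by linarith)
  · simp only
    rw [hleft x₀ le_rfl]
    simp [h0.le]

/-- The first crossing of the standard picture of `n'` crossings can be expanded by an isotopy of the
plane so that a neighbourhood `N` of it becomes a neighbourhood of the first `n - n' + 1` crossings of
the standard picture of `n` crossings, the pictures being the same outside. -/
theorem exists_isotopy_twistGraph {n n' : ℕ} (h1 : 1 ≤ n') (h : n' ≤ n) {O : Set (ℝ × ℝ)}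
    (hO : IsOpen O) (hq : (twistParam n' 0, (0 : ℝ)) ∈ O) :
    ∃ (P : (ℝ × ℝ) × ℝ → ℝ × ℝ) (N : Set (ℝ × ℝ)), IsCompactIsotopy P ∧ IsCompact N ∧
      IsPreconnected N ∧ N ⊆ O ∧
      (∀ z ∉ N, (P (z, 0) ∈ twistGraph n ↔ z ∈ twistGraph n') ∧ ((P (z, 0)).2 = 0 ↔ z.2 = 0)) ∧
      ∃ r > twistParam n 0, ∀ x ∈ Icc 0 r, ∀ y, |y| ≤ |twistWave n x| →
        ∃ z ∈ N, P (z, 0) = (x, y) := by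
  have hn0 : 0 < n := by omega
  have hnR : (0 : ℝ) < n := by exact_mod_cast hn0
  have hnR' : (0 : ℝ) < n' := by exact_mod_cast h1
  set q := twistParam n' 0 with hqdef
  have hq0 : 0 < q := twistParam_pos h1
  have hq1 : q < 1 := twistParam_lt_one h1
  have hqn : n' * q = 1 / 2 := by
    simp only [hqdef, twistParam]; field_simp; simp
  -- choice of the window
  obtain ⟨ρ, hρ, hball⟩ := Metric.isOpen_iff.1 hO _ hq
  have hw : ∀ᶠ x in 𝓝 q, |twistWave n' x| < ρ := by
    have : ContinuousAt (fun x => |twistWave n' x|) q :=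
      (continuous_twistWave n').abs.continuousAt
    refine this.eventually_lt continuousAt_const ?_
    rw [hqdef, twistWave_twistParam h1]
    simpa using hρ
  obtain ⟨ε', hε', hwε⟩ := Metric.eventually_nhds_iff.1 hw
  obtain ⟨ε, hε, hεb⟩ : ∃ ε > 0, ε < ε' ∧ ε < ρ ∧ ε < q ∧ ε < 1 - q := by
    obtain ⟨ε, h1, h2⟩ := exists_between (lt_min (lt_min hε' hρ) (lt_min hq0 (sub_pos.2 hq1)))
    simp only [lt_min_iff] at h2
    exact ⟨ε, h1, h2.1.1, h2.1.2, h2.2.1, h2.2.2⟩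
  obtain ⟨hε1, hε2, hε3, hε4⟩ := hεb
  set x₀ := q - ε
  set x₁ := q + ε
  have hx0 : 0 < x₀ := by simp only [x₀]; linarith
  have hx01 : x₀ < x₁ := by simp only [x₀, x₁]; linarith
  have hx1 : x₁ ≤ 1 := by simp only [x₁]; linarith
  have hlt : (n' / n : ℝ) ≤ 1 := by rw [div_le_one hnR]; exact_mod_cast h
  have hpos : (0 : ℝ) < n' / n := by positivity
  -- The rescaling sends the first crossing of the short row to the crossing of index `n - n'` of
  -- the long one. The window thus has to absorb the crossings of indices `0` to `n - n'`.
  have hqr : (1 - (1 - q) * (n' / n) : ℝ) = 1 - n' / n + twistParam n 0 := by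
    have : twistParam n 0 = q * (n' / n) := by
      rw [← mul_div_assoc, mul_comm q, hqn, twistParam]; field_simp; simp
    rw [this]; ring
  have hr : twistParam n 0 < 1 - (1 - x₁) * (n' / n) := by
    have : (1 - (1 - x₁) * (n' / n) : ℝ) = 1 - (1 - q) * (n' / n) + ε * (n' / n) := by
      simp only [x₁]; ring
    rw [this, hqr]
    have := mul_pos hε hpos
    linarith
  obtain ⟨φ, hφ, hφc, hφ1, hφ0, hφx0, hφr⟩ := exists_stretching_function hx0 hx01 hx1 hpos hlt
  -- the heights
  set η := |twistWave n' x₀| with hη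
  have hη0 : 0 < η := by
    rw [hη, abs_pos, Ne, twistWave_eq_zero_iff]
    rintro ⟨j, -, hj⟩
    have : q ≤ twistParam n' j := by
      simp only [hqdef, twistParam]; gcongr; simp
    simp only [x₀] at hj; linarith
  have hηle : ∀ x, x ≤ x₀ → η ≤ |twistWave n' x| := by
    intro x hx
    rcases le_total x 0 with h0 | h0
    · rw [abs_twistWave_of_nonpos _ h0]; exact abs_twistWave_le_one _ _
    · have hx' : x ≤ 1 := by linarith
      have hpi := Real.pi_pos
      have hle : n' * Real.pi * x₀ ≤ Real.pi / 2 := by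
        have : n' * x₀ ≤ 1 / 2 := by rw [← hqn]; gcongr; simp only [x₀]; linarith
        nlinarith
      have hc0 : 0 ≤ Real.cos (n' * Real.pi * x₀) :=
        Real.cos_nonneg_of_neg_pi_div_two_le_of_le (by
          have : 0 ≤ n' * Real.pi * x₀ := by positivity
          linarith) hle
      rw [hη, twistWave_eq_cos _ h0 hx', twistWave_eq_cos _ hx0.le (by linarith), abs_of_nonneg hc0]
      refine le_trans ?_ (le_abs_self _)
      exact Real.cos_le_cos_of_nonneg_of_le_pi (by positivity) (by linarith) (by gcongr)
  have hη1 : η ≤ 1 := abs_twistWave_le_one _ _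
  -- The band `|y| ≤ a x` is stretched to `|y| ≤ u x`. Left of the window `a` is the wave itself and
  -- `u = 1`, so strands go to horizontal strands; right of it `u = a` and heights are unchanged.
  -- The floor `η` keeps `a` positive across the zeros of the wave.
  set a : ℝ → ℝ := fun x => max |twistWave n' x| η with ha
  set u : ℝ → ℝ := fun x => max (a x) |twistWave n (φ x)| with hu
  have hac : Continuous a := (continuous_twistWave n').abs.max continuous_const
  have huc : Continuous u := hac.max ((continuous_twistWave n).comp hφc).abs
  have ha0 : ∀ x, 0 < a x := fun x => hη0.trans_le (le_max_right _ _)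
  have ha1 : ∀ x, a x ≤ 1 := fun x => max_le (abs_twistWave_le_one _ _) hη1
  have hau : ∀ x, a x ≤ u x := fun x => le_max_left _ _
  have hu1 : ∀ x, u x ≤ 1 := fun x => max_le (ha1 x) (abs_twistWave_le_one _ _)
  have hul : ∀ x, x ≤ x₀ → u x = 1 ∧ |twistWave n (φ x)| = 1 ∧ a x = |twistWave n' x| := by
    intro x hx
    have := abs_twistWave_of_nonpos n (hφ0 x hx)
    exact ⟨by simp only [hu, this]; exact max_eq_right (ha1 x), this, max_eq_left (hηle x hx)⟩
  have hur : ∀ x, x₁ ≤ x → |twistWave n (φ x)| = |twistWave n' x| ∧ u x = a x := by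
    intro x hx
    have hge : (1 - x) * (n' / n : ℝ) ≤ (1 - x₁) * (n' / n) := by gcongr
    have : |twistWave n (φ x)| = |twistWave n' x| := by
      rw [hφr x hx]
      exact abs_twistWave_comp_right hn0 h (by linarith [twistParam_pos hn0]) (by linarith)
    refine ⟨this, ?_⟩
    simp only [hu, this, ha]
    exact max_eq_left (le_max_left _ _)
  have hau1 : ∀ x, 1 ≤ |x| → a x = u x := by
    intro x hx
    rcases le_abs'.1 hx with h | h
    · rw [(hul x (by linarith)).1, (hul x (by linarith)).2.2, abs_twistWave_of_nonpos _ (by linarith)]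
    · exact (hur x (by linarith)).2.symm
  set g : ℝ × ℝ → ℝ × ℝ := fun p => (p.1, p.2 * a p.1) with hg
  have hgc : Continuous g := by fun_prop
  set N := g '' (Icc x₀ x₁ ×ˢ Icc (-1) 1) with hN
  have hNmem : ∀ x y, (x, y) ∈ N ↔ x ∈ Icc x₀ x₁ ∧ |y| ≤ a x := by
    intro x y
    constructor
    · rintro ⟨⟨x', s⟩, ⟨hx', hs⟩, heq⟩
      simp only [hg, Prod.mk.injEq] at heq
      obtain ⟨rfl, rfl⟩ := heq
      refine ⟨hx', ?_⟩
      rw [abs_mul, abs_of_pos (ha0 _)]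
      exact mul_le_of_le_one_left (ha0 _).le (abs_le.2 hs)
    · rintro ⟨hx, hy⟩
      refine ⟨(x, y / a x), ⟨hx, ?_⟩, ?_⟩
      · rw [mem_Icc, ← abs_le, abs_div, abs_of_pos (ha0 x)]
        exact (div_le_one (ha0 x)).2 hy
      · simp only [hg, div_mul_cancel₀ _ (ha0 x).ne']
  have hv0 : ∀ x y, stretch (a x) (u x) y = 0 ↔ y = 0 := by
    intro x y
    have := (stretch_strictMono (ha0 x) (hau x) (hu1 x)).injective.eq_iff (a := y) (b := 0)
    rwa [stretch_zero (ha0 x) (hau x) (hu1 x)] at this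
  refine ⟨planeIsotopy φ a u, N,
    isCompactIsotopy_planeIsotopy hφ hφc hφ1 hac huc ha0 hau hu1 hau1,
    (isCompact_Icc.prod isCompact_Icc).image hgc,
    (isPreconnected_Icc.prod isPreconnected_Icc).image _ hgc.continuousOn, ?_, ?_,
    1 - (1 - x₁) * (n' / n), hr, ?_⟩
  · rintro ⟨x, y⟩ hxy
    obtain ⟨hx, hy⟩ := (hNmem x y).1 hxy
    apply hball
    have hxq : |x - q| ≤ ε := abs_le.2 ⟨by simp only [x₀] at hx; linarith [hx.1],
      by simp only [x₁] at hx; linarith [hx.2]⟩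
    rw [Metric.mem_ball, Prod.dist_eq, Real.dist_eq, Real.dist_eq, sub_zero]
    refine max_lt (by linarith) (hy.trans_lt (max_lt (hwε ?_) (hwε ?_)))
    · rw [Real.dist_eq]; linarith
    · rw [Real.dist_eq]; simp only [x₀]
      rw [abs_lt]; constructor <;> linarith
  · rintro ⟨x, y⟩ hxy
    rw [hNmem, not_and_or] at hxy
    refine ⟨?_, by rw [planeIsotopy_zero]; exact hv0 x y⟩
    -- Above height `1` the horizontal cut-off may act, but no strand reaches that height before or
    -- after the isotopy.
    rcases lt_or_ge 1 |stretch (a x) (u x) y| with hv | hv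
    · have hy : a x < |y| := by
        rw [← not_le, ← abs_stretch_le_iff (ha0 x) (hau x) (hu1 x), not_le]
        exact (hu1 x).trans_lt hv
      refine iff_of_false ?_ ?_
      · rw [planeIsotopy_zero]
        exact fun hh => absurd (hh.le.trans (abs_twistWave_le_one _ _)) (not_le.2 hv)
      · intro hh
        exact absurd ((le_max_left _ _).trans_lt hy) (not_lt.2 hh.le)
    · rw [planeIsotopy_zero_of_le_one hv]
      simp only [twistGraph, mem_ofPred_eq]
      by_cases hx : x ∈ Icc x₀ x₁
      · have hy : a x < |y| := not_le.1 (hxy.resolve_left (not_not.2 hx))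
        refine iff_of_false ?_ ?_
        · have : u x < |stretch (a x) (u x) y| := by
            rwa [← not_le, abs_stretch_le_iff (ha0 x) (hau x) (hu1 x), not_le]
          exact ((le_max_right _ _).trans_lt this).ne'
        · exact ((le_max_left _ _).trans_lt hy).ne'
      · rcases lt_or_ge x x₀ with hx' | hx'
        · obtain ⟨e1, e2, e3⟩ := hul x hx'.le
          rw [e2, ← e1, abs_stretch_eq_iff (ha0 x) (hau x) (hu1 x), e3]
        · have hx'' : x₁ ≤ x := by
            by_contra hcon
            exact hx ⟨hx', (not_le.1 hcon).le⟩
          obtain ⟨e1, e2⟩ := hur x hx''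
          rw [e1, e2, stretch_of_eq (ha0 x) (ha1 x)]
  · intro X hX y hy
    -- The window is mapped onto an interval containing `[0, r]`, and over each of its points the
    -- stretched band contains everything between the strands of the long row.
    have hX' : X ∈ Icc (φ x₀) (φ x₁) := by
      rw [hφx0, hφr x₁ le_rfl]
      exact ⟨hX.1, hX.2.trans (le_max_right _ _)⟩
    obtain ⟨x, hx, rfl⟩ := intermediate_value_Icc hx01.le hφc.continuousOn hX'
    obtain ⟨s, rfl⟩ := (stretch_bijective (ha0 x) (hau x) (hu1 x)).2 y
    refine ⟨(x, s), (hNmem x s).2 ⟨hx, ?_⟩, planeIsotopy_zero_of_le_one ?_⟩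
    · rw [← abs_stretch_le_iff (ha0 x) (hau x) (hu1 x)]
      exact hy.trans (le_max_right _ _)
    · exact hy.trans (abs_twistWave_le_one _ _)

/-! ### Extending compactly supported maps -/

theorem bijective_extend {X Y : Type*} {e : X → Y} (he : Function.Injective e) {p : X → X}
    (hp : Function.Bijective p) : Function.Bijective (Function.extend e (e ∘ p) id) := by
  have h1 : ∀ x, Function.extend e (e ∘ p) id (e x) = e (p x) := fun x => he.extend_apply _ _ _
  have h2 : ∀ y, y ∉ range e → Function.extend e (e ∘ p) id y = y := fun y hy =>
    Function.extend_apply' _ _ _ hy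
  constructor
  · intro y y' h
    by_cases hy : y ∈ range e <;> by_cases hy' : y' ∈ range e
    · obtain ⟨x, rfl⟩ := hy
      obtain ⟨x', rfl⟩ := hy'
      rw [h1, h1] at h
      rw [hp.1 (he h)]
    · obtain ⟨x, rfl⟩ := hy
      rw [h1, h2 _ hy'] at h
      exact absurd ⟨_, h⟩ hy'
    · obtain ⟨x, rfl⟩ := hy'
      rw [h1, h2 _ hy] at h
      exact absurd ⟨_, h.symm⟩ hy
    · rwa [h2 _ hy, h2 _ hy'] at h
  · intro y
    by_cases hy : y ∈ range e
    · obtain ⟨x, rfl⟩ := hy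
      obtain ⟨x', rfl⟩ := hp.2 x
      exact ⟨e x', h1 x'⟩
    · exact ⟨y, h2 y hy⟩

section extend

variable {X Y Z F : Type*} [TopologicalSpace X] [TopologicalSpace Y] [TopologicalSpace Z]
  [TopologicalSpace F]

/-- At a point outside the chart, the closed set `e '' C` can be avoided, and there the extension is
just `f`. This one gluing statement serves the homeomorphisms of `F`, the maps of `Y`, the new
projection and the new height. -/
theorem continuous_extend [T2Space Y] {e : X → Y} (he : IsOpenEmbedding e) {g : X → Z} {f : Y → Z}
    (hg : Continuous g) (hf : Continuous f) {C : Set X} (hC : IsCompact C)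
    (h : ∀ x ∉ C, g x = f (e x)) : Continuous (Function.extend e g f) := by
  rw [continuous_iff_continuousAt]
  intro y
  by_cases hy : y ∈ range e
  · obtain ⟨x, rfl⟩ := hy
    rw [← he.continuousAt_iff, Function.extend_comp he.injective]
    exact hg.continuousAt
  · have hCo : IsOpen (e '' C)ᶜ := (hC.image he.continuous).isClosed.isOpen_compl
    refine hf.continuousAt.congr ?_
    filter_upwards [hCo.mem_nhds fun hc => hy (image_subset_range _ _ hc)] with z hz
    by_cases hz' : z ∈ range e
    · obtain ⟨x, rfl⟩ := hz'
      rw [he.injective.extend_apply, h x fun hx => hz (mem_image_of_mem _ hx)]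
    · rw [Function.extend_apply' _ _ _ hz']

theorem IsCompactIsotopy.exists_homeomorph [T2Space F] [CompactSpace F] {e : X → F}
    (he : IsOpenEmbedding e) {P : X × ℝ → X} (hP : IsCompactIsotopy P) :
    ∃ h : F ≃ₜ F, (∀ x, h (e x) = e (P (x, 0))) ∧ ∀ y ∉ range e, h y = y := by
  have hc : Continuous fun x => P (x, 0) := hP.continuous.comp (by fun_prop)
  obtain ⟨C, hC, hPC⟩ := hP.eq_off_compact
  have hcont : Continuous (Function.extend e (e ∘ fun x => P (x, 0)) id) :=
    continuous_extend he (he.continuous.comp hc) continuous_id hC fun x hx => by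
      simp [hPC x 0 hx]
  refine ⟨Continuous.homeoOfEquivCompactToT2
    (f := Equiv.ofBijective _ (bijective_extend he.injective (hP.bijective 0))) hcont, ?_, ?_⟩
  · exact fun x => he.injective.extend_apply _ _ _
  · exact fun y hy => Function.extend_apply' _ _ _ hy

theorem IsEssential.comp_homeomorph {α : Circle → F} (hα : IsEssential α) (h : F ≃ₜ F) :
    IsEssential (h ∘ α) := by
  refine ⟨h.continuous.comp hα.1, h.injective.comp hα.2.1, ?_⟩
  rintro ⟨δ, hδ, hδα⟩
  refine hα.2.2 ⟨h.symm ∘ δ, h.symm.isOpenEmbedding.comp hδ, ?_⟩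
  rw [image_comp, hδα, range_comp, ← image_comp]
  simp

/-- The isotopy extends to the ambient space along the product neighbourhood of the surface. -/
theorem IsCompressionDisk.exists_comp [T2Space Y] {c : F × ℝ → Y} (hc : IsOpenEmbedding c)
    {e : X → F} (he : IsOpenEmbedding e) {P : X × ℝ → X} (hP : IsCompactIsotopy P) {h : F ≃ₜ F}
    (h1 : ∀ x, h (e x) = e (P (x, 0))) (h2 : ∀ y ∉ range e, h y = y) {δ : ℂ → Y} {α : Circle → F}
    (hδ : IsCompressionDisk c δ α) : ∃ δ' : ℂ → Y, IsCompressionDisk c δ' (h ∘ α) := by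
  set e' : X × ℝ → Y := fun p => c (e p.1, p.2) with he'def
  have he' : IsOpenEmbedding e' := hc.comp (he.prodMap IsOpenEmbedding.id)
  -- The time of the isotopy becomes the normal coordinate: the surface at level `0` feels the final
  -- map, and the motion has died out at levels `± 1`.
  set p : X × ℝ → X × ℝ := fun q => (P q, q.2)
  have hpc : Continuous p := hP.continuous.prodMk continuous_snd
  have hpb : Function.Bijective p := by
    constructor
    · rintro ⟨x, t⟩ ⟨x', t'⟩ hq
      simp only [p, Prod.mk.injEq] at hq
      obtain ⟨hq, rfl⟩ := hq
      rw [(hP.bijective t).1 hq]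
    · rintro ⟨x, t⟩
      obtain ⟨x', hx'⟩ := (hP.bijective t).2 x
      exact ⟨(x', t), by simp only [p]; simp only at hx'; rw [hx']⟩
  obtain ⟨C, hC, hPC⟩ := hP.eq_off_compact
  set H := Function.extend e' (e' ∘ p) id with hH
  have hHc : Continuous H := by
    refine continuous_extend he' (he'.continuous.comp hpc) continuous_id
      (hC.prod (isCompact_Icc (a := (-1 : ℝ)) (b := 1))) ?_
    rintro ⟨x, t⟩ hq
    rw [mem_prod, not_and_or, mem_Icc, ← abs_le, not_le] at hq
    have : P (x, t) = x := hq.elim (fun hq => hPC x t hq) fun hq => hP.eq_of_one_le x t hq.le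
    simp [p, this]
  have hHb : Function.Bijective H := bijective_extend he'.injective hpb
  have hHe : ∀ q, H (e' q) = e' (p q) := fun q => he'.injective.extend_apply _ _ _
  have hHn : ∀ y ∉ range e', H y = y := fun y hy => Function.extend_apply' _ _ _ hy
  have hmem : ∀ z t, c (z, t) ∈ range e' → z ∈ range e := by
    rintro z t ⟨⟨x, t'⟩, hx⟩
    have := hc.injective hx
    simp only [Prod.mk.injEq] at this
    exact ⟨x, this.1⟩
  have hH0 : ∀ z, H (c (z, 0)) = c (h z, 0) := by
    intro z
    by_cases hz : z ∈ range e
    · obtain ⟨x, rfl⟩ := hz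
      exact (hHe (x, 0)).trans (by simp only [e', p, h1])
    · rw [hHn _ fun hh => hz (hmem z 0 hh), h2 z hz]
  -- Levels are preserved, so points off the surface stay off it; this keeps the interior of the
  -- disk away from `F`.
  have hH1 : ∀ y z, H y = c (z, 0) → ∃ z', y = c (z', 0) := by
    intro y z hy
    by_cases hy' : y ∈ range e'
    · obtain ⟨⟨x, t⟩, rfl⟩ := hy'
      rw [hHe] at hy
      have := hc.injective hy
      simp only [p, Prod.mk.injEq] at this
      exact ⟨e x, by simp only [e', this.2]⟩
    · exact ⟨z, by rw [← hy, hHn y hy']⟩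
  obtain ⟨hδc, hδi, hδb, hδd, hα⟩ := hδ
  refine ⟨H ∘ δ, hHc.comp_continuousOn hδc, hHb.1.comp_injOn hδi, ?_, ?_, hα.comp_homeomorph h⟩
  · intro z
    simp only [Function.comp, hδb z, hH0]
  · intro z hz x hx
    obtain ⟨z', hz'⟩ := hH1 _ _ hx
    exact hδd z hz z' hz'

/-- All rows are moved simultaneously by treating the disjoint disks as one chart with domain `Fin m
× X`. -/
theorem isCompactIsotopy_fin {m : ℕ} {P : Fin m → X × ℝ → X} (hP : ∀ i, IsCompactIsotopy (P i)) :
    IsCompactIsotopy fun p : (Fin m × X) × ℝ => (p.1.1, P p.1.1 (p.1.2, p.2)) := by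
  constructor
  · have h : Continuous fun q : Fin m × (X × ℝ) => (q.1, P q.1 q.2) := by
      rw [continuous_prod_of_discrete_left]
      exact fun i => continuous_const.prodMk (hP i).continuous
    exact h.comp (f := fun p : (Fin m × X) × ℝ => (p.1.1, (p.1.2, p.2))) (by fun_prop)
  · intro t
    constructor
    · rintro ⟨i, x⟩ ⟨i', x'⟩ h
      simp only [Prod.mk.injEq] at h
      obtain ⟨rfl, h⟩ := h
      rw [((hP i).bijective t).1 h]
    · rintro ⟨i, x⟩
      obtain ⟨x', hx'⟩ := ((hP i).bijective t).2 x
      exact ⟨(i, x'), by simp only at hx' ⊢; rw [hx']⟩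
  · choose C hC hPC using fun i => (hP i).eq_off_compact
    refine ⟨⋃ i, {i} ×ˢ C i, isCompact_iUnion fun i => isCompact_singleton.prod (hC i), ?_⟩
    rintro ⟨i, x⟩ t hx
    simp only [mem_iUnion, mem_prod, mem_singleton_iff, not_exists, not_and] at hx
    simp only [hPC i x t (hx i rfl)]
  · rintro ⟨i, x⟩ t ht
    simp only [(hP i).eq_of_one_le x t ht]

end extend

/-! ### Transporting transverse intersections -/

section transport

variable {F : Type*} [TopologicalSpace F] [T2Space F]

/-- The image of the parameters away from `t` is compact and misses `γ t`, so close to this point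
the curve is traced only by parameters close to `t`. -/
theorem eventually_mem_image_of_unique {γ : Circle → F} (hγ : Continuous γ) {t : Circle}
    (ht : ∀ t', γ t' = γ t → t' = t) {V : Set Circle} (hV : V ∈ 𝓝 t) :
    ∀ᶠ p in 𝓝 (γ t), p ∈ range γ → p ∈ γ '' V := by
  have hcl : IsClosed (γ '' (interior V)ᶜ) :=
    (isOpen_interior.isClosed_compl.isCompact.image hγ).isClosed
  have hn : γ t ∉ γ '' (interior V)ᶜ := by
    rintro ⟨t', ht', h⟩
    rw [ht t' h] at ht'
    exact ht' (mem_interior_iff_mem_nhds.2 hV)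
  filter_upwards [hcl.isOpen_compl.mem_nhds hn]
  rintro _ hp ⟨v, rfl⟩
  refine ⟨v, ?_, rfl⟩
  by_contra hv
  exact hp ⟨v, fun h => hv (interior_subset h), rfl⟩

/-- The chart is `ψ` precomposed with `h.symm`. The axis conditions concern points only, so it
suffices that the images of `γ` and `h ∘ γ'` are related near the point; the parametrizations need
not correspond, and local injectivity of `γ` is supplied separately. -/
theorem TransverseAt.transport {γ γ' α : Circle → F} (hγ : Continuous γ) (hγ' : Continuous γ')
    {s t t₂ : Circle} (hinj : ∃ U ∈ 𝓝 t₂, InjOn γ U) (h : F ≃ₜ F) (hαγ : TransverseAt α s γ' t)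
    (ht : ∀ t', γ' t' = γ' t → t' = t) (ht₂ : γ t₂ = h (γ' t))
    (hD : ∀ᶠ p in 𝓝 (γ' t), h p ∈ range γ → p ∈ range γ') : TransverseAt (h ∘ α) s γ t₂ := by
  obtain ⟨hst, ψ, hψs, hψ0, ⟨U, hU, hUi, hUm, hU0⟩, V, hV, hVi, hVm, hV0⟩ := hαγ
  obtain ⟨V₁, hV₁, hV₁i⟩ := hinj
  have hev := (eventually_mem_image_of_unique hγ' ht hV).and hD
  have hcont : ContinuousAt (h.symm ∘ γ) t₂ := (h.symm.continuous.comp hγ).continuousAt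
  have heq : (h.symm ∘ γ) t₂ = γ' t := by simp [ht₂]
  have hev' : ∀ᶠ v in 𝓝 t₂, h.symm (γ v) ∈ γ' '' V := by
    have := hcont.eventually (heq ▸ hev)
    filter_upwards [this] with v hv
    exact hv.1 (hv.2 (by simp))
  refine ⟨by simp [ht₂, hst], h.symm.transOpenPartialHomeomorph ψ, ?_, ?_,
    ⟨U, hU, h.injective.comp_injOn hUi, ?_, ?_⟩, V₁ ∩ {v | h.symm (γ v) ∈ γ' '' V},
    Filter.inter_mem hV₁ hev', hV₁i.mono inter_subset_left, ?_, ?_⟩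
  · simpa using hψs
  · simpa using hψ0
  · intro v hv
    simpa using hUm hv
  · intro v hv
    simpa using hU0 v hv
  · rintro v ⟨-, w, hw, hwv⟩
    simpa [← hwv] using hVm hw
  · rintro v ⟨-, w, hw, hwv⟩
    simpa [← hwv] using hV0 w hw

/-- The set `A` contains the region where `h` fails to match the two diagrams. Since `α` avoids it,
both the intersection count and the absence of double points on the curve carry over. -/
theorem MeetsTransversely.transport {γ γ' α : Circle → F} (hγ : Continuous γ)
    (hγ' : Continuous γ') (hinj : ∀ t, ∃ U ∈ 𝓝 t, InjOn γ U) (h : F ≃ₜ F) {A : Set F}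
    (hA : IsClosed A) (hαA : ∀ s, α s ∉ A) (hD : ∀ p ∉ A, h p ∈ range γ ↔ p ∈ range γ')
    (hX : ∀ p ∉ A, ∀ t t', γ t = h p → γ t' = h p → t ≠ t' →
      ∃ u u', γ' u = p ∧ γ' u' = p ∧ u ≠ u')
    (hα : MeetsTransversely α γ') :
    MeetsTransversely (h ∘ α) γ ∧ numIntersections (h ∘ α) γ = numIntersections α γ' := by
  constructor
  · intro s t₂ hs
    obtain ⟨t, ht⟩ := (hD _ (hαA s)).1 ⟨t₂, hs.symm⟩
    obtain ⟨h1, h2⟩ := hα s t ht.symm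
    constructor
    · intro t' ht'
      by_contra hne
      obtain ⟨u, u', hu, hu', huu⟩ := hX _ (hαA s) t' t₂ (ht'.trans hs.symm) hs.symm hne
      rw [← ht] at hu hu'
      exact huu ((h1 u hu).trans (h1 u' hu').symm)
    · refine h2.transport hγ hγ' (hinj t₂) h h1 (by rw [ht, ← hs]; rfl) ?_
      filter_upwards [hA.isOpen_compl.mem_nhds (ht ▸ hαA s : γ' t ∈ Aᶜ)] with p hp
      exact (hD p hp).1
  · unfold numIntersections
    congr 1
    ext s
    exact hD _ (hαA s)

/-- Three arcs that meet in a common end point only do not lie in an arc. -/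
theorem IsArc.false_of_triod {S : Set F} (hS : IsArc S) {p : F} {C : Fin 3 → Set F}
    (hC : ∀ k, IsPreconnected (C k)) (hCS : ∀ k, C k ⊆ S) (hp : ∀ k, p ∈ C k)
    (hne : ∀ k, ∃ x ∈ C k, x ≠ p) (hd : ∀ k l, k ≠ l → C k ∩ C l ⊆ {p}) : False := by
  obtain ⟨f, hf, hfi, rfl⟩ := hS
  set g : Icc (0 : ℝ) 1 → F := fun t => f t
  have hgc : Continuous g := continuousOn_iff_continuous_domRestrict.1 hf
  have hgi : Function.Injective g := fun a b h => Subtype.ext (hfi a.2 b.2 h)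
  have hge : IsClosedEmbedding g := hgc.isClosedEmbedding hgi
  have hsurj : ∀ k, ∀ x ∈ C k, ∃ t, g t = x := by
    intro k x hx
    obtain ⟨t, ht, rfl⟩ := hCS k hx
    exact ⟨⟨t, ht⟩, rfl⟩
  -- In the parameter interval the three sets become intervals through `t₀`, each with a point other
  -- than `t₀`. Two of them must extend to the same side of `t₀`, and there they overlap.
  have hconn : ∀ k, (g ⁻¹' C k).OrdConnected := by
    intro k
    refine IsPreconnected.ordConnected ?_
    rw [← hge.isInducing.isPreconnected_image, image_preimage_eq_of_subset (hsurj k)]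
    exact hC k
  obtain ⟨t₀, ht₀⟩ := hsurj 0 p (hp 0)
  have ht₀' : ∀ k, t₀ ∈ g ⁻¹' C k := fun k => by simpa [ht₀] using hp k
  have hex : ∀ k, ∃ t, t ∈ g ⁻¹' C k ∧ t ≠ t₀ := by
    intro k
    obtain ⟨x, hx, hxp⟩ := hne k
    obtain ⟨t, rfl⟩ := hsurj k x hx
    exact ⟨t, hx, fun h => hxp (h ▸ ht₀)⟩
  choose t ht htne using hex
  have hcap : ∀ k l, k ≠ l → ∀ s ∈ g ⁻¹' C k, s ∈ g ⁻¹' C l → s = t₀ := by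
    intro k l hkl s hsk hsl
    exact hgi ((hd k l hkl ⟨hsk, hsl⟩).trans ht₀.symm)
  have hright : ∀ k l, k ≠ l → t₀ < t k → ¬ t₀ < t l := by
    intro k l hkl hk hl
    rcases le_total (t k) (t l) with hle | hle
    · exact htne k (hcap k l hkl _ (ht k) ((hconn l).out (ht₀' l) (ht l) ⟨hk.le, hle⟩))
    · exact htne l (hcap k l hkl _ ((hconn k).out (ht₀' k) (ht k) ⟨hl.le, hle⟩) (ht l))
  have hleft : ∀ k l, k ≠ l → t k < t₀ → ¬ t l < t₀ := by
    intro k l hkl hk hl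
    rcases le_total (t k) (t l) with hle | hle
    · exact htne l (hcap k l hkl _ ((hconn k).out (ht k) (ht₀' k) ⟨hle, hl.le⟩) (ht l))
    · exact htne k (hcap k l hkl _ (ht k) ((hconn l).out (ht l) (ht₀' l) ⟨hle, hk.le⟩))
  have h01 := hright 0 1 (by decide)
  have h12 := hright 1 2 (by decide)
  have h02 := hright 0 2 (by decide)
  have g01 := hleft 0 1 (by decide)
  have g12 := hleft 1 2 (by decide)
  have g02 := hleft 0 2 (by decide)
  rcases lt_or_gt_of_ne (htne 0) with h | h <;> rcases lt_or_gt_of_ne (htne 1) with h' | h' <;>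
    rcases lt_or_gt_of_ne (htne 2) with h'' | h'' <;> tauto

end transport

/-! ### Twist systems -/

theorem isOpenEmbedding_fin {X Y : Type*} [TopologicalSpace X] [TopologicalSpace Y] {m : ℕ}
    {e : Fin m → X → Y} (he : ∀ i, IsOpenEmbedding (e i))
    (hd : ∀ i j, i ≠ j → Disjoint (range (e i)) (range (e j))) :
    IsOpenEmbedding fun p : Fin m × X => e p.1 p.2 := by
  refine IsOpenEmbedding.of_continuous_injective_isOpenMap ?_ ?_ ?_
  · rw [continuous_prod_of_discrete_left]
    exact fun i => (he i).continuous
  · rintro ⟨i, x⟩ ⟨j, y⟩ h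
    simp only at h
    obtain rfl : i = j := by
      by_contra hij
      exact (Set.disjoint_left.1 (hd i j hij)) ⟨x, rfl⟩ ⟨y, h.symm⟩
    rw [(he i).injective h]
  · intro U hU
    have : (fun p : Fin m × X => e p.1 p.2) '' U = ⋃ i, e i '' {x | (i, x) ∈ U} := by
      ext y
      simp only [mem_image, mem_iUnion, mem_ofPred_eq, Prod.exists]
    rw [this]
    exact isOpen_iUnion fun i => (he i).isOpenMap _ (hU.preimage (by fun_prop))

theorem continuous_twistPoint (n : ℕ) (b : Bool) : Continuous (twistPoint n b) :=
  continuous_id.prodMk (continuous_const.mul (continuous_twistWave n))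

theorem twistPoint_mem_twistGraph (n : ℕ) (b : Bool) (x : ℝ) : twistPoint n b x ∈ twistGraph n := by
  cases b <;> simp [twistPoint, twistGraph]

theorem exists_twistPoint_eq {n : ℕ} {z : ℝ × ℝ} (hz : z ∈ twistGraph n) :
    ∃ b, twistPoint n b z.1 = z := by
  rcases abs_eq_abs.1 hz with h | h
  · exact ⟨true, by ext <;> simp [twistPoint, h]⟩
  · exact ⟨false, by ext <;> simp [twistPoint, h]⟩

theorem twistPoint_eq_iff {n : ℕ} {b b' : Bool} {x x' : ℝ} :
    twistPoint n b x = twistPoint n b' x' ↔ x = x' ∧ (b = b' ∨ twistWave n x = 0) := by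
  simp only [twistPoint, Prod.mk.injEq]
  constructor
  · rintro ⟨rfl, h⟩
    refine ⟨rfl, ?_⟩
    cases b <;> cases b' <;> simp at h ⊢ <;> linarith
  · rintro ⟨rfl, rfl | h⟩
    · simp
    · simp [h]

/-- The abscissa in the chart recovers the parameter: composing it with the strands gives the
projection `Bool × ℝ → ℝ`, which is proper. Hence the strands are proper into the open preimage of
the disk, and by `exists_strand` they fill it. -/
theorem TwistChart.isOpenEmbedding_strand {F : Type*} [TopologicalSpace F] {K : KnotDiagram F}
    {n : ℕ} (T : TwistChart K n) : IsOpenEmbedding fun p : Bool × ℝ => T.strand p.1 p.2 := by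
  set U : Set Circle := K.proj ⁻¹' range T.chart with hU
  have hUo : IsOpen U := T.isOpenEmbedding.isOpen_range.preimage K.continuous_proj
  have hmem : ∀ p : Bool × ℝ, T.strand p.1 p.2 ∈ U := fun p => ⟨_, (T.proj_strand p.1 p.2).symm⟩
  have hc : Continuous fun p : Bool × ℝ => T.strand p.1 p.2 := by
    rw [continuous_prod_of_discrete_left]
    exact fun b => T.continuous_strand b
  set f : Bool × ℝ → U := fun p => ⟨T.strand p.1 p.2, hmem p⟩
  have hf : Continuous f := hc.subtype_mk _
  set g : U → ℝ := fun s => (T.isOpenEmbedding.isEmbedding.toHomeomorph.symm ⟨K.proj s, s.2⟩).1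
  have hg : Continuous g := by
    refine continuous_fst.comp ((Homeomorph.continuous _).comp ?_)
    exact (K.continuous_proj.comp continuous_subtype_val).subtype_mk _
  have hgf : g ∘ f = Prod.snd := by
    funext p
    have : (⟨K.proj (f p), (f p).2⟩ : range T.chart) =
        T.isOpenEmbedding.isEmbedding.toHomeomorph (twistPoint n p.1 p.2) :=
      Subtype.ext (T.proj_strand p.1 p.2)
    simp only [g, Function.comp, this, Homeomorph.symm_apply_apply]
    rfl
  have hp : IsProperMap f := isProperMap_of_comp_of_t2 hf hg (by
    rw [hgf]; exact isProperMap_snd_of_compactSpace)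
  have hinj : Function.Injective f := fun p q h => T.injective_strand (congrArg Subtype.val h)
  have hemb : IsClosedEmbedding f := .of_continuous_injective_isClosedMap hf hinj hp.isClosedMap
  have hsurj : range f = univ := by
    rw [range_eq_univ]
    rintro ⟨s, hs⟩
    obtain ⟨b, x, h⟩ := T.exists_strand s hs
    exact ⟨(b, x), Subtype.ext h⟩
  exact hUo.isOpenEmbedding_subtypeVal.comp ⟨hemb.isEmbedding, by rw [hsurj]; exact isOpen_univ⟩

/-- In the disjoint disks given by `E`, the closed curve `γ` is the standard picture of `n i`
crossings, with the parameters of the strands given by `S`. -/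
structure IsTwistSystem {F : Type*} [TopologicalSpace F] {m : ℕ} (γ : Circle → F) (n : Fin m → ℕ)
    (E : Fin m × (ℝ × ℝ) → F) (S : Fin m × (Bool × ℝ) → Circle) : Prop where
  chart : IsOpenEmbedding E
  strand : IsOpenEmbedding S
  apply_strand : ∀ i b x, γ (S (i, b, x)) = E (i, twistPoint (n i) b x)
  mem_range_strand : ∀ s, γ s ∈ range E → s ∈ range S

theorem isTwistSystem_of_twistChart {F : Type*} [TopologicalSpace F] {K : KnotDiagram F} {m : ℕ}
    {n : Fin m → ℕ} (T : ∀ i, TwistChart K (n i))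
    (hd : ∀ i j, i ≠ j → Disjoint (range (T i).chart) (range (T j).chart)) :
    IsTwistSystem K.proj n (fun p => (T p.1).chart p.2) fun p => (T p.1).strand p.2.1 p.2.2 where
  chart := isOpenEmbedding_fin (fun i => (T i).isOpenEmbedding) hd
  strand := isOpenEmbedding_fin (fun i => (T i).isOpenEmbedding_strand) fun i j hij => by
    rw [Set.disjoint_left]
    rintro _ ⟨p, rfl⟩ ⟨q, hq⟩
    simp only at hq
    refine (Set.disjoint_left.1 (hd i j hij)) ⟨_, ((T i).proj_strand p.1 p.2).symm⟩ ?_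
    rw [← hq]
    exact ⟨_, ((T j).proj_strand q.1 q.2).symm⟩
  apply_strand := fun i => (T i).proj_strand
  mem_range_strand := by
    rintro s ⟨⟨i, z⟩, h⟩
    obtain ⟨b, x, hx⟩ := (T i).exists_strand s ⟨z, h⟩
    exact ⟨(i, b, x), hx⟩

namespace IsTwistSystem

variable {F : Type*} [TopologicalSpace F] {m : ℕ} {γ γ' : Circle → F} {n n' : Fin m → ℕ}
  {E : Fin m × (ℝ × ℝ) → F} {S : Fin m × (Bool × ℝ) → Circle}

theorem mem_range_chart_iff (h : IsTwistSystem γ n E S) {s : Circle} :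
    γ s ∈ range E ↔ s ∈ range S := by
  refine ⟨h.mem_range_strand s, ?_⟩
  rintro ⟨⟨i, b, x⟩, rfl⟩
  exact ⟨_, (h.apply_strand i b x).symm⟩

theorem exists_strand_eq (h : IsTwistSystem γ n E S) {s : Circle} {i : Fin m} {z : ℝ × ℝ}
    (hs : γ s = E (i, z)) : ∃ b, s = S (i, b, z.1) ∧ twistPoint (n i) b z.1 = z := by
  obtain ⟨⟨j, b, x⟩, rfl⟩ := h.mem_range_strand s ⟨_, hs.symm⟩
  rw [h.apply_strand] at hs
  have := h.chart.injective hs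
  simp only [Prod.mk.injEq] at this
  obtain ⟨rfl, rfl⟩ := this
  exact ⟨b, rfl, rfl⟩

theorem chart_mem_range_iff (h : IsTwistSystem γ n E S) {i : Fin m} {z : ℝ × ℝ} :
    E (i, z) ∈ range γ ↔ z ∈ twistGraph (n i) := by
  constructor
  · rintro ⟨s, hs⟩
    obtain ⟨b, -, hz⟩ := h.exists_strand_eq hs
    rw [← hz]
    exact twistPoint_mem_twistGraph _ _ _
  · intro hz
    obtain ⟨b, hb⟩ := exists_twistPoint_eq hz
    exact ⟨S (i, b, z.1), by rw [h.apply_strand, hb]⟩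

theorem apply_eq_strand_iff (h : IsTwistSystem γ n E S) {t : Circle} {i : Fin m} {b : Bool} {x : ℝ}
    (ht : t ≠ S (i, b, x)) :
    γ t = γ (S (i, b, x)) ↔ t = S (i, !b, x) ∧ twistWave (n i) x = 0 := by
  constructor
  · intro hh
    rw [h.apply_strand] at hh
    obtain ⟨b', hb', hz⟩ := h.exists_strand_eq hh
    have hne : b' ≠ b := by
      rintro rfl
      exact ht hb'
    have : b' = !b := by cases b <;> cases b' <;> simp_all
    subst this
    refine ⟨hb', ?_⟩
    have := (twistPoint_eq_iff.1 hz).2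
    cases b <;> simpa [twistPoint] using this
  · rintro ⟨rfl, hw⟩
    rw [h.apply_strand, h.apply_strand, twistPoint_eq_iff.2 ⟨rfl, Or.inr hw⟩]

theorem strand_ne_strand_not (h : IsTwistSystem γ n E S) (i : Fin m) (b : Bool) (x : ℝ) :
    S (i, b, x) ≠ S (i, !b, x) := fun hh => by
  have := h.strand.injective hh
  simp at this

theorem mem_range_iff_of_notMem (h : IsTwistSystem γ n E S) (h' : IsTwistSystem γ' n' E S)
    (hoff : ∀ s ∉ range S, γ' s = γ s) {p : F} (hp : p ∉ range E) :
    p ∈ range γ ↔ p ∈ range γ' := by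
  constructor
  · rintro ⟨s, rfl⟩
    exact ⟨s, hoff s fun hs => hp (h.mem_range_chart_iff.2 hs)⟩
  · rintro ⟨s, rfl⟩
    exact ⟨s, (hoff s fun hs => hp (h'.mem_range_chart_iff.2 hs)).symm⟩

/-- The triod consists of both strands up to the first crossing and of the continuation of one
strand beyond it. -/
theorem not_isArc_of_triod [T2Space F] (h : IsTwistSystem γ n E S) {i : Fin m} (hn : 0 < n i) {r : ℝ}
    (hr : twistParam (n i) 0 < r) {A : Set F}
    (hA : ∀ x ∈ Icc 0 r, ∀ b, E (i, twistPoint (n i) b x) ∈ A) : ¬ IsArc A := by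
  intro hArc
  set p := twistParam (n i) 0
  have hp : 0 < p := twistParam_pos hn
  set C : Bool → Set ℝ → Set F := fun b I => (fun x => E (i, twistPoint (n i) b x)) '' I
  have hC : ∀ b, ∀ I, IsPreconnected I → IsPreconnected (C b I) := fun b I hI =>
    hI.image _ (h.chart.continuous.comp
      (continuous_const.prodMk (continuous_twistPoint _ b))).continuousOn
  have hw : twistWave (n i) p = 0 := twistWave_twistParam hn
  have hsub : ∀ b, ∀ I, I ⊆ Icc 0 r → C b I ⊆ A := by
    rintro b I hI _ ⟨x, hx, rfl⟩
    exact hA x (hI hx) b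
  have hpt : ∀ b, E (i, twistPoint (n i) b p) = E (i, (p, 0)) := by
    intro b
    simp [twistPoint, hw]
  have hmem : ∀ b, ∀ I, p ∈ I → E (i, (p, 0)) ∈ C b I := fun b I hI => ⟨p, hI, hpt b⟩
  have hother : ∀ b, ∀ I, ∀ x ∈ I, x ≠ p → ∃ y ∈ C b I, y ≠ E (i, (p, 0)) := by
    intro b I x hx hxp
    refine ⟨_, ⟨x, hx, rfl⟩, fun hh => hxp ?_⟩
    have := h.chart.injective hh
    simp only [twistPoint, Prod.mk.injEq] at this
    exact this.2.1
  have hinter : ∀ b b' I I', (∀ x ∈ I, x ∈ I' → (b = b' ∨ twistWave (n i) x = 0) → x = p) →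
      C b I ∩ C b' I' ⊆ {E (i, (p, 0))} := by
    rintro b b' I I' hI _ ⟨⟨x, hx, rfl⟩, x', hx', hxx⟩
    have := h.chart.injective hxx
    simp only [Prod.mk.injEq, true_and] at this
    obtain ⟨rfl, hb⟩ := twistPoint_eq_iff.1 this
    rw [hI x' hx hx' (hb.imp_left Eq.symm)]
    exact hpt b
  have hzero : ∀ x ≤ p, twistWave (n i) x = 0 → x = p := by
    intro x hx hw
    obtain ⟨j, -, rfl⟩ := twistWave_eq_zero_iff.1 hw
    refine le_antisymm hx ?_
    simp only [p, twistParam]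
    gcongr
    simp
  have hsymm : ∀ k l : Fin 3, ![C true (Icc 0 p), C false (Icc 0 p), C true (Icc p r)] k ∩
      ![C true (Icc 0 p), C false (Icc 0 p), C true (Icc p r)] l ⊆ {E (i, (p, 0))} →
      ![C true (Icc 0 p), C false (Icc 0 p), C true (Icc p r)] l ∩
      ![C true (Icc 0 p), C false (Icc 0 p), C true (Icc p r)] k ⊆ {E (i, (p, 0))} :=
    fun k l hkl => by rwa [inter_comm]
  have h01 : C true (Icc 0 p) ∩ C false (Icc 0 p) ⊆ {E (i, (p, 0))} :=
    hinter _ _ _ _ fun x hx _ hb => hzero x hx.2 (by simpa using hb)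
  have h02 : C true (Icc 0 p) ∩ C true (Icc p r) ⊆ {E (i, (p, 0))} :=
    hinter _ _ _ _ fun x hx hx' _ => le_antisymm hx.2 hx'.1
  have h12 : C false (Icc 0 p) ∩ C true (Icc p r) ⊆ {E (i, (p, 0))} :=
    hinter _ _ _ _ fun x hx hx' _ => le_antisymm hx.2 hx'.1
  refine hArc.false_of_triod (p := E (i, (p, 0)))
    (C := ![C true (Icc 0 p), C false (Icc 0 p), C true (Icc p r)]) ?_ ?_ ?_ ?_ ?_
  · simp only [Fin.forall_fin_succ, Fin.isValue, IsEmpty.forall_iff, and_true]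
    exact ⟨hC _ _ isPreconnected_Icc, hC _ _ isPreconnected_Icc, hC _ _ isPreconnected_Icc⟩
  · simp only [Fin.forall_fin_succ, Fin.isValue, IsEmpty.forall_iff, and_true]
    exact ⟨hsub _ _ (Icc_subset_Icc_right hr.le), hsub _ _ (Icc_subset_Icc_right hr.le),
      hsub _ _ (Icc_subset_Icc_left hp.le)⟩
  · simp only [Fin.forall_fin_succ, Fin.isValue, IsEmpty.forall_iff, and_true]
    exact ⟨hmem _ _ ⟨hp.le, le_rfl⟩, hmem _ _ ⟨hp.le, le_rfl⟩, hmem _ _ ⟨le_rfl, hr.le⟩⟩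
  · simp only [Fin.forall_fin_succ, Fin.isValue, IsEmpty.forall_iff, and_true]
    exact ⟨hother _ _ 0 ⟨le_rfl, hp.le⟩ hp.ne, hother _ _ 0 ⟨le_rfl, hp.le⟩ hp.ne,
      hother _ _ r ⟨hr.le, le_rfl⟩ hr.ne'⟩
  · intro k l hkl
    fin_cases k <;> fin_cases l <;> first | exact absurd rfl hkl | skip
    · exact h01
    · exact h02
    · exact hsymm 0 1 h01
    · exact h12
    · exact hsymm 0 2 h02
    · exact hsymm 1 2 h12

/-- A closed curve transverse to the diagram with the shorter rows of crossings avoids a neighbourhood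
`N i` of one crossing in each row; expanding these neighbourhoods by an isotopy makes it a closed curve
transverse to the diagram with the longer rows. -/
theorem exists_transport [T2Space F] [CompactSpace F] (h : IsTwistSystem γ n E S)
    (h' : IsTwistSystem γ' n' E S) (hoff : ∀ s ∉ range S, γ' s = γ s) (hγ : Continuous γ)
    (hγ' : Continuous γ') (hinj : ∀ t, ∃ U ∈ 𝓝 t, InjOn γ U) (hn : ∀ i, 1 ≤ n' i ∧ n' i ≤ n i)
    {α : Circle → F} (hαc : Continuous α) (hα : MeetsTransversely α γ') :
    ∃ (P : (Fin m × (ℝ × ℝ)) × ℝ → Fin m × (ℝ × ℝ)) (f : F ≃ₜ F) (N : Fin m → Set F),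
      IsCompactIsotopy P ∧ (∀ x, f (E x) = E (P (x, 0))) ∧ (∀ y ∉ range E, f y = y) ∧
      (∀ i s, α s ∉ N i) ∧ (∀ i, IsPreconnected (N i)) ∧
      (∀ p, (∀ i, p ∉ N i) → (f p ∈ range γ ↔ p ∈ range γ')) ∧
      (∀ i A, f '' N i ∩ range γ ⊆ A → ¬ IsArc A) ∧
      MeetsTransversely (f ∘ α) γ ∧ numIntersections (f ∘ α) γ = numIntersections α γ' := by
  have hαo : IsOpen (range α)ᶜ := (isCompact_range hαc).isClosed.isOpen_compl
  have hO : ∀ i, IsOpen {z | E (i, z) ∉ range α} := fun i =>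
    hαo.preimage (h.chart.continuous.comp (by fun_prop))
  -- The curve `α` meets the diagram only at simple points, so it misses the first crossing of each
  -- row; its complement is the open set in which `N i` is found.
  have hq : ∀ i, (twistParam (n' i) 0, (0 : ℝ)) ∈ {z | E (i, z) ∉ range α} := by
    rintro i ⟨s, hs⟩
    have hw : twistWave (n' i) (twistParam (n' i) 0) = 0 := twistWave_twistParam (hn i).1
    have e : E (i, (twistParam (n' i) 0, 0)) = γ' (S (i, true, twistParam (n' i) 0)) := by
      rw [h'.apply_strand]; simp [twistPoint, hw]
    refine h'.strand_ne_strand_not i true (twistParam (n' i) 0) (Eq.symm ?_)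
    refine (hα s _ (hs.trans e)).1 _ ?_
    rw [h'.apply_strand, h'.apply_strand]
    simp [twistPoint, hw]
  choose P N hP hNc hNp hNO hPN r hr hPr using fun i =>
    exists_isotopy_twistGraph (hn i).1 (hn i).2 (hO i) (hq i)
  have hPP := isCompactIsotopy_fin hP
  obtain ⟨f, hf, hf2⟩ := hPP.exists_homeomorph h.chart
  have hf1 : ∀ i z, f (E (i, z)) = E (i, P i (z, 0)) := fun i z => hf (i, z)
  set M : Fin m → Set F := fun i => (fun z => E (i, z)) '' N i with hM
  have hEi : ∀ i, Continuous fun z => E (i, z) := fun i => h.chart.continuous.comp (by fun_prop)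
  have hMc : ∀ i, IsCompact (M i) := fun i => (hNc i).image (hEi i)
  have hMα : ∀ i s, α s ∉ M i := by
    rintro i s ⟨z, hz, hzs⟩
    exact hNO i hz ⟨s, hzs.symm⟩
  have hMN : ∀ i z, E (i, z) ∉ M i → z ∉ N i := fun i z hz hzN => hz ⟨z, hzN, rfl⟩
  have hD : ∀ p, (∀ i, p ∉ M i) → (f p ∈ range γ ↔ p ∈ range γ') := by
    intro p hp
    by_cases hpE : p ∈ range E
    · obtain ⟨⟨i, z⟩, rfl⟩ := hpE
      rw [hf1, h.chart_mem_range_iff, h'.chart_mem_range_iff]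
      exact (hPN i z (hMN i z (hp i))).1
    · rw [hf2 p hpE]
      exact h.mem_range_iff_of_notMem h' hoff hpE
  -- Off `N i` the isotopy also matches the axis `y = 0`. The crossings are the points of the graph
  -- on this axis, so they correspond.
  have hX : ∀ p ∉ ⋃ i, M i, ∀ t t', γ t = f p → γ t' = f p → t ≠ t' →
      ∃ u u', γ' u = p ∧ γ' u' = p ∧ u ≠ u' := by
    intro p hp t t' ht ht' htt
    simp only [mem_iUnion, not_exists] at hp
    by_cases hpE : p ∈ range E
    · obtain ⟨⟨i, z⟩, rfl⟩ := hpE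
      have hz := hPN i z (hMN i z (hp i))
      rw [hf1] at ht ht'
      obtain ⟨b, rfl, hb⟩ := h.exists_strand_eq ht
      obtain ⟨b', rfl, hb'⟩ := h.exists_strand_eq ht'
      have hw : twistWave (n i) (P i (z, 0)).1 = 0 := by
        rcases (twistPoint_eq_iff.1 (hb.trans hb'.symm)).2 with rfl | hw
        · exact absurd rfl htt
        · exact hw
      have h2 : (P i (z, 0)).2 = 0 := by rw [← hb]; simp [twistPoint, hw]
      have hz2 : z.2 = 0 := hz.2.1 h2
      have hzg : z ∈ twistGraph (n' i) := hz.1.1 (by rw [← hb]; exact twistPoint_mem_twistGraph _ _ _)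
      have hzw : twistWave (n' i) z.1 = 0 := by
        have : |z.2| = |twistWave (n' i) z.1| := hzg
        rw [hz2, abs_zero] at this
        exact abs_eq_zero.1 this.symm
      refine ⟨S (i, true, z.1), S (i, false, z.1), ?_, ?_, h.strand_ne_strand_not i true z.1⟩ <;>
      · rw [h'.apply_strand]
        congr 2
        ext <;> simp [twistPoint, hzw, hz2]
    · rw [hf2 p hpE] at ht ht'
      refine ⟨t, t', ?_, ?_, htt⟩
      · rw [hoff t fun hs => hpE (ht ▸ h.mem_range_chart_iff.2 hs), ht]
      · rw [hoff t' fun hs => hpE (ht' ▸ h.mem_range_chart_iff.2 hs), ht']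
  obtain ⟨hm, hnum⟩ := hα.transport hγ hγ' hinj f
    (isCompact_iUnion hMc).isClosed (A := ⋃ i, M i)
    (fun s => by simpa using fun i => hMα i s) (fun p hp => hD p (by simpa using hp)) hX
  refine ⟨_, f, M, hPP, hf, hf2, hMα,
    fun i => (hNp i).image _ (hEi i).continuousOn, hD, ?_, hm, hnum⟩
  intro i A hA
  refine h.not_isArc_of_triod ((hn i).1.trans (hn i).2) (hr i) fun x hx b => hA ?_
  have hg := twistPoint_mem_twistGraph (n i) b x
  refine ⟨?_, h.chart_mem_range_iff.2 hg⟩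
  -- The strands lie in the closed region `|y| ≤ |twistWave|`, whose part over `[0, r]` is covered
  -- by the blown-up `N i`.
  obtain ⟨z, hz, hzP⟩ := hPr i x hx (twistPoint (n i) b x).2 (le_of_eq hg)
  refine ⟨E (i, z), ⟨z, hz, rfl⟩, ?_⟩
  rw [hf1, hzP]
  rfl

end IsTwistSystem

theorem KnotDiagram.locally_injective {F : Type*} [TopologicalSpace F] (K : KnotDiagram F)
    (t : Circle) : ∃ U ∈ 𝓝 t, InjOn K.proj U := by
  obtain ⟨ψ, -, U, hU, hinj, -⟩ := K.flat t
  exact ⟨U, hU, hinj⟩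

theorem IsArc.preimage_homeomorph {F : Type*} [TopologicalSpace F] {A B : Set F} (hB : IsArc B) (f : F ≃ₜ F)
    (h : ∀ p, f p ∈ B ↔ p ∈ A) : IsArc A := by
  obtain ⟨g, hg, hgi, hgB⟩ := hB
  refine ⟨f.symm ∘ g, f.symm.continuous.comp_continuousOn hg, f.symm.injective.comp_injOn hgi, ?_⟩
  rw [image_comp, hgB]
  ext p
  rw [← h p]
  constructor
  · rintro ⟨q, hq, rfl⟩
    simpa using hq
  · intro hp
    exact ⟨f p, hp, by simp⟩

/-! ### Monotonicity of the representativities, and weak primeness -/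

section representativity

variable {F : Type*} [TopologicalSpace F] [T2Space F] [CompactSpace F] {K K' : KnotDiagram F} {m : ℕ}
  {n n' : Fin m → ℕ} {E : Fin m × (ℝ × ℝ) → F} {S : Fin m × (Bool × ℝ) → Circle}

theorem IsTwistSystem.edgeRepresentativity_le (h : IsTwistSystem K.proj n E S)
    (h' : IsTwistSystem K'.proj n' E S) (hoff : ∀ s ∉ range S, K'.proj s = K.proj s)
    (hn : ∀ i, 1 ≤ n' i ∧ n' i ≤ n i) : K.edgeRepresentativity ≤ K'.edgeRepresentativity := by
  refine le_iInf fun α => le_iInf fun hα => le_iInf fun hm => ?_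
  obtain ⟨P, f, N, -, -, -, -, -, -, -, hfm, hnum⟩ := h.exists_transport h' hoff K.continuous_proj
    K'.continuous_proj K.locally_injective hn hα.1 hm
  rw [← hnum]
  exact iInf_le_of_le (f ∘ α) (iInf_le_of_le (hα.comp_homeomorph f) (iInf_le_of_le hfm le_rfl))

theorem IsTwistSystem.representativity_le {Y : Type*} [TopologicalSpace Y] [T2Space Y]
    {c : F × ℝ → Y} (hc : IsOpenEmbedding c) (h : IsTwistSystem K.proj n E S)
    (h' : IsTwistSystem K'.proj n' E S) (hoff : ∀ s ∉ range S, K'.proj s = K.proj s)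
    (hn : ∀ i, 1 ≤ n' i ∧ n' i ≤ n i) : K.representativity c ≤ K'.representativity c := by
  refine le_iInf fun δ => le_iInf fun α => le_iInf fun hδ => le_iInf fun hm => ?_
  obtain ⟨P, f, N, hP, hf1, hf2, -, -, -, -, hfm, hnum⟩ := h.exists_transport h' hoff
    K.continuous_proj K'.continuous_proj K.locally_injective hn hδ.2.2.2.2.1 hm
  obtain ⟨δ', hδ'⟩ := hδ.exists_comp hc h.chart hP hf1 hf2
  rw [← hnum]
  exact iInf_le_of_le δ' (iInf_le_of_le (f ∘ α) (iInf_le_of_le hδ' (iInf_le_of_le hfm le_rfl)))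

/-- Weak primeness of `K` is applied to the moved disk `f ∘ δ`. The side on which it gives an arc
contains no blown-up `N i`, and off the `N i` the map `f` matches the diagrams, so the arc can be
pulled back. -/
theorem IsTwistSystem.isWeaklyPrime (h : IsTwistSystem K.proj n E S)
    (h' : IsTwistSystem K'.proj n' E S) (hoff : ∀ s ∉ range S, K'.proj s = K.proj s)
    (hn : ∀ i, 1 ≤ n' i ∧ n' i ≤ n i) (hK : K.IsWeaklyPrime) : K'.IsWeaklyPrime := by
  intro δ hδ hm hnum
  obtain ⟨P, f, N, -, -, -, hNα, hNp, hD, harc, hfm, hfnum⟩ := h.exists_transport h' hoff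
    K.continuous_proj K'.continuous_proj K.locally_injective hn
    (hδ.continuous.comp continuous_subtype_val) hm
  have hball : IsOpen (δ '' Metric.ball 0 1) := hδ.isOpenMap _ Metric.isOpen_ball
  have hcball : IsOpen (δ '' Metric.closedBall 0 1)ᶜ :=
    ((isCompact_closedBall 0 1).image hδ.continuous).isClosed.isOpen_compl
  have hside : ∀ i, N i ⊆ δ '' Metric.ball 0 1 ∨ N i ⊆ (δ '' Metric.closedBall 0 1)ᶜ := by
    intro i
    refine (hNp i).subset_or_subset hball hcball ?_ ?_
    · rw [disjoint_compl_right_iff_subset]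
      exact image_mono Metric.ball_subset_closedBall
    · intro p hp
      by_cases hpc : p ∈ δ '' Metric.closedBall 0 1
      · obtain ⟨z, hz, rfl⟩ := hpc
        left
        refine ⟨z, ?_, rfl⟩
        rw [Metric.mem_ball]
        refine lt_of_le_of_ne hz fun hz1 => ?_
        exact hNα i ⟨z, mem_sphere_iff_norm.2 (by simpa using hz1)⟩ hp
      · exact Or.inr hpc
  have key := hK (f ∘ δ) (f.isOpenEmbedding.comp hδ) hfm (hfnum.trans hnum)
  have hfδ : ∀ A p, f p ∈ (f ∘ δ) '' A ↔ p ∈ δ '' A := fun A p => by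
    rw [image_comp, f.injective.mem_set_image]
  refine key.imp (fun hA => ?_) fun hA => ⟨hA.1, ?_⟩
  · refine hA.preimage_homeomorph f fun p => ?_
    rw [mem_inter_iff, mem_inter_iff, hfδ]
    refine and_congr_left fun hp => hD p fun i hpi => ?_
    rcases hside i with hi | hi
    -- If `N i` were inside the disk, its image would put a triod into the arc.
    · refine harc i _ ?_ hA
      rintro _ ⟨⟨q, hq, rfl⟩, hqγ⟩
      exact ⟨hqγ, (hfδ _ _).2 (image_mono Metric.ball_subset_closedBall (hi hq))⟩
    · exact hi hpi hp
  · refine hA.2.preimage_homeomorph f fun p => ?_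
    rw [mem_sdiff, mem_sdiff, hfδ]
    refine and_congr_left fun hp => hD p fun i hpi => ?_
    rcases hside i with hi | hi
    · exact hp (hi hpi)
    · refine harc i _ ?_ hA.2
      rintro _ ⟨⟨q, hq, rfl⟩, hqγ⟩
      exact ⟨hqγ, fun hh => hi hq (image_mono Metric.ball_subset_closedBall ((hfδ _ _).1 hh))⟩

end representativity

/-! ### Twist replacements -/

section replacement

variable {F : Type*} [TopologicalSpace F] {m : ℕ}

theorem isOpenEmbedding_prodMk_of_discrete {X Y : Type*} [TopologicalSpace X] [DiscreteTopology X]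
    [TopologicalSpace Y] (x : X) : IsOpenEmbedding fun y : Y => (x, y) :=
  .of_continuous_injective_isOpenMap (by fun_prop) (fun _ _ h => (Prod.mk.inj h).2) fun U hU => by
    rw [show (fun y : Y => (x, y)) '' U = {x} ×ˢ U from singleton_prod.symm]
    exact (isOpen_discrete _).prod hU

theorem exists_openPartialHomeomorph_extend {e : ℝ × ℝ → F} (he : IsOpenEmbedding e)
    (Φ : OpenPartialHomeomorph (ℝ × ℝ) (ℝ × ℝ)) : ∃ ψ : OpenPartialHomeomorph F (ℝ × ℝ),
      ∀ z ∈ Φ.source, e z ∈ ψ.source ∧ ψ (e z) = Φ z := by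
  refine ⟨(he.toOpenPartialHomeomorph e).symm.trans Φ, fun z hz => ?_⟩
  have : (he.toOpenPartialHomeomorph e).symm (e z) = z := by
    have := (he.toOpenPartialHomeomorph e).left_inv (x := z) (by simp)
    simpa using this
  simp [this, hz]

/-- The shear of the plane that maps the graph of a continuous function to the horizontal axis. -/
def shearHomeomorph (g : ℝ → ℝ) (hg : Continuous g) : ℝ × ℝ ≃ₜ ℝ × ℝ where
  toFun z := (z.1, z.2 - g z.1)
  invFun z := (z.1, z.2 + g z.1)
  left_inv z := by simp
  right_inv z := by simp
  continuous_toFun := by fun_prop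
  continuous_invFun := by fun_prop

/-- Near a simple zero `x` of `g`, the graphs of `g` and `- g` are the two axes in a suitable chart
of the plane. -/
theorem exists_chart_of_graphs {g : ℝ → ℝ} {x d : ℝ} (hg : HasStrictDerivAt g d x) (hd : d ≠ 0)
    (h0 : g x = 0) : ∃ (Φ : OpenPartialHomeomorph (ℝ × ℝ) (ℝ × ℝ)) (V : Set ℝ), V ∈ 𝓝 x ∧
      (∀ v ∈ V, ∀ y, (v, y) ∈ Φ.source) ∧ Φ (x, 0) = 0 ∧
      (∀ v ∈ V, (Φ (v, g v)).2 = 0) ∧ ∀ v ∈ V, (Φ (v, - g v)).1 = 0 := by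
  have hg' := hg.hasStrictFDerivAt_equiv hd
  set G := hg'.toOpenPartialHomeomorph g
  have hG : ∀ v, G v = g v := fun v => rfl
  -- The local homeomorphism `G` makes `g` the new abscissa, so that the graphs of `g` and `-g`
  -- become the two diagonals; `L` turns the diagonals into the axes.
  let L : ℝ × ℝ ≃ₜ ℝ × ℝ :=
    { toFun := fun z => (z.2 + z.1, z.2 - z.1)
      invFun := fun z => ((z.1 - z.2) / 2, (z.1 + z.2) / 2)
      left_inv := fun z => by ext <;> simp
      right_inv := fun z => by ext <;> simp <;> ring
      continuous_toFun := by fun_prop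
      continuous_invFun := by fun_prop }
  have hL : ∀ z, L z = (z.2 + z.1, z.2 - z.1) := fun z => rfl
  refine ⟨(G.prod (OpenPartialHomeomorph.refl ℝ)).transHomeomorph L, G.source,
    G.open_source.mem_nhds hg'.mem_toOpenPartialHomeomorph_source, ?_, ?_, ?_, ?_⟩
  · intro v hv y
    simpa using hv
  · simp [hL, hG, h0]
  · intro v _
    simp [hL, hG]
  · intro v _
    simp [hL, hG]

theorem finite_setOf_twistWave_eq_zero (n : ℕ) : {x | twistWave n x = 0}.Finite := by
  refine ((finite_Iio n).image (twistParam n)).subset fun x hx => ?_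
  obtain ⟨j, hj, rfl⟩ := twistWave_eq_zero_iff.1 hx
  exact ⟨j, hj, rfl⟩

/-- A reparametrization of the line, supported in the unit interval, that maps the first `n'`
crossings to the first `n'` crossings. -/
theorem exists_twistParam_map {n n' : ℕ} (h : n' ≤ n) (h1 : 1 ≤ n') :
    ∃ τ : ℝ → ℝ, Continuous τ ∧ (∀ x ∉ Icc (0 : ℝ) 1, τ x = x) ∧
      ∀ j < n', τ (twistParam n' j) = twistParam n j := by
  have hnR : (0 : ℝ) < n := by exact_mod_cast h1.trans h
  have hnR' : (1 : ℝ) ≤ n' := by exact_mod_cast h1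
  have hle : (n' / n : ℝ) ≤ 1 := by rw [div_le_one hnR]; exact_mod_cast h
  -- Up to the last crossing, at `1 - 1 / (2 * n')`, scaling by `n' / n` does the job. The line of
  -- slope `2 * n'` vanishes at that crossing and then climbs back to the value `1` at the end of
  -- the row.
  refine ⟨fun x => x - max 0 (min 1 x) +
    max (max 0 (min 1 x) * (n' / n)) (1 - 2 * n' * (1 - max 0 (min 1 x))), by fun_prop, ?_, ?_⟩
  · intro x hx
    rcases lt_or_ge x 0 with h0 | h0
    · have e : max 0 (min 1 x) = 0 := max_eq_left ((min_le_right _ _).trans h0.le)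
      simp only [e]
      rw [max_eq_left] <;> linarith
    · have h1 : 1 ≤ x := le_of_not_ge fun h1 => hx ⟨h0, h1⟩
      have e : max 0 (min 1 x) = 1 := by rw [min_eq_left h1]; simp
      simp only [e]
      rw [max_eq_right] <;> linarith
  · intro j hj
    have hp := twistParam_mem_Icc hj
    have e : max 0 (min 1 (twistParam n' j)) = twistParam n' j := by
      rw [min_eq_right hp.2, max_eq_right hp.1]
    simp only [e, sub_self, zero_add]
    have hmul : twistParam n' j * (n' / n) = twistParam n j := by
      unfold twistParam; field_simp
    have hjR : (j : ℝ) + 1 ≤ n' := by exact_mod_cast hj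
    have h2 : 2 * n' * twistParam n' j = 2 * j + 1 := by
      unfold twistParam; field_simp
    rw [hmul, max_eq_left]
    have := twistParam_pos (hj.trans_le h)
    linarith

theorem TransverseAt.congr {A B : Type*} [TopologicalSpace A] [TopologicalSpace B] {α α' : A → F}
    {β β' : B → F} {s : A} {t : B} (h : TransverseAt α s β t) (hα : ∀ᶠ u in 𝓝 s, α' u = α u)
    (hβ : ∀ᶠ v in 𝓝 t, β' v = β v) : TransverseAt α' s β' t := by
  obtain ⟨h0, ψ, hψ, hψ0, ⟨U, hU, hUi, hUm, hU0⟩, V, hV, hVi, hVm, hV0⟩ := h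
  have hs := hα.self_of_nhds
  have ht := hβ.self_of_nhds
  refine ⟨by rw [hs, ht, h0], ψ, by rwa [hs], by rwa [hs],
    ⟨U ∩ {u | α' u = α u}, Filter.inter_mem hU hα, ?_, ?_, ?_⟩,
    ⟨V ∩ {v | β' v = β v}, Filter.inter_mem hV hβ, ?_, ?_, ?_⟩⟩
  · rintro u ⟨hu, hu'⟩ v ⟨hv, hv'⟩ huv
    exact hUi hu hv (hu'.symm.trans (huv.trans hv'))
  · rintro u ⟨hu, hu'⟩
    rw [show α' u = α u from hu']
    exact hUm hu
  · rintro u ⟨hu, hu'⟩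
    rw [show α' u = α u from hu']
    exact hU0 u hu
  · rintro u ⟨hu, hu'⟩ v ⟨hv, hv'⟩ huv
    exact hVi hu hv (hu'.symm.trans (huv.trans hv'))
  · rintro u ⟨hu, hu'⟩
    rw [show β' u = β u from hu']
    exact hVm hu
  · rintro u ⟨hu, hu'⟩
    rw [show β' u = β u from hu']
    exact hV0 u hu

namespace IsTwistSystem

variable {K : KnotDiagram F} {γ : Circle → F} {n n' : Fin m → ℕ} {E : Fin m × (ℝ × ℝ) → F}
  {S : Fin m × (Bool × ℝ) → Circle}

theorem chart_apply (h : IsTwistSystem γ n E S) (i : Fin m) :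
    IsOpenEmbedding fun z => E (i, z) :=
  h.chart.comp (isOpenEmbedding_prodMk_of_discrete i)

theorem strand_apply (h : IsTwistSystem γ n E S) (i : Fin m) (b : Bool) :
    IsOpenEmbedding fun x => S (i, b, x) :=
  (h.strand.comp (isOpenEmbedding_prodMk_of_discrete i)).comp (isOpenEmbedding_prodMk_of_discrete b)

theorem injOn_range_strand (h : IsTwistSystem γ n E S) (i : Fin m) (b : Bool) :
    InjOn γ (range fun x => S (i, b, x)) := by
  rintro _ ⟨u, rfl⟩ _ ⟨v, rfl⟩ huv
  simp only [h.apply_strand] at huv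
  have := h.chart.injective huv
  simp only [Prod.mk.injEq, true_and, twistPoint_eq_iff] at this
  rw [this.1]

theorem flat_strand (h : IsTwistSystem γ n E S) (i : Fin m) (b : Bool) (x : ℝ) :
    ∃ ψ : OpenPartialHomeomorph F (ℝ × ℝ), γ (S (i, b, x)) ∈ ψ.source ∧
      ∃ U ∈ 𝓝 (S (i, b, x)), InjOn γ U ∧ MapsTo γ U ψ.source ∧ ∀ u ∈ U, (ψ (γ u)).2 = 0 := by
  obtain ⟨ψ, hψ⟩ := exists_openPartialHomeomorph_extend (h.chart_apply i)
    (shearHomeomorph (fun x => (if b then 1 else -1) * twistWave (n i) x)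
      (continuous_const.mul (continuous_twistWave _))).toOpenPartialHomeomorph
  refine ⟨ψ, ?_, range fun x => S (i, b, x), (h.strand_apply i b).isOpen_range.mem_nhds ⟨x, rfl⟩,
    h.injOn_range_strand i b, ?_, ?_⟩
  · rw [h.apply_strand]
    exact (hψ _ (mem_univ _)).1
  · rintro _ ⟨u, rfl⟩
    simp only [h.apply_strand]
    exact (hψ _ (mem_univ _)).1
  · rintro _ ⟨u, rfl⟩
    simp only [h.apply_strand]
    rw [(hψ _ (mem_univ _)).2]
    simp [shearHomeomorph, twistPoint]

/-- The two strands are the graphs of `c * twistWave` and of its negative near a simple zero, so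
`exists_chart_of_graphs` applies. -/
theorem transverseAt_strand (h : IsTwistSystem γ n E S) {i : Fin m} {b : Bool} {x : ℝ}
    (hw : twistWave (n i) x = 0) : TransverseAt γ (S (i, b, x)) γ (S (i, !b, x)) := by
  obtain ⟨j, hj, rfl⟩ := twistWave_eq_zero_iff.1 hw
  obtain ⟨d, hd, hderiv⟩ := exists_hasStrictDerivAt_twistWave hj
  set c : ℝ := if b then 1 else -1 with hc
  have hc0 : c ≠ 0 := by cases b <;> simp [c]
  have hcn : (if (!b) then (1 : ℝ) else -1) = -c := by cases b <;> simp [c]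
  obtain ⟨Φ, V, hV, hVs, hΦ0, hΦ1, hΦ2⟩ := exists_chart_of_graphs
    (hderiv.const_mul c) (mul_ne_zero hc0 hd) (by rw [hw, mul_zero])
  obtain ⟨ψ, hψ⟩ := exists_openPartialHomeomorph_extend (h.chart_apply i) Φ
  have hp : twistPoint (n i) b (twistParam (n i) j) = (twistParam (n i) j, 0) := by
    simp [twistPoint, hw]
  have hnhds : ∀ b, (fun x => S (i, b, x)) '' V ∈ 𝓝 (S (i, b, twistParam (n i) j)) := fun b =>
    (h.strand_apply i b).isOpenMap.image_mem_nhds hV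
  have hinj : ∀ b, InjOn γ ((fun x => S (i, b, x)) '' V) := fun b =>
    (h.injOn_range_strand i b).mono (image_subset_range _ _)
  refine ⟨((h.apply_eq_strand_iff (h.strand_ne_strand_not i b _).symm).2 ⟨rfl, hw⟩).symm, ψ, ?_, ?_,
    ⟨_, hnhds b, hinj b, ?_, ?_⟩, ⟨_, hnhds (!b), hinj (!b), ?_, ?_⟩⟩
  · rw [h.apply_strand]
    exact (hψ _ (hVs _ (mem_of_mem_nhds hV) _)).1
  · rw [h.apply_strand, hp, (hψ _ (hVs _ (mem_of_mem_nhds hV) _)).2, hΦ0]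
  · rintro _ ⟨u, hu, rfl⟩
    simp only [h.apply_strand]
    exact (hψ _ (hVs _ hu _)).1
  · rintro _ ⟨u, hu, rfl⟩
    simp only [h.apply_strand]
    rw [twistPoint, (hψ _ (hVs _ hu _)).2]
    exact hΦ1 u hu
  · rintro _ ⟨u, hu, rfl⟩
    simp only [h.apply_strand]
    exact (hψ _ (hVs _ hu _)).1
  · rintro _ ⟨u, hu, rfl⟩
    simp only [h.apply_strand]
    rw [twistPoint, (hψ _ (hVs _ hu _)).2]
    simp only [hcn, neg_mul]
    exact hΦ2 u hu

theorem continuous_strand_pair {X Z : Type*} [TopologicalSpace X] [TopologicalSpace Z]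
    {g : Fin m × (Bool × X) → Z} (hg : ∀ i b, Continuous fun x => g (i, b, x)) : Continuous g := by
  rw [continuous_prod_of_discrete_left]
  intro i
  rw [continuous_prod_of_discrete_left]
  exact hg i

/-- The part of the strands that contains the crossings. -/
def core (S : Fin m × (Bool × ℝ) → Circle) : Set Circle := S '' (univ ×ˢ (univ ×ˢ Icc 0 1))

theorem strand_mem_core_iff (h : IsTwistSystem γ n E S) {i : Fin m} {b : Bool} {x : ℝ} :
    S (i, b, x) ∈ core S ↔ x ∈ Icc (0 : ℝ) 1 := by
  rw [core, h.strand.injective.mem_set_image]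
  simp

theorem isClosed_core (h : IsTwistSystem γ n E S) : IsClosed (core S) :=
  ((isCompact_univ.prod (isCompact_univ.prod isCompact_Icc)).image h.strand.continuous).isClosed

theorem core_subset : core S ⊆ range S := image_subset_range _ _

/-- By parity the short and long waves agree outside the unit interval, so the new strands fit
continuously onto the old curve, and near parameters outside `range S` nothing changes. -/
theorem exists_replacement_curve [T2Space F] (h : IsTwistSystem K.proj n E S)
    (hn : ∀ i, 1 ≤ n' i ∧ ∃ k, n i = n' i + 2 * k) :
    ∃ γ' : Circle → F, Continuous γ' ∧ IsTwistSystem γ' n' E S ∧ (∀ s ∉ range S, γ' s = K.proj s) ∧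
      ∀ s ∉ range S, ∀ᶠ u in 𝓝 s, γ' u = K.proj u := by
  have hinjS := h.strand.injective
  have hC : IsCompact (univ ×ˢ (univ ×ˢ Icc 0 1) : Set (Fin m × (Bool × ℝ))) :=
    isCompact_univ.prod (isCompact_univ.prod isCompact_Icc)
  have hwave : ∀ i, ∀ x ∉ Icc (0 : ℝ) 1, ∀ b,
      twistPoint (n' i) b x = twistPoint (n i) b x := by
    intro i x hx b
    obtain ⟨k, hk⟩ := (hn i).2
    rw [twistPoint, twistPoint, twistWave_congr_of_parity hk fun hx' => hx (Ioo_subset_Icc_self hx')]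
  obtain ⟨g, hg⟩ : ∃ g : Fin m × (Bool × ℝ) → F,
      ∀ i b x, g (i, b, x) = E (i, twistPoint (n' i) b x) :=
    ⟨fun q => E (q.1, twistPoint (n' q.1) q.2.1 q.2.2), fun _ _ _ => rfl⟩
  have hgc : Continuous g := continuous_strand_pair fun i b => by
    simp only [hg]
    exact h.chart.continuous.comp (continuous_const.prodMk (continuous_twistPoint _ b))
  obtain ⟨γ', hγ'def⟩ : ∃ γ', γ' = Function.extend S g K.proj := ⟨_, rfl⟩
  have hγ'S : ∀ i b x, γ' (S (i, b, x)) = E (i, twistPoint (n' i) b x) := fun i b x => by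
    rw [hγ'def, hinjS.extend_apply, hg]
  have hγ'off : ∀ s ∉ range S, γ' s = K.proj s := fun s hs => by
    rw [hγ'def]
    exact Function.extend_apply' _ _ _ hs
  have hγ'c : Continuous γ' := by
    rw [hγ'def]
    refine continuous_extend h.strand hgc K.continuous_proj hC ?_
    rintro ⟨i, b, x⟩ hx
    rw [hg, h.apply_strand, ← hwave i x fun hx' => hx ⟨mem_univ _, mem_univ _, hx'⟩]
  have h' : IsTwistSystem γ' n' E S := by
    refine ⟨h.chart, h.strand, hγ'S, fun s hs => ?_⟩
    by_contra hsS
    rw [hγ'off s hsS] at hs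
    exact hsS (h.mem_range_strand s hs)
  have hev : ∀ s ∉ range S, ∀ᶠ u in 𝓝 s, γ' u = K.proj u := by
    intro s hs
    filter_upwards [h.isClosed_core.isOpen_compl.mem_nhds fun hh => hs (core_subset hh)] with u hu
    by_cases hur : u ∈ range S
    · obtain ⟨⟨i, b, x⟩, rfl⟩ := hur
      rw [hγ'S, h.apply_strand, hwave i x fun hx => hu (h.strand_mem_core_iff.2 hx)]
    · exact hγ'off u hur
  exact ⟨γ', hγ'c, h', hγ'off, hev⟩

/-- Heights matter only at crossings, so the old height is read along each strand through the
reparametrization `τ`: the `j`-th new crossing inherits both heights of the `j`-th old one. -/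
theorem exists_replacement_height [T2Space F] (h : IsTwistSystem K.proj n E S)
    (hn : ∀ i, 1 ≤ n' i ∧ n' i ≤ n i) :
    ∃ η' : Circle → ℝ, Continuous η' ∧ (∀ s ∉ core S, η' s = K.height s) ∧
      ∀ i b, ∀ j < n' i, η' (S (i, b, twistParam (n' i) j)) =
        K.height (S (i, b, twistParam (n i) j)) := by
  choose τ hτc hτ1 hτ using fun i => exists_twistParam_map (hn i).2 (hn i).1
  have hinjS := h.strand.injective
  have hC : IsCompact (univ ×ˢ (univ ×ˢ Icc 0 1) : Set (Fin m × (Bool × ℝ))) :=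
    isCompact_univ.prod (isCompact_univ.prod isCompact_Icc)
  obtain ⟨k, hk⟩ : ∃ k : Fin m × (Bool × ℝ) → ℝ,
      ∀ i b x, k (i, b, x) = K.height (S (i, b, τ i x)) :=
    ⟨fun q => K.height (S (q.1, q.2.1, τ q.1 q.2.2)), fun _ _ _ => rfl⟩
  have hkc : Continuous k := continuous_strand_pair fun i b => by
    simp only [hk]
    exact K.continuous_height.comp ((h.strand_apply i b).continuous.comp (hτc i))
  obtain ⟨η', hη'def⟩ : ∃ η', η' = Function.extend S k K.height := ⟨_, rfl⟩
  have hη'S : ∀ i b x, η' (S (i, b, x)) = K.height (S (i, b, τ i x)) := fun i b x => by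
    rw [hη'def, hinjS.extend_apply, hk]
  have hη'off : ∀ s ∉ range S, η' s = K.height s := fun s hs => by
    rw [hη'def]
    exact Function.extend_apply' _ _ _ hs
  have hη'c : Continuous η' := by
    rw [hη'def]
    refine continuous_extend h.strand hkc K.continuous_height hC ?_
    rintro ⟨i, b, x⟩ hx
    rw [hk, hτ1 i x fun hx' => hx ⟨mem_univ _, mem_univ _, hx'⟩]
  refine ⟨η', hη'c, fun s hs => ?_, fun i b j hj => by rw [hη'S, hτ i j hj]⟩
  by_cases hsr : s ∈ range S
  · obtain ⟨⟨i, b, x⟩, rfl⟩ := hsr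
    rw [hη'S, hτ1 i x fun hx => hs (h.strand_mem_core_iff.2 hx)]
  · exact hη'off s hsr

theorem exists_knotDiagram [T2Space F] (h : IsTwistSystem K.proj n E S)
    (hn : ∀ i, 1 ≤ n' i ∧ ∃ k, n i = n' i + 2 * k) :
    ∃ K' : KnotDiagram F, (∀ s ∉ range S, K'.proj s = K.proj s) ∧
      (∀ i b x, K'.proj (S (i, b, x)) = E (i, twistPoint (n' i) b x)) ∧
      (∀ s ∉ core S, K'.height s = K.height s) ∧
      ∀ i b, ∀ j < n' i, K'.height (S (i, b, twistParam (n' i) j)) =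
        K.height (S (i, b, twistParam (n i) j)) := by
  have hle : ∀ i, n' i ≤ n i := fun i => by obtain ⟨k, hk⟩ := (hn i).2; omega
  obtain ⟨γ', hγ'c, h', hγ'off, hev⟩ := h.exists_replacement_curve hn
  obtain ⟨η', hη'c, hη'off, hη'S⟩ := h.exists_replacement_height fun i => ⟨(hn i).1, hle i⟩
  -- Parameters in `range S` are exactly those projecting into the disks, so no double point mixes a
  -- strand with the rest of the knot. Each axiom can then be checked separately on the two parts.
  have hoffS : ∀ s t, s ∉ range S → γ' s = γ' t → t ∉ range S := by
    intro s t hs hst ht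
    exact hs (h'.mem_range_chart_iff.1 (hst ▸ h'.mem_range_chart_iff.2 ht))
  have hflat : ∀ s, ∃ ψ : OpenPartialHomeomorph F (ℝ × ℝ), γ' s ∈ ψ.source ∧
      ∃ U ∈ 𝓝 s, InjOn γ' U ∧ MapsTo γ' U ψ.source ∧ ∀ u ∈ U, (ψ (γ' u)).2 = 0 := by
    intro s
    by_cases hs : s ∈ range S
    · obtain ⟨⟨i, b, x⟩, rfl⟩ := hs
      exact h'.flat_strand i b x
    · obtain ⟨ψ, hψ, U, hU, hUi, hUm, hU0⟩ := K.flat s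
      refine ⟨ψ, by rwa [hγ'off s hs], U ∩ {u | γ' u = K.proj u},
        Filter.inter_mem hU (hev s hs), ?_, ?_, ?_⟩
      · rintro u ⟨hu, hu'⟩ v ⟨hv, hv'⟩ huv
        exact hUi hu hv (hu'.symm.trans (huv.trans hv'))
      · rintro u ⟨hu, hu'⟩
        rw [show γ' u = K.proj u from hu']
        exact hUm hu
      · rintro u ⟨hu, hu'⟩
        rw [show γ' u = K.proj u from hu']
        exact hU0 u hu
  have htrans : ∀ s t, s ≠ t → γ' s = γ' t → TransverseAt γ' s γ' t := by
    intro s t hst hγ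
    by_cases hs : s ∈ range S
    · obtain ⟨⟨i, b, x⟩, rfl⟩ := hs
      obtain ⟨rfl, hw⟩ := (h'.apply_eq_strand_iff hst.symm).1 hγ.symm
      exact h'.transverseAt_strand hw
    · have ht := hoffS s t hs hγ
      rw [hγ'off s hs, hγ'off t ht] at hγ
      exact (K.transverse s t hst hγ).congr (hev s hs) (hev t ht)
  refine ⟨⟨γ', η', hγ'c, hη'c, ?_, hflat, ?_, ?_, htrans⟩, hγ'off, h'.apply_strand, hη'off, hη'S⟩
  · intro s t hst
    simp only [Prod.mk.injEq] at hst
    obtain ⟨h1, h2⟩ := hst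
    by_cases hs : s ∈ range S
    · obtain ⟨⟨i, b, x⟩, rfl⟩ := hs
      by_contra hne
      obtain ⟨rfl, hw⟩ := (h'.apply_eq_strand_iff (Ne.symm hne)).1 h1.symm
      obtain ⟨j, hj, rfl⟩ := twistWave_eq_zero_iff.1 hw
      -- Equal heights at a new crossing would be equal heights at an old one, contradicting
      -- embeddedness of `K`.
      rw [hη'S i b j hj, hη'S i (!b) j hj] at h2
      have hw' : twistWave (n i) (twistParam (n i) j) = 0 :=
        twistWave_twistParam (hj.trans_le (hle i))
      refine h.strand_ne_strand_not i b (twistParam (n i) j) (K.injective (Prod.ext ?_ h2))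
      simp only [h.apply_strand]
      rw [twistPoint_eq_iff.2 ⟨rfl, Or.inr hw'⟩]
    · have ht := hoffS s t hs h1
      rw [hγ'off s hs, hγ'off t ht] at h1
      rw [hη'off s fun hh => hs (core_subset hh), hη'off t fun hh => ht (core_subset hh)] at h2
      exact K.injective (Prod.ext h1 h2)
  · have hfin : (S '' (univ ×ˢ (univ ×ˢ ⋃ i, {x | twistWave (n' i) x = 0}))).Finite :=
      ((finite_univ.prod (finite_univ.prod (finite_iUnion fun i =>
        finite_setOf_twistWave_eq_zero (n' i)))).image S)
    refine (K.finite_double.union hfin).subset ?_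
    rintro s ⟨t, hts, hst⟩
    by_cases hs : s ∈ range S
    · obtain ⟨⟨i, b, x⟩, rfl⟩ := hs
      obtain ⟨rfl, hw⟩ := (h'.apply_eq_strand_iff hts).1 hst
      exact Or.inr ⟨(i, b, x), ⟨mem_univ _, mem_univ _, mem_iUnion.2 ⟨i, hw⟩⟩, rfl⟩
    · have ht := hoffS s t hs hst.symm
      rw [hγ'off s hs, hγ'off t ht] at hst
      exact Or.inl ⟨t, hts, hst⟩
  · intro s t u hst htu
    by_cases hs : s ∈ range S
    · obtain ⟨⟨i, b, x⟩, rfl⟩ := hs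
      by_contra hcon
      simp only [not_or] at hcon
      obtain ⟨rfl, -⟩ := (h'.apply_eq_strand_iff (Ne.symm hcon.1)).1 hst.symm
      obtain ⟨rfl, -⟩ := (h'.apply_eq_strand_iff (Ne.symm hcon.2.2)).1 (hst.trans htu).symm
      exact hcon.2.1 rfl
    · have ht := hoffS s t hs hst
      have hu := hoffS t u ht htu
      rw [hγ'off s hs, hγ'off t ht] at hst
      rw [hγ'off t ht, hγ'off u hu] at htu
      exact K.no_triple s t u hst htu

end IsTwistSystem

theorem KnotDiagram.exists_isTwistReplacement [T2Space F] {K : KnotDiagram F} {n n' : Fin m → ℕ}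
    (T : ∀ i, TwistChart K (n i))
    (hd : ∀ i j, i ≠ j → Disjoint (range (T i).chart) (range (T j).chart))
    (hn : ∀ i, 1 ≤ n' i ∧ ∃ k, n i = n' i + 2 * k) :
    ∃ K' : KnotDiagram F, K.IsTwistReplacement T n' K' := by
  have h := isTwistSystem_of_twistChart T hd
  obtain ⟨K', h1, h2, h3, h4⟩ := h.exists_knotDiagram hn
  have hout : ∀ s, (∀ i, ¬ (T i).InTwist s) →
      s ∉ IsTwistSystem.core fun p : Fin m × (Bool × ℝ) => (T p.1).strand p.2.1 p.2.2 := by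
    rintro s hs ⟨⟨i, b, x⟩, ⟨-, -, hx⟩, hh⟩
    exact hs i ⟨b, x, hx, hh⟩
  refine ⟨K', ?_, ?_, ?_, ?_⟩
  · intro s hs
    by_cases hsr : s ∈ range fun p : Fin m × (Bool × ℝ) => (T p.1).strand p.2.1 p.2.2
    · obtain ⟨⟨i, b, x⟩, rfl⟩ := hsr
      obtain ⟨k, hk⟩ := (hn i).2
      refine (h2 i b x).trans (Eq.trans ?_ (h.apply_strand i b x).symm)
      rw [twistPoint, twistPoint, twistWave_congr_of_parity hk]
      exact fun hx => hs i ⟨b, x, Ioo_subset_Icc_self hx, rfl⟩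
    · exact h1 s hsr
  · intro s t hs ht _ _
    rw [h3 s (hout s hs), h3 t (hout t ht)]
  · exact fun i b x _ => h2 i b x
  · intro i j hj
    rw [← h4 i false j hj, ← h4 i true j hj]

theorem KnotDiagram.IsTwistReplacement.proj_strand {K K' : KnotDiagram F} {n n' : Fin m → ℕ}
    {T : ∀ i, TwistChart K (n i)}
    (hd : ∀ i j, i ≠ j → Disjoint (range (T i).chart) (range (T j).chart))
    (hn : ∀ i, ∃ k, n i = n' i + 2 * k) (hR : K.IsTwistReplacement T n' K') (i : Fin m) (b : Bool)
    (x : ℝ) : K'.proj ((T i).strand b x) = (T i).chart (twistPoint (n' i) b x) := by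
  by_cases hx : x ∈ Icc (0 : ℝ) 1
  · exact hR.proj_inside i b x hx
  · have h := isTwistSystem_of_twistChart T hd
    obtain ⟨k, hk⟩ := hn i
    rw [hR.proj_outside, (T i).proj_strand, twistPoint, twistPoint,
      twistWave_congr_of_parity hk fun hx' => hx (Ioo_subset_Icc_self hx')]
    rintro j ⟨b', x', hx', hs⟩
    have := h.strand.injective (a₁ := (j, b', x')) (a₂ := (i, b, x)) hs
    simp only [Prod.mk.injEq] at this
    exact hx (this.2.2 ▸ hx')

theorem KnotDiagram.IsTwistReplacement.isTwistSystem {K K' : KnotDiagram F} {n n' : Fin m → ℕ}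
    {T : ∀ i, TwistChart K (n i)}
    (hd : ∀ i j, i ≠ j → Disjoint (range (T i).chart) (range (T j).chart))
    (hn : ∀ i, ∃ k, n i = n' i + 2 * k) (hR : K.IsTwistReplacement T n' K') :
    IsTwistSystem K'.proj n' (fun p => (T p.1).chart p.2) (fun p => (T p.1).strand p.2.1 p.2.2) ∧
      ∀ s ∉ range fun p : Fin m × (Bool × ℝ) => (T p.1).strand p.2.1 p.2.2,
        K'.proj s = K.proj s := by
  have h := isTwistSystem_of_twistChart T hd
  have hoff : ∀ s ∉ range fun p : Fin m × (Bool × ℝ) => (T p.1).strand p.2.1 p.2.2,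
      K'.proj s = K.proj s := fun s hs => hR.proj_outside s fun i ⟨b, x, _, hx⟩ =>
    hs ⟨(i, b, x), hx⟩
  refine ⟨⟨h.chart, h.strand, fun i b x => hR.proj_strand hd hn i b x, fun s hs => ?_⟩, hoff⟩
  by_contra hsS
  rw [hoff s hsS] at hs
  exact hsS (h.mem_range_strand s hs)

end replacement

/-! ### Alternation -/

theorem iff_iff_iff_self (p q : Prop) : ((p ↔ q) ↔ q) ↔ p := by tauto

theorem iff_iff_not_iff_self (p q : Prop) : ((p ↔ q) ↔ ¬ q) ↔ ¬ p := by tauto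

/-- A labelling, up to a discrete set, of the complement of `Z` in the line that is locally constant and
changes at each point `x` of `Z` from `O x` to `¬ O x`. -/
def IsAlternatingLabel (Z : Set ℝ) (O l : ℝ → Prop) : Prop :=
  ∀ x, (x ∉ Z → ∃ c : Prop, ∀ᶠ y in 𝓝[≠] x, (l y ↔ c)) ∧
    (x ∈ Z → (∀ᶠ y in 𝓝[<] x, (l y ↔ O x)) ∧ ∀ᶠ y in 𝓝[>] x, (l y ↔ ¬ O x))

/-- The label at `x` is the over/under bit of the next point of `Z` strictly to the right. Just
before a crossing it is the bit of that crossing; just after, by alternation, it is the opposite. -/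
theorem exists_isAlternatingLabel {Z : Set ℝ} {O : ℝ → Prop}
    (hdisc : ∀ x, ∀ᶠ y in 𝓝[≠] x, y ∉ Z) (hunb : ∀ x, ∃ b ∈ Z, x < b)
    (halt : ∀ a b, a < b → a ∈ Z → b ∈ Z → (∀ x ∈ Ioo a b, x ∉ Z) → (O a ↔ ¬ O b)) :
    ∃ l, IsAlternatingLabel Z O l := by
  have hint : ∀ x, ∃ p q, x ∈ Ioo p q ∧ ∀ y ∈ Ioo p q, y ≠ x → y ∉ Z := by
    intro x
    obtain ⟨p, q, hx, h⟩ := mem_nhds_iff_exists_Ioo_subset.1 (eventually_nhdsWithin_iff.1 (hdisc x))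
    exact ⟨p, q, hx, fun y hy hyx => h hy hyx⟩
  have hnext : ∀ x, ∃ b ∈ Z, x < b ∧ ∀ y ∈ Ioo x b, y ∉ Z := by
    intro x
    obtain ⟨b₀, hb₀, hxb₀⟩ := hunb x
    have hne : (Z ∩ Ioi x).Nonempty := ⟨b₀, hb₀, hxb₀⟩
    have hbdd : BddBelow (Z ∩ Ioi x) := ⟨x, fun y hy => le_of_lt hy.2⟩
    set b := sInf (Z ∩ Ioi x) with hb
    have hmin : ∀ y ∈ Ioo x b, y ∉ Z := fun y hy hyZ =>
      absurd (csInf_le hbdd ⟨hyZ, hy.1⟩) (not_le.2 hy.2)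
    obtain ⟨p, q, hpq, hpqZ⟩ := hint x
    have hqb : q ≤ b := le_csInf hne fun y hy => le_of_not_gt fun hyq =>
      hpqZ y ⟨hpq.1.trans hy.2, hyq⟩ (ne_of_gt hy.2) hy.1
    refine ⟨b, ?_, hpq.2.trans_le hqb, hmin⟩
    -- If the infimum were not attained, points of `Z` would accumulate at it from the right,
    -- against discreteness.
    by_contra hbZ
    obtain ⟨p', q', hpq', hpqZ'⟩ := hint b
    obtain ⟨y, hy, hyq⟩ := exists_lt_of_csInf_lt hne hpq'.2
    have hby : b ≤ y := csInf_le hbdd hy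
    have hyb : y ≠ b := fun h => hbZ (h ▸ hy.1)
    exact hpqZ' y ⟨hpq'.1.trans_le hby, hyq⟩ hyb hy.1
  choose nx hnZ hlt hnx using hnext
  have huniq : ∀ x b, b ∈ Z → x < b → (∀ y ∈ Ioo x b, y ∉ Z) → nx x = b := by
    intro x b hb hxb h
    refine le_antisymm (le_of_not_gt fun h' => ?_) (le_of_not_gt fun h' => ?_)
    · exact hnx x b ⟨hxb, h'⟩ hb
    · exact h (nx x) ⟨hlt x, h'⟩ (hnZ x)
  have hright : ∀ x p q, x ∈ Ioo p q → (∀ y ∈ Ioo p q, y ≠ x → y ∉ Z) →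
      ∀ y ∈ Ioo x q, nx y = nx x := by
    intro x p q hx h y hy
    have hqn : q ≤ nx x := le_of_not_gt fun h' =>
      h (nx x) ⟨hx.1.trans (hlt x), h'⟩ (ne_of_gt (hlt x)) (hnZ x)
    exact huniq y (nx x) (hnZ x) (hy.2.trans_le hqn) fun z hz => hnx x z ⟨hy.1.trans hz.1, hz.2⟩
  refine ⟨fun x => O (nx x), fun x => ?_⟩
  obtain ⟨p, q, hx, h⟩ := hint x
  have hR : ∀ᶠ y in 𝓝[>] x, nx y = nx x := by
    filter_upwards [Ioo_mem_nhdsGT hx.2] with y hy using hright x p q hx h y hy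
  constructor
  · intro hxZ
    refine ⟨O (nx x), ?_⟩
    have hL : ∀ᶠ y in 𝓝[<] x, nx y = nx x := by
      filter_upwards [Ioo_mem_nhdsLT hx.1] with y hy
      refine huniq y (nx x) (hnZ x) (hy.2.trans (hlt x)) fun z hz => ?_
      rcases lt_trichotomy z x with hzx | rfl | hzx
      · exact h z ⟨hy.1.trans hz.1, hzx.trans hx.2⟩ hzx.ne
      · exact hxZ
      · exact hnx x z ⟨hzx, hz.2⟩
    rw [← nhdsLT_sup_nhdsGT, Filter.eventually_sup]
    exact ⟨hL.mono fun y hy => by simp only [hy], hR.mono fun y hy => by simp only [hy]⟩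
  · intro hxZ
    constructor
    · filter_upwards [Ioo_mem_nhdsLT hx.1] with y hy
      rw [huniq y x hxZ hy.2 fun z hz => h z ⟨hy.1.trans hz.1, hz.2.trans hx.2⟩ hz.2.ne]
    · filter_upwards [hR] with y hy
      rw [hy]
      have := halt x (nx x) (hlt x) hxZ (hnZ x) (hnx x)
      tauto

/-- The common punctured-neighbourhood value of `l` is a continuous function to `Bool`, hence
constant on `s`; the values of `l` at exceptional points play no role. -/
theorem exists_eventually_iff_of_isPreconnected {s : Set ℝ} (hs : IsPreconnected s) {l : ℝ → Prop}
    (h : ∀ x ∈ s, ∃ c : Prop, ∀ᶠ y in 𝓝[≠] x, (l y ↔ c)) :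
    ∃ c : Prop, ∀ x ∈ s, ∀ᶠ y in 𝓝[≠] x, (l y ↔ c) := by
  classical
  set f : ℝ → Bool := fun x => decide (∀ᶠ y in 𝓝[≠] x, l y) with hf
  have hval : ∀ x (c : Prop), (∀ᶠ y in 𝓝[≠] x, (l y ↔ c)) → (f x = true ↔ c) := by
    intro x c hc
    rw [hf, decide_eq_true_iff, Filter.eventually_congr hc, Filter.eventually_const]
  have hcont : ContinuousOn f s := by
    intro x hx
    obtain ⟨c, hc⟩ := h x hx
    refine ContinuousAt.continuousWithinAt ?_
    have hev : ∀ᶠ y in 𝓝 x, f y = f x := by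
      have h2 := eventually_nhdsWithin_iff.1 (eventually_eventually_nhdsWithin.2 hc)
      filter_upwards [h2] with y hy
      by_cases hyx : y = x
      · rw [hyx]
      · have hy' : ∀ᶠ z in 𝓝 y, (l z ↔ c) := by
          have := hy hyx
          rwa [(isOpen_compl_singleton (x := x)).nhdsWithin_eq hyx] at this
        have e1 := hval y c (hy'.filter_mono nhdsWithin_le_nhds)
        have e2 := hval x c hc
        rw [Bool.eq_iff_iff, e1, e2]
    exact (continuousAt_const (y := f x)).congr (hev.mono fun y hy => hy.symm)
  rcases s.eq_empty_or_nonempty with rfl | ⟨x₀, hx₀⟩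
  · exact ⟨True, fun x hx => absurd hx (notMem_empty x)⟩
  · obtain ⟨c, hc⟩ := h x₀ hx₀
    refine ⟨c, fun x hx => ?_⟩
    obtain ⟨c', hc'⟩ := h x hx
    have e1 := hval x c' hc'
    have e2 := hval x₀ c hc
    rw [hs.constant hcont hx hx₀, e2] at e1
    exact hc'.mono fun y hy => hy.trans e1.symm

/-- Between consecutive crossings the label has one generic value, which reads `¬ O a` near the left
end and `O b` near the right end. -/
theorem IsAlternatingLabel.alternating {Z : Set ℝ} {O l : ℝ → Prop} (h : IsAlternatingLabel Z O l)
    {a b : ℝ} (hab : a < b) (ha : a ∈ Z) (hb : b ∈ Z) (hZ : ∀ x ∈ Ioo a b, x ∉ Z) :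
    O a ↔ ¬ O b := by
  obtain ⟨c, hc⟩ := exists_eventually_iff_of_isPreconnected (isPreconnected_Ioo (a := a) (b := b))
    fun x hx => (h x).1 (hZ x hx)
  have key : ∀ (o : Prop) (p q : ℝ), p < q → Ioo p q ⊆ Ioo a b → (∀ y ∈ Ioo p q, (l y ↔ o)) →
      (c ↔ o) := by
    intro o p q hpq hsub hlo
    obtain ⟨y, hy⟩ := exists_between hpq
    have h1 := hc y (hsub hy)
    have h2 : ∀ᶠ z in 𝓝[≠] y, (l z ↔ o) :=
      nhdsWithin_le_nhds (Filter.mem_of_superset (Ioo_mem_nhds hy.1 hy.2) hlo)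
    obtain ⟨z, hz1, hz2⟩ := (h1.and h2).exists
    exact hz1.symm.trans hz2
  obtain ⟨q, hq, hq'⟩ := mem_nhdsGT_iff_exists_Ioo_subset.1 ((h a).2 ha).2
  obtain ⟨p, hp, hp'⟩ := mem_nhdsLT_iff_exists_Ioo_subset.1 ((h b).2 hb).1
  have e1 := key (¬ O a) a (min q b) (lt_min hq hab) (Ioo_subset_Ioo_right (min_le_right _ _))
    fun y hy => hq' ⟨hy.1, hy.2.trans_le (min_le_left _ _)⟩
  have e2 := key (O b) (max p a) b (max_lt hp hab) (Ioo_subset_Ioo_left (le_max_right _ _))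
    fun y hy => hp' ⟨(le_max_left _ _).trans_lt hy.1, hy.2⟩
  tauto

theorem Topology.IsOpenEmbedding.map_nhdsNE {f : ℝ → ℝ} (hf : IsOpenEmbedding f) (y : ℝ) :
    Filter.map f (𝓝[≠] y) = 𝓝[≠] f y := by
  rw [hf.isEmbedding.map_nhdsWithin_eq]
  have : f '' {y}ᶜ = {f y}ᶜ ∩ range f := by
    ext x
    constructor
    · rintro ⟨z, hz, rfl⟩
      exact ⟨fun h => hz (hf.injective h), z, rfl⟩
    · rintro ⟨hx, z, rfl⟩
      exact ⟨z, fun h => hx (congrArg f h), rfl⟩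
  rw [this, nhdsWithin_inter_of_mem']
  exact nhdsWithin_le_nhds (hf.isOpen_range.mem_nhds ⟨y, rfl⟩)

/-- A one-sided change of a label, expressed in a parametrization that may reverse the orientation. -/
theorem Topology.IsOpenEmbedding.exists_direction {f : ℝ → ℝ} (hf : IsOpenEmbedding f) :
    ∃ d : Prop, ∀ (l : ℝ → Prop) (o : Prop) (y : ℝ),
      ((∀ᶠ x in 𝓝[<] f y, (l x ↔ o)) ∧ ∀ᶠ x in 𝓝[>] f y, (l x ↔ ¬ o)) ↔
      ((∀ᶠ z in 𝓝[<] y, (l (f z) ↔ (o ↔ d))) ∧ ∀ᶠ z in 𝓝[>] y, (l (f z) ↔ ¬ (o ↔ d))) := by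
  have hmap : ∀ (y : ℝ) (A B : Set ℝ), f '' A = B ∩ range f →
      Filter.map f (𝓝[A] y) = 𝓝[B] f y := by
    intro y A B hAB
    rw [hf.isEmbedding.map_nhdsWithin_eq, hAB, nhdsWithin_inter_of_mem']
    exact nhdsWithin_le_nhds (hf.isOpen_range.mem_nhds ⟨y, rfl⟩)
  rcases hf.continuous.strictMono_of_inj hf.injective with hm | hm
  · refine ⟨True, fun l o y => ?_⟩
    have h1 : Filter.map f (𝓝[<] y) = 𝓝[<] f y := hmap y _ _ (by
      ext x
      constructor
      · rintro ⟨z, hz, rfl⟩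
        exact ⟨hm hz, z, rfl⟩
      · rintro ⟨hx, z, rfl⟩
        exact ⟨z, hm.lt_iff_lt.1 hx, rfl⟩)
    have h2 : Filter.map f (𝓝[>] y) = 𝓝[>] f y := hmap y _ _ (by
      ext x
      constructor
      · rintro ⟨z, hz, rfl⟩
        exact ⟨hm hz, z, rfl⟩
      · rintro ⟨hx, z, rfl⟩
        exact ⟨z, hm.lt_iff_lt.1 hx, rfl⟩)
    rw [← h1, ← h2]
    simp only [Filter.eventually_map, iff_true]
  · refine ⟨False, fun l o y => ?_⟩
    have h1 : Filter.map f (𝓝[>] y) = 𝓝[<] f y := hmap y _ _ (by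
      ext x
      constructor
      · rintro ⟨z, hz, rfl⟩
        exact ⟨hm hz, z, rfl⟩
      · rintro ⟨hx, z, rfl⟩
        exact ⟨z, hm.lt_iff_gt.1 hx, rfl⟩)
    have h2 : Filter.map f (𝓝[<] y) = 𝓝[>] f y := hmap y _ _ (by
      ext x
      constructor
      · rintro ⟨z, hz, rfl⟩
        exact ⟨hm hz, z, rfl⟩
      · rintro ⟨hx, z, rfl⟩
        exact ⟨z, hm.lt_iff_gt.1 hx, rfl⟩)
    rw [← h1, ← h2]
    simp only [Filter.eventually_map, iff_false, not_not]
    exact and_comm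

/-- A strand is lifted through the covering of the circle by the line. The lift is a local
homeomorphism because the strand and the covering are, and it is injective because the strand is. -/
theorem exists_lift_of_isOpenEmbedding {g : ℝ → Circle} (hg : IsOpenEmbedding g) {x y : ℝ}
    (h : Circle.exp x = g y) :
    ∃ θ : ℝ → ℝ, IsOpenEmbedding θ ∧ θ y = x ∧ ∀ z, Circle.exp (θ z) = g z := by
  obtain ⟨θ, ⟨hθ0, hθ⟩, -⟩ := Circle.isCoveringMap_exp.existsUnique_continuousMap_lifts
    ⟨g, hg.continuous⟩ y x h
  have hθ' : ∀ z, Circle.exp (θ z) = g z := fun z => congrFun hθ z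
  have hloc : IsLocalHomeomorph θ :=
    IsLocalHomeomorph.of_comp
      (by
        rw [show Circle.exp ∘ θ = g from funext hθ']
        exact hg.isLocalHomeomorph) Circle.isCoveringMap_exp.isLocalHomeomorph θ.continuous
  refine ⟨θ, hloc.isOpenEmbedding_of_injective fun u v huv => hg.injective ?_, hθ0, hθ'⟩
  rw [← hθ', ← hθ', huv]

section alternating

variable {F : Type*} [TopologicalSpace F] {K K' : KnotDiagram F} {m : ℕ} {n n' : Fin m → ℕ}
  {E : Fin m × (ℝ × ℝ) → F} {S : Fin m × (Bool × ℝ) → Circle}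

theorem KnotDiagram.eventually_not_isCrossingAt (K : KnotDiagram F) (x : ℝ) :
    ∀ᶠ y in 𝓝[≠] x, ¬ K.IsCrossingAt (Circle.exp y) := by
  have hfin : ({s | K.IsCrossingAt s} \ {Circle.exp x}).Finite := K.finite_double.sdiff
  have h1 : ∀ᶠ y in 𝓝 x, Circle.exp y ∉ {s | K.IsCrossingAt s} \ {Circle.exp x} :=
    Circle.exp.continuous.continuousAt.eventually
      (hfin.isClosed.isOpen_compl.mem_nhds fun h => h.2 rfl)
  obtain ⟨e, hxe, he⟩ := Circle.isCoveringMap_exp.isLocalHomeomorph x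
  filter_upwards [nhdsWithin_le_nhds h1, nhdsWithin_le_nhds (e.open_source.mem_nhds hxe),
    self_mem_nhdsWithin] with y hy hye hyx hcr
  refine hy ⟨hcr, fun hxy => hyx (e.injOn hye hxe ?_)⟩
  rw [← he]
  exact hxy

theorem exists_exp_eq_and_lt (s : Circle) (x : ℝ) : ∃ b, Circle.exp b = s ∧ x < b := by
  obtain ⟨N, hN⟩ := exists_nat_gt (x - Complex.arg s)
  refine ⟨Complex.arg s + N * (2 * Real.pi), ?_, ?_⟩
  · rw [Circle.periodic_exp.nat_mul N (Complex.arg s), Circle.exp_arg]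
  · have : (N : ℝ) ≤ N * (2 * Real.pi) :=
      le_mul_of_one_le_right (Nat.cast_nonneg N) (by linarith [Real.pi_gt_three])
    linarith

theorem KnotDiagram.IsAlternating.exists_label (hK : K.IsAlternating)
    (hc : ∃ s, K.IsCrossingAt s) :
    ∃ l, IsAlternatingLabel {x | K.IsCrossingAt (Circle.exp x)}
      (fun x => K.IsOverAt (Circle.exp x)) l := by
  refine exists_isAlternatingLabel K.eventually_not_isCrossingAt ?_ hK
  intro x
  obtain ⟨s, hs⟩ := hc
  obtain ⟨b, rfl, hb⟩ := exists_exp_eq_and_lt s x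
  exact ⟨b, hs, hb⟩

namespace IsTwistSystem

theorem isCrossingAt_strand_iff (h : IsTwistSystem K.proj n E S) {i : Fin m} {b : Bool} {x : ℝ} :
    K.IsCrossingAt (S (i, b, x)) ↔ twistWave (n i) x = 0 := by
  constructor
  · rintro ⟨t, ht, htx⟩
    exact ((h.apply_eq_strand_iff ht).1 htx).2
  · intro hw
    have hne := (h.strand_ne_strand_not i b x).symm
    exact ⟨_, hne, (h.apply_eq_strand_iff hne).2 ⟨rfl, hw⟩⟩

theorem isOverAt_strand_iff (h : IsTwistSystem K.proj n E S) {i : Fin m} {b : Bool} {x : ℝ}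
    (hw : twistWave (n i) x = 0) :
    K.IsOverAt (S (i, b, x)) ↔ K.height (S (i, !b, x)) < K.height (S (i, b, x)) := by
  constructor
  · rintro ⟨t, ht, htx, hh⟩
    rwa [((h.apply_eq_strand_iff ht).1 htx).1] at hh
  · intro hh
    have hne := (h.strand_ne_strand_not i b x).symm
    exact ⟨_, hne, (h.apply_eq_strand_iff hne).2 ⟨rfl, hw⟩, hh⟩

/-- Both strands are expressed through the single height comparison that a twist replacement
preserves. -/
theorem isOverAt_strand_iff_true (h : IsTwistSystem K.proj n E S) {i : Fin m} {b : Bool} {x : ℝ}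
    (hw : twistWave (n i) x = 0) :
    K.IsOverAt (S (i, b, x)) ↔
      ((K.height (S (i, false, x)) < K.height (S (i, true, x))) ↔ b = true) := by
  rw [h.isOverAt_strand_iff hw]
  cases b
  · have hne : K.height (S (i, false, x)) ≠ K.height (S (i, true, x)) := fun hh =>
      h.strand_ne_strand_not i false x (K.injective (Prod.ext
        ((h.apply_eq_strand_iff (h.strand_ne_strand_not i false x)).2 ⟨rfl, hw⟩) hh))
    simp [le_iff_lt_or_eq, hne.symm]
  · simp

theorem notMem_core_of_eq {γ : Circle → F} (h : IsTwistSystem γ n E S) {s t : Circle}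
    (hs : s ∉ core S) (hst : γ s = γ t) : t ∉ core S := by
  rintro ⟨⟨i, b, x⟩, ⟨-, -, hx⟩, rfl⟩
  by_cases hne : s = S (i, b, x)
  · exact hs (hne ▸ h.strand_mem_core_iff.2 hx)
  · rw [((h.apply_eq_strand_iff hne).1 hst).1] at hs
    exact hs (h.strand_mem_core_iff.2 hx)

theorem isCrossingAt_iff_of_notMem_core (h : IsTwistSystem K.proj n E S)
    (h' : IsTwistSystem K'.proj n' E S) (hcore : ∀ s ∉ core S, K'.proj s = K.proj s) {s : Circle}
    (hs : s ∉ core S) : K'.IsCrossingAt s ↔ K.IsCrossingAt s := by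
  refine exists_congr fun t => and_congr_right fun _ => ⟨fun ht => ?_, fun ht => ?_⟩
  · rw [← hcore s hs, ← ht, hcore t (h'.notMem_core_of_eq hs ht.symm)]
  · rw [hcore s hs, hcore t (h.notMem_core_of_eq hs ht.symm), ht]

theorem isOverAt_iff_of_notMem_core (h : IsTwistSystem K.proj n E S)
    (h' : IsTwistSystem K'.proj n' E S) (hcore : ∀ s ∉ core S, K'.proj s = K.proj s)
    (hover : ∀ s t, s ∉ core S → t ∉ core S → s ≠ t → K.proj s = K.proj t →
      (K'.height s < K'.height t ↔ K.height s < K.height t)) {s : Circle}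
    (hs : s ∉ core S) : K'.IsOverAt s ↔ K.IsOverAt s := by
  refine exists_congr fun t => and_congr_right fun hne => ⟨fun ⟨ht, hh⟩ => ?_, fun ⟨ht, hh⟩ => ?_⟩
  · have ht' := h'.notMem_core_of_eq hs ht.symm
    have e : K.proj t = K.proj s := by rw [← hcore s hs, ← ht, hcore t ht']
    exact ⟨e, (hover t s ht' hs hne e).1 hh⟩
  · have ht' := h.notMem_core_of_eq hs ht.symm
    exact ⟨by rw [hcore s hs, hcore t ht', ht], (hover t s ht' hs hne ht).2 hh⟩

theorem eventually_twistWave_neg_iff_of_ne {n : ℕ} {y : ℝ} (hy : twistWave n y ≠ 0) :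
    ∀ᶠ z in 𝓝 y, (twistWave n z < 0 ↔ twistWave n y < 0) := by
  rcases lt_or_gt_of_ne hy with h | h
  · filter_upwards [(continuous_twistWave n).continuousAt.eventually_lt continuousAt_const h]
      with z hz
    simp [h, hz]
  · filter_upwards [continuousAt_const.eventually_lt (continuous_twistWave n).continuousAt h]
      with z hz
    exact iff_of_false (not_lt.2 hz.le) (not_lt.2 h.le)

theorem isAlternating (h : IsTwistSystem K.proj n E S) (h' : IsTwistSystem K'.proj n' E S)
    (hn : ∀ i, n' i ≤ n i ∧ ∃ k, n i = n' i + 2 * k)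
    (hcore : ∀ s ∉ core S, K'.proj s = K.proj s)
    (hover : ∀ s t, s ∉ core S → t ∉ core S → s ≠ t → K.proj s = K.proj t →
      (K'.height s < K'.height t ↔ K.height s < K.height t))
    (hin : ∀ i, ∀ j < n' i,
      (K'.height (S (i, false, twistParam (n' i) j)) < K'.height (S (i, true, twistParam (n' i) j)) ↔
        K.height (S (i, false, twistParam (n i) j)) < K.height (S (i, true, twistParam (n i) j))))
    (hc : ∃ s, K.IsCrossingAt s) (hK : K.IsAlternating) : K'.IsAlternating := by
  obtain ⟨l, hl⟩ := hK.exists_label hc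
  -- `N n x` says that `x` lies over a point of a strand where the wave is negative. Twisting the
  -- old label by `N n` and `N n'` exchanges the sign pattern of the long rows for that of the short
  -- ones.
  set N : (Fin m → ℕ) → ℝ → Prop := fun n x =>
    ∃ i b y, Circle.exp x = S (i, b, y) ∧ twistWave (n i) y < 0 with hN
  have hNval : ∀ (n : Fin m → ℕ) x i b y, Circle.exp x = S (i, b, y) →
      (N n x ↔ twistWave (n i) y < 0) := by
    intro n x i b y hx
    constructor
    · rintro ⟨i', b', y', hx', hw⟩
      have := h.strand.injective (hx.symm.trans hx')
      simp only [Prod.mk.injEq] at this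
      obtain ⟨rfl, rfl, rfl⟩ := this
      exact hw
    · exact fun hw => ⟨i, b, y, hx, hw⟩
  suffices hlab : IsAlternatingLabel {x | K'.IsCrossingAt (Circle.exp x)}
      (fun x => K'.IsOverAt (Circle.exp x)) fun x => (l x ↔ (N n x ↔ N n' x)) from
    fun a b hab ha hb hZ => hlab.alternating hab ha hb hZ
  intro x
  by_cases hx : Circle.exp x ∈ core S
  · obtain ⟨⟨i, b, y⟩, -, hxy⟩ := hx
    obtain ⟨θ, hθ, rfl, hθS⟩ := exists_lift_of_isOpenEmbedding (h.strand_apply i b) hxy.symm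
    obtain ⟨d, hd⟩ := hθ.exists_direction
    have hcr : ∀ z, K.IsCrossingAt (Circle.exp (θ z)) ↔ twistWave (n i) z = 0 := fun z => by
      rw [hθS, h.isCrossingAt_strand_iff]
    have hcr' : ∀ z, K'.IsCrossingAt (Circle.exp (θ z)) ↔ twistWave (n' i) z = 0 := fun z => by
      rw [hθS, h'.isCrossingAt_strand_iff]
    -- the label at a crossing of the longer row
    have hat : ∀ j < n i, ∀ᶠ z in 𝓝[≠] twistParam (n i) j, ((l (θ z) ↔ twistWave (n i) z < 0) ↔
        ((K.IsOverAt (S (i, b, twistParam (n i) j)) ↔ d) ↔ Odd j)) := by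
      intro j hj
      have hj1 := (hl (θ (twistParam (n i) j))).2 ((hcr _).2 (twistWave_twistParam hj))
      simp only [hd, hθS] at hj1
      obtain ⟨hwl, hwr⟩ := eventually_twistWave_neg_iff hj
      rw [← nhdsLT_sup_nhdsGT, Filter.eventually_sup]
      constructor
      · filter_upwards [hj1.1, hwl] with z hz1 hz2
        rw [hz1, hz2]
      · filter_upwards [hj1.2, hwr] with z hz1 hz2
        rw [hz1, hz2, not_iff_not]
    -- Label and sign of the long wave switch together at each crossing, so their comparison has a
    -- single generic value `κ` along the whole strand.
    obtain ⟨κ, hκ⟩ := exists_eventually_iff_of_isPreconnected isPreconnected_univ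
      (l := fun z => (l (θ z) ↔ twistWave (n i) z < 0)) fun z _ => by
        by_cases hw : twistWave (n i) z = 0
        · obtain ⟨j, hj, rfl⟩ := twistWave_eq_zero_iff.1 hw
          exact ⟨_, hat j hj⟩
        · obtain ⟨c, hc⟩ := (hl (θ z)).1 (mt (hcr z).1 hw)
          rw [← hθ.map_nhdsNE, Filter.eventually_map] at hc
          refine ⟨c ↔ twistWave (n i) z < 0, ?_⟩
          filter_upwards [hc, nhdsWithin_le_nhds (eventually_twistWave_neg_iff_of_ne hw)]
            with u hu1 hu2
          rw [hu1, hu2]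
    have hnew : ∀ᶠ z in 𝓝[≠] y, ((l (θ z) ↔ (N n (θ z) ↔ N n' (θ z))) ↔
        (κ ↔ twistWave (n' i) z < 0)) := by
      filter_upwards [hκ y (mem_univ y)] with z hz
      rw [hNval n (θ z) i b z (hθS z), hNval n' (θ z) i b z (hθS z), ← hz]
      exact iff_assoc.symm
    constructor
    · intro hxZ
      have hw : twistWave (n' i) y ≠ 0 := mt (hcr' y).2 hxZ
      refine ⟨κ ↔ twistWave (n' i) y < 0, ?_⟩
      rw [← hθ.map_nhdsNE, Filter.eventually_map]
      filter_upwards [hnew, nhdsWithin_le_nhds (eventually_twistWave_neg_iff_of_ne hw)]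
        with z hz1 hz2
      rw [hz1, hz2]
    · intro hxZ
      obtain ⟨j, hj, rfl⟩ := twistWave_eq_zero_iff.1 ((hcr' y).1 hxZ)
      have hjn := hj.trans_le (hn i).1
      have hov : K'.IsOverAt (Circle.exp (θ (twistParam (n' i) j))) ↔
          K.IsOverAt (S (i, b, twistParam (n i) j)) := by
        rw [hθS, h'.isOverAt_strand_iff_true (twistWave_twistParam hj),
          h.isOverAt_strand_iff_true (twistWave_twistParam hjn), hin i j hj]
      -- The constant is evaluated at the `j`-th crossing of the long row, whose over/under bit is
      -- also that of the `j`-th crossing of the short row.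
      have hκ' : κ ↔ ((K.IsOverAt (S (i, b, twistParam (n i) j)) ↔ d) ↔ Odd j) := by
        obtain ⟨z, hz1, hz2⟩ := ((hκ _ (mem_univ (twistParam (n i) j))).and (hat j hjn)).exists
        exact hz1.symm.trans hz2
      obtain ⟨hwl, hwr⟩ := eventually_twistWave_neg_iff hj
      rw [← nhdsLT_sup_nhdsGT, Filter.eventually_sup] at hnew
      rw [hd]
      simp only [hov]
      constructor
      · filter_upwards [hnew.1, hwl] with z hz1 hz2
        rw [hz1, hz2, hκ', iff_iff_iff_self]
      · filter_upwards [hnew.2, hwr] with z hz1 hz2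
        rw [hz1, hz2, hκ', iff_iff_not_iff_self]
  · have hev : ∀ᶠ z in 𝓝 x, ((l z ↔ (N n z ↔ N n' z)) ↔ l z) := by
      have : ∀ᶠ z in 𝓝 x, Circle.exp z ∈ (core S)ᶜ :=
        Circle.exp.continuous.continuousAt.eventually (h.isClosed_core.isOpen_compl.mem_nhds hx)
      filter_upwards [this] with z hz
      -- Outside the core the waves agree by parity, so the old label is unchanged there.
      have hNN : N n z ↔ N n' z := by
        refine exists_congr fun i => exists_congr fun b => exists_congr fun y =>
          and_congr_right fun hzS => ?_
        obtain ⟨k, hk⟩ := (hn i).2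
        rw [twistWave_congr_of_parity hk fun hy => hz ?_]
        rw [hzS, h.strand_mem_core_iff]
        exact Ioo_subset_Icc_self hy
      simp [hNN]
    constructor
    · intro hxZ
      obtain ⟨c, hc⟩ := (hl x).1 fun hxK =>
        hxZ ((h.isCrossingAt_iff_of_notMem_core h' hcore hx).2 hxK)
      refine ⟨c, ?_⟩
      filter_upwards [hc, nhdsWithin_le_nhds hev] with z hz1 hz2
      rw [hz2, hz1]
    · intro hxZ
      obtain ⟨hL, hR⟩ := (hl x).2 ((h.isCrossingAt_iff_of_notMem_core h' hcore hx).1 hxZ)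
      simp only [h.isOverAt_iff_of_notMem_core h' hcore hover hx]
      constructor
      · filter_upwards [hL, nhdsWithin_le_nhds hev] with z hz1 hz2
        rw [hz2, hz1]
      · filter_upwards [hR, nhdsWithin_le_nhds hev] with z hz1 hz2
        rw [hz2, hz1]

end IsTwistSystem

end alternating

/-! ### Checkerboard colourings -/

/-- The two regions above and below all strands. -/
def twistOutside (n : ℕ) : Set (ℝ × ℝ) := {z | |twistWave n z.1| < |z.2|}

/-- The bigons between the strands and the two unbounded regions at the ends of the row. -/
def twistInside (n : ℕ) : Set (ℝ × ℝ) := {z | |z.2| < |twistWave n z.1|}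

theorem isOpen_twistOutside (n : ℕ) : IsOpen (twistOutside n) :=
  isOpen_lt ((continuous_twistWave n).comp continuous_fst).abs continuous_snd.abs

theorem isOpen_twistInside (n : ℕ) : IsOpen (twistInside n) :=
  isOpen_lt continuous_snd.abs ((continuous_twistWave n).comp continuous_fst).abs

theorem disjoint_twistOutside_twistInside (n : ℕ) : Disjoint (twistOutside n) (twistInside n) :=
  Set.disjoint_left.2 fun z (h : |twistWave n z.1| < |z.2|) (h' : |z.2| < |twistWave n z.1|) =>
    lt_asymm h h'

theorem twistOutside_union_twistInside (n : ℕ) :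
    twistOutside n ∪ twistInside n = (twistGraph n)ᶜ := by
  ext z
  simp only [twistOutside, twistInside, twistGraph, mem_union, mem_ofPred_eq, mem_compl_iff]
  rw [or_comm]
  exact ne_iff_lt_or_gt.symm

theorem twistGraph_subset_closure_twistOutside (n : ℕ) :
    twistGraph n ⊆ closure (twistOutside n) := by
  rintro ⟨x, y⟩ hz
  have hz' : |y| = |twistWave n x| := hz
  rcases le_total 0 y with hy | hy
  · have ht : Filter.Tendsto (fun t : ℝ => (x, y + t)) (𝓝[>] 0) (𝓝 (x, y)) := by
      have : ContinuousAt (fun t : ℝ => (x, y + t)) 0 := by fun_prop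
      simpa [ContinuousAt] using this.tendsto.mono_left nhdsWithin_le_nhds
    refine mem_closure_of_tendsto ht ?_
    filter_upwards [self_mem_nhdsWithin] with t ht
    have ht : 0 < t := ht
    simp only [twistOutside, mem_ofPred_eq]
    rw [← hz', abs_of_nonneg hy, abs_of_nonneg (by linarith)]
    linarith
  · have ht : Filter.Tendsto (fun t : ℝ => (x, y - t)) (𝓝[>] 0) (𝓝 (x, y)) := by
      have : ContinuousAt (fun t : ℝ => (x, y - t)) 0 := by fun_prop
      simpa [ContinuousAt] using this.tendsto.mono_left nhdsWithin_le_nhds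
    refine mem_closure_of_tendsto ht ?_
    filter_upwards [self_mem_nhdsWithin] with t ht
    have ht : 0 < t := ht
    simp only [twistOutside, mem_ofPred_eq]
    rw [← hz', abs_of_nonpos hy, abs_of_nonpos (by linarith)]
    linarith

theorem twistGraph_subset_closure_twistInside (n : ℕ) :
    twistGraph n ⊆ closure (twistInside n) := by
  rintro ⟨x, y⟩ hz
  have hz' : |y| = |twistWave n x| := hz
  by_cases hw : twistWave n x = 0
  · have hy : y = 0 := by rwa [hw, abs_zero, abs_eq_zero] at hz'
    subst hy
    obtain ⟨j, hj, rfl⟩ := twistWave_eq_zero_iff.1 hw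
    have ht : Filter.Tendsto (fun t : ℝ => (t, (0 : ℝ))) (𝓝[<] twistParam n j)
        (𝓝 (twistParam n j, 0)) := by
      have : ContinuousAt (fun t : ℝ => (t, (0 : ℝ))) (twistParam n j) := by fun_prop
      exact this.tendsto.mono_left nhdsWithin_le_nhds
    refine mem_closure_of_tendsto ht ?_
    filter_upwards [(eventually_neg_one_pow_mul_twistWave hj).1] with t ht
    simp only [twistInside, mem_ofPred_eq, abs_zero, abs_pos]
    rintro h0
    rw [h0, mul_zero] at ht
    exact lt_irrefl _ ht
  · have ht : Filter.Tendsto (fun t : ℝ => (x, (1 - t) * y)) (𝓝[>] 0) (𝓝 (x, y)) := by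
      have : ContinuousAt (fun t : ℝ => (x, (1 - t) * y)) 0 := by fun_prop
      simpa [ContinuousAt] using this.tendsto.mono_left nhdsWithin_le_nhds
    refine mem_closure_of_tendsto ht ?_
    filter_upwards [Ioo_mem_nhdsGT (zero_lt_one (α := ℝ))] with t ht
    have hpos : 0 < |twistWave n x| := abs_pos.2 hw
    simp only [twistInside, mem_ofPred_eq]
    rw [abs_mul, hz', abs_of_nonneg (by linarith [ht.2])]
    nlinarith [ht.1]

theorem mem_twistOutside_iff_of_notMem {n n' : ℕ} {z : ℝ × ℝ}
    (hz : z ∉ Icc (0 : ℝ) 1 ×ˢ Icc (-1 : ℝ) 1) :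
    (z ∈ twistOutside n ↔ z ∈ twistOutside n') ∧ (z ∈ twistInside n ↔ z ∈ twistInside n') := by
  obtain ⟨x, y⟩ := z
  simp only [twistOutside, twistInside, mem_ofPred_eq]
  rw [mem_prod, not_and_or] at hz
  rcases hz with hx | hy
  · have h : ∀ n, |twistWave n x| = 1 := by
      intro n
      rcases lt_or_ge x 0 with h0 | h0
      · exact abs_twistWave_of_nonpos n h0.le
      · exact abs_twistWave_of_one_le n (le_of_not_ge fun h1 => hx ⟨h0, h1⟩)
    rw [h n, h n']
    simp
  · rw [mem_Icc, ← abs_le, not_le] at hy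
    have h : ∀ n, |twistWave n x| < |y| := fun n => (abs_twistWave_le_one n x).trans_lt hy
    exact ⟨iff_of_true (h n) (h n'), iff_of_false (h n).not_gt (h n').not_gt⟩

/-- In the standard picture of a row of crossings there is only one checkerboard colouring with given
colour of the upper region. -/
theorem eq_twistOutside_of_upper_subset {n : ℕ} {P Q : Set (ℝ × ℝ)} (hP : IsOpen P) (hQ : IsOpen Q)
    (hd : Disjoint P Q) (hPQ : P ∪ Q = (twistGraph n)ᶜ)
    (hcl : twistGraph n ⊆ closure P ∩ closure Q) (hup : ∀ u v, |twistWave n u| < v → (u, v) ∈ P) :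
    P = twistOutside n ∧ Q = twistInside n := by
  have hcov : ∀ z, z ∉ twistGraph n → z ∈ P ∨ z ∈ Q := fun z hz => by
    have : z ∈ P ∪ Q := by rw [hPQ]; exact hz
    exact this
  have hQg : ∀ z ∈ Q, z ∉ twistGraph n := fun z hz => by
    have : z ∈ P ∪ Q := Or.inr hz
    rwa [hPQ] at this
  have hPg : ∀ z ∈ P, z ∉ twistGraph n := fun z hz => by
    have : z ∈ P ∪ Q := Or.inl hz
    rwa [hPQ] at this
  have hdisj : ∀ z, z ∈ P → z ∉ Q := fun z hz => Set.disjoint_left.1 hd hz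
  have hwc := continuous_twistWave n
  have hw := hwc.abs
  have hin : twistInside n ⊆ Q := by
    rintro ⟨x, y⟩ hz
    have hxw : 0 < |twistWave n x| := (abs_nonneg y).trans_lt hz
    obtain ⟨a, b, hxab, hab⟩ := mem_nhds_iff_exists_Ioo_subset.1
      (continuousAt_const.eventually_lt hw.continuousAt hxw)
    set R : Set (ℝ × ℝ) := (fun p : ℝ × ℝ => (p.1, p.2 * |twistWave n p.1|)) '' (Ioo a b ×ˢ Ioo (-1) 1)
    have hRmem : ∀ u ∈ Ioo a b, ∀ v, |v| < |twistWave n u| → (u, v) ∈ R := by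
      intro u hu v hv
      have hpos : 0 < |twistWave n u| := hab hu
      refine ⟨(u, v / |twistWave n u|), ⟨hu, ?_⟩, ?_⟩
      · rw [mem_Ioo, ← abs_lt, abs_div, abs_abs]
        exact (div_lt_one hpos).2 hv
      · simp only [div_mul_cancel₀ _ hpos.ne']
    have hRc : IsPreconnected R := (isPreconnected_Ioo.prod isPreconnected_Ioo).image _
      (Continuous.continuousOn (by fun_prop))
    have hRsub : R ⊆ P ∪ Q := by
      rintro _ ⟨⟨u, s⟩, ⟨hu, hs⟩, rfl⟩
      refine hcov _ fun hg => ?_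
      have hpos : 0 < |twistWave n u| := hab hu
      have hg' : abs (s * |twistWave n u|) = |twistWave n u| := hg
      rw [abs_mul, abs_abs] at hg'
      have : |s| < 1 := abs_lt.2 hs
      nlinarith
    -- `R` is the part between the strands near abscissa `x`. If it had the colour of the upper
    -- region, both sides of the strand at height `|twistWave n x|` would be coloured alike, so that
    -- point could not be in the closure of `Q`.
    rcases hRc.subset_or_subset hP hQ hd hRsub with hR | hR
    · exfalso
      have hmem : (x, |twistWave n x|) ∈ closure Q := (hcl (by simp [twistGraph])).2
      obtain ⟨⟨u, v⟩, ⟨hu, hv⟩, huv⟩ := mem_closure_iff.1 hmem (Ioo a b ×ˢ Ioi 0)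
        (isOpen_Ioo.prod isOpen_Ioi) ⟨hxab, hxw⟩
      have hv' : 0 < v := hv
      rcases lt_trichotomy v |twistWave n u| with h | h | h
      · exact hdisj _ (hR (hRmem u hu v (by rwa [abs_of_pos hv']))) huv
      · exact hQg _ huv (by simp only [twistGraph, mem_ofPred_eq]; rw [abs_of_pos hv', h])
      · exact hdisj _ (hup _ _ h) huv
    · exact hR (hRmem x hxab y hz)
  set L : Set (ℝ × ℝ) := (fun p : ℝ × ℝ => (p.1, - |twistWave n p.1| - p.2)) '' (univ ×ˢ Ioi 0)
  have hLmem : ∀ u v, v < - |twistWave n u| → (u, v) ∈ L := fun u v huv =>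
    ⟨(u, - |twistWave n u| - v), ⟨mem_univ _, mem_Ioi.2 (sub_pos.2 huv)⟩, by simp⟩
  have hLc : IsPreconnected L := (isPreconnected_univ.prod isPreconnected_Ioi).image _
      (Continuous.continuousOn (by fun_prop))
  have hLsub : L ⊆ P ∪ Q := by
    rintro _ ⟨⟨u, s⟩, ⟨-, hs⟩, rfl⟩
    refine hcov _ fun hg => ?_
    have hs : 0 < s := hs
    have hg' : abs (- |twistWave n u| - s) = |twistWave n u| := hg
    rw [abs_of_neg (by linarith [abs_nonneg (twistWave n u)])] at hg'
    linarith
  -- The same argument at the point `(0, -1)` of the lower strand: the region between the strands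
  -- already has colour `Q`, so the region below must have colour `P`.
  have hLP : L ⊆ P := by
    refine (hLc.subset_or_subset hP hQ hd hLsub).resolve_right fun hLQ => ?_
    have hmem : ((0 : ℝ), (-1 : ℝ)) ∈ closure P :=
      (hcl (by simp [twistGraph, abs_twistWave_of_nonpos])).1
    obtain ⟨⟨u, v⟩, hv, huv⟩ := mem_closure_iff.1 hmem (univ ×ˢ Iio 0)
      (isOpen_univ.prod isOpen_Iio) ⟨mem_univ _, by simp⟩
    have hv' : v < 0 := hv.2
    rcases lt_trichotomy v (-|twistWave n u|) with h | h | h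
    · exact hdisj _ huv (hLQ (hLmem u v h))
    · exact hPg _ huv (by simp only [twistGraph, mem_ofPred_eq]; rw [abs_of_neg hv', h, neg_neg])
    · refine hdisj _ huv (hin ?_)
      simp only [twistInside, mem_ofPred_eq]
      rw [abs_of_neg hv']
      linarith
  have hout : twistOutside n ⊆ P := by
    rintro ⟨x, y⟩ hz
    rcases lt_abs.1 (show |twistWave n x| < |y| from hz) with h | h
    · exact hup _ _ h
    · exact hLP (hLmem x y (by linarith))
  have hcov' : ∀ z, z ∉ twistGraph n → z ∈ twistOutside n ∨ z ∈ twistInside n := fun z hz => by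
    have : z ∈ twistOutside n ∪ twistInside n := by rw [twistOutside_union_twistInside]; exact hz
    exact this
  constructor
  · refine Subset.antisymm (fun z hz => ?_) hout
    exact (hcov' z (hPg z hz)).resolve_right fun h => hdisj z hz (hin h)
  · refine Subset.antisymm (fun z hz => ?_) hin
    exact (hcov' z (hQg z hz)).resolve_left fun h => hdisj z (hout h) hz

/-- The region above the strands is connected and so has one colour, which determines all the
others; the two cases are exchanged by swapping `P` and `Q`. -/
theorem checkerboard_twistGraph {n : ℕ} {P Q : Set (ℝ × ℝ)} (hP : IsOpen P) (hQ : IsOpen Q)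
    (hd : Disjoint P Q) (hPQ : P ∪ Q = (twistGraph n)ᶜ)
    (hcl : twistGraph n ⊆ closure P ∩ closure Q) :
    (P = twistOutside n ∧ Q = twistInside n) ∨ (P = twistInside n ∧ Q = twistOutside n) := by
  have hwc := continuous_twistWave n
  have hw := hwc.abs
  have hU : {z : ℝ × ℝ | |twistWave n z.1| < z.2} =
      (fun p : ℝ × ℝ => (p.1, |twistWave n p.1| + p.2)) '' (univ ×ˢ Ioi 0) := by
    ext ⟨u, v⟩
    constructor
    · intro h
      exact ⟨(u, v - |twistWave n u|), ⟨mem_univ _, mem_Ioi.2 (sub_pos.2 h)⟩, by simp⟩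
    · rintro ⟨⟨u', s⟩, ⟨-, hs⟩, h⟩
      simp only [Prod.mk.injEq] at h
      obtain ⟨rfl, rfl⟩ := h
      exact lt_add_of_pos_right _ (mem_Ioi.1 hs)
  have hUc : IsPreconnected {z : ℝ × ℝ | |twistWave n z.1| < z.2} := by
    rw [hU]
    exact (isPreconnected_univ.prod isPreconnected_Ioi).image _ (Continuous.continuousOn (by fun_prop))
  have hUsub : {z : ℝ × ℝ | |twistWave n z.1| < z.2} ⊆ P ∪ Q := by
    rw [hPQ]
    intro z hz hg
    have hz' : |twistWave n z.1| < z.2 := hz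
    have hg' : |z.2| = |twistWave n z.1| := hg
    rw [abs_of_pos ((abs_nonneg _).trans_lt hz')] at hg'
    exact hz'.ne' hg'
  rcases hUc.subset_or_subset hP hQ hd hUsub with h | h
  · exact Or.inl (eq_twistOutside_of_upper_subset hP hQ hd hPQ hcl fun u v huv => h huv)
  · exact Or.inr (eq_twistOutside_of_upper_subset hQ hP hd.symm (by rwa [union_comm])
      (by rwa [inter_comm]) fun u v huv => h huv).symm

/-- In each disk the old colouring is one of the two standard ones, and the short row receives the
corresponding one. Outside a compact box these agree, since the standard regions depend only on the
absolute value of the wave, so the new local colours glue to the old ones. -/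
theorem IsTwistSystem.isCheckerboardColorable {F : Type*} [TopologicalSpace F] [T2Space F]
    {K K' : KnotDiagram F} {m : ℕ} {n n' : Fin m → ℕ} {E : Fin m × (ℝ × ℝ) → F}
    {S : Fin m × (Bool × ℝ) → Circle} (h : IsTwistSystem K.proj n E S)
    (h' : IsTwistSystem K'.proj n' E S) (hoff : ∀ s ∉ range S, K'.proj s = K.proj s)
    (hK : K.IsCheckerboardColorable) : K'.IsCheckerboardColorable := by
  obtain ⟨P, Q, hP, hQ, hd, hPQ, hcl⟩ := hK
  set box : Set (ℝ × ℝ) := Icc (0 : ℝ) 1 ×ˢ Icc (-1 : ℝ) 1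
  have hEi : ∀ i, IsOpenEmbedding fun z => E (i, z) := h.chart_apply
  have hlocal : ∀ i, ∃ A B : Set (ℝ × ℝ), IsOpen A ∧ IsOpen B ∧ Disjoint A B ∧
      A ∪ B = (twistGraph (n' i))ᶜ ∧ twistGraph (n' i) ⊆ closure A ∧
      twistGraph (n' i) ⊆ closure B ∧
      ∀ z ∉ box, (z ∈ A ↔ E (i, z) ∈ P) ∧ (z ∈ B ↔ E (i, z) ∈ Q) := by
    intro i
    have hpre : ∀ R : Set F, K.proj '' univ ⊆ closure R →
        twistGraph (n i) ⊆ closure ((fun z => E (i, z)) ⁻¹' R) := by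
      intro R hR z hz
      rw [← (hEi i).isOpenMap.preimage_closure_eq_closure_preimage (hEi i).continuous]
      exact hR (by rw [image_univ]; exact h.chart_mem_range_iff.2 hz)
    have hchk := checkerboard_twistGraph (n := n i) (P := (fun z => E (i, z)) ⁻¹' P)
      (Q := (fun z => E (i, z)) ⁻¹' Q) (hP.preimage (hEi i).continuous)
      (hQ.preimage (hEi i).continuous) (hd.preimage _) (by
        rw [← preimage_union, hPQ, preimage_compl]
        congr 1
        ext z
        exact h.chart_mem_range_iff)
      (subset_inter (hpre P (by rw [image_univ]; exact fun x hx => (hcl hx).1))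
        (hpre Q (by rw [image_univ]; exact fun x hx => (hcl hx).2)))
    rcases hchk with ⟨h1, h2⟩ | ⟨h1, h2⟩
    · refine ⟨twistOutside (n' i), twistInside (n' i), isOpen_twistOutside _, isOpen_twistInside _,
        disjoint_twistOutside_twistInside _, twistOutside_union_twistInside _,
        twistGraph_subset_closure_twistOutside _, twistGraph_subset_closure_twistInside _,
        fun z hz => ?_⟩
      obtain ⟨e1, e2⟩ := mem_twistOutside_iff_of_notMem (n := n' i) (n' := n i) hz
      rw [e1, e2, ← h1, ← h2]
      exact ⟨Iff.rfl, Iff.rfl⟩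
    · refine ⟨twistInside (n' i), twistOutside (n' i), isOpen_twistInside _, isOpen_twistOutside _,
        (disjoint_twistOutside_twistInside _).symm,
        by rw [union_comm]; exact twistOutside_union_twistInside _,
        twistGraph_subset_closure_twistInside _, twistGraph_subset_closure_twistOutside _,
        fun z hz => ?_⟩
      obtain ⟨e1, e2⟩ := mem_twistOutside_iff_of_notMem (n := n' i) (n' := n i) hz
      rw [e1, e2, ← h1, ← h2]
      exact ⟨Iff.rfl, Iff.rfl⟩
  choose A B hA hB hAB hABu hAc hBc hABbox using hlocal
  set M : Set F := ⋃ i, (fun z => E (i, z)) '' box with hM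
  have hMc : IsClosed M := (isCompact_iUnion fun i =>
    (isCompact_Icc.prod isCompact_Icc).image (hEi i).continuous).isClosed
  have hMsub : ∀ p ∉ range E, p ∉ M := by
    intro p hp hpM
    obtain ⟨i, z, -, rfl⟩ := mem_iUnion.1 hpM
    exact hp ⟨_, rfl⟩
  have hMmem : ∀ i z, E (i, z) ∈ M ↔ z ∈ box := by
    intro i z
    rw [hM, mem_iUnion]
    constructor
    · rintro ⟨j, z', hz', heq⟩
      have := h.chart.injective heq
      simp only [Prod.mk.injEq] at this
      exact this.2 ▸ hz'
    · exact fun hz => ⟨i, z, hz, rfl⟩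
  -- recolour the disks
  set rec : Set F → (Fin m → Set (ℝ × ℝ)) → Set F := fun R C =>
    (R \ M) ∪ ⋃ i, (fun z => E (i, z)) '' C i with hrec
  have hopen : ∀ R C, IsOpen R → (∀ i, IsOpen (C i)) → IsOpen (rec R C) := fun R C hR hC =>
    (hR.sdiff hMc).union (isOpen_iUnion fun i => (hEi i).isOpenMap _ (hC i))
  have hmemE : ∀ R C, (∀ i, ∀ z ∉ box, (z ∈ C i ↔ E (i, z) ∈ R)) → ∀ i z,
      (E (i, z) ∈ rec R C ↔ z ∈ C i) := by
    intro R C hRC i z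
    constructor
    · rintro (⟨h1, h2⟩ | h1)
      · exact (hRC i z fun hz => h2 ((hMmem i z).2 hz)).2 h1
      · obtain ⟨j, z', hz', heq⟩ := mem_iUnion.1 h1
        have := h.chart.injective heq
        simp only [Prod.mk.injEq] at this
        obtain ⟨rfl, rfl⟩ := this
        exact hz'
    · exact fun hz => Or.inr (mem_iUnion.2 ⟨i, z, hz, rfl⟩)
  have hmemN : ∀ R C p, p ∉ range E → (p ∈ rec R C ↔ p ∈ R) := by
    intro R C p hp
    constructor
    · rintro (⟨h1, -⟩ | h1)
      · exact h1
      · obtain ⟨j, z, -, rfl⟩ := mem_iUnion.1 h1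
        exact absurd ⟨_, rfl⟩ hp
    · exact fun hpR => Or.inl ⟨hpR, hMsub p hp⟩
  have hclos : ∀ R C, range K.proj ⊆ closure R → (∀ i, twistGraph (n' i) ⊆ closure (C i)) →
      range K'.proj ⊆ closure (rec R C) := by
    intro R C hR hC p hp
    by_cases hpE : p ∈ range E
    · obtain ⟨⟨i, z⟩, rfl⟩ := hpE
      have hz := hC i (h'.chart_mem_range_iff.1 hp)
      have := image_closure_subset_closure_image (hEi i).continuous (mem_image_of_mem _ hz)
      refine closure_mono ?_ this
      exact fun q hq => Or.inr (mem_iUnion.2 ⟨i, hq⟩)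
    · have hpR := hR ((h.mem_range_iff_of_notMem h' hoff hpE).2 hp)
      -- Near a point outside all the disks the closed union `M` of the boxes can be avoided, and
      -- there the old colour is kept.
      refine mem_closure_iff.2 fun O hO hpO => ?_
      obtain ⟨q, ⟨hqO, hqM⟩, hqR⟩ := mem_closure_iff.1 hpR (O ∩ Mᶜ) (hO.inter hMc.isOpen_compl)
        ⟨hpO, hMsub p hpE⟩
      exact ⟨q, hqO, Or.inl ⟨hqR, hqM⟩⟩
  have hPA := hmemE P A fun i z hz => (hABbox i z hz).1
  have hQB := hmemE Q B fun i z hz => (hABbox i z hz).2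
  refine ⟨rec P A, rec Q B, hopen P A hP hA, hopen Q B hQ hB, ?_, ?_, ?_⟩
  · rw [Set.disjoint_left]
    intro p hpP hpQ
    by_cases hpE : p ∈ range E
    · obtain ⟨⟨i, z⟩, rfl⟩ := hpE
      exact Set.disjoint_left.1 (hAB i) ((hPA i z).1 hpP) ((hQB i z).1 hpQ)
    · exact Set.disjoint_left.1 hd ((hmemN _ _ p hpE).1 hpP) ((hmemN _ _ p hpE).1 hpQ)
  · ext p
    by_cases hpE : p ∈ range E
    · obtain ⟨⟨i, z⟩, rfl⟩ := hpE
      rw [mem_union, hPA, hQB, mem_compl_iff, h'.chart_mem_range_iff, ← mem_union, hABu i,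
        mem_compl_iff]
    · rw [mem_union, hmemN _ _ p hpE, hmemN _ _ p hpE, mem_compl_iff,
        ← h.mem_range_iff_of_notMem h' hoff hpE, ← mem_union, hPQ, mem_compl_iff]
  · exact subset_inter (hclos P A (fun x hx => (hcl hx).1) hAc)
      (hclos Q B (fun x hx => (hcl hx).2) hBc)

/-! ### Assembly of the result -/

/-- Removing crossings in pairs from some of the twist regions of a weakly generalized alternating knot
diagram, so that one or two crossings are left in each of these, gives a knot diagram, and this diagram
is again weakly generalized alternating, with edge representativity at least 4 and representativity
greater than 4. -/
theorem proposition4p1 {F Y : Type*}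
    [TopologicalSpace F] [T2Space F] [CompactSpace F] [ConnectedSpace F]
    [ChartedSpace (EuclideanSpace ℝ (Fin 2)) F]
    [TopologicalSpace Y] [T2Space Y] [ChartedSpace (EuclideanHalfSpace 3) Y]
    (c : F × ℝ → Y) (hc : IsOpenEmbedding c)
    (K : KnotDiagram F) (hK : K.IsWeaklyGeneralizedAlternating c)
    (he : 4 ≤ K.edgeRepresentativity) (hr : 4 < K.representativity c)
    (m : ℕ) (n n' : Fin m → ℕ) (T : ∀ i, TwistChart K (n i))
    (hT : ∀ i, (T i).IsTwistRegion)
    (hdisj : ∀ i j, i ≠ j → Disjoint (range (T i).chart) (range (T j).chart))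
    (hn' : ∀ i, (n' i = 1 ∨ n' i = 2) ∧ ∃ k, n i = n' i + 2 * k) :
    (∃ K' : KnotDiagram F, K.IsTwistReplacement T n' K') ∧
      ∀ K' : KnotDiagram F, K.IsTwistReplacement T n' K' →
        K'.IsWeaklyGeneralizedAlternating c ∧
          4 ≤ K'.edgeRepresentativity ∧ 4 < K'.representativity c := by
  have hnk : ∀ i, ∃ k, n i = n' i + 2 * k := fun i => (hn' i).2
  have hn1 : ∀ i, 1 ≤ n' i := fun i => by rcases (hn' i).1 with h | h <;> omega
  have hnle : ∀ i, n' i ≤ n i := fun i => by obtain ⟨k, hk⟩ := hnk i; omega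
  refine ⟨KnotDiagram.exists_isTwistReplacement T hdisj fun i => ⟨hn1 i, hnk i⟩, fun K' hR => ?_⟩
  have h := isTwistSystem_of_twistChart T hdisj
  obtain ⟨h', hoff⟩ := hR.isTwistSystem hdisj hnk
  have hle : ∀ i, 1 ≤ n' i ∧ n' i ≤ n i := fun i => ⟨hn1 i, hnle i⟩
  have hcore : ∀ s ∉ IsTwistSystem.core fun p : Fin m × (Bool × ℝ) => (T p.1).strand p.2.1 p.2.2,
      ∀ i, ¬ (T i).InTwist s := fun s hs i ⟨b, x, hx, hxs⟩ =>
    hs ⟨(i, b, x), ⟨mem_univ _, mem_univ _, hx⟩, hxs⟩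
  have hcoreK : ∀ s ∉ IsTwistSystem.core fun p : Fin m × (Bool × ℝ) => (T p.1).strand p.2.1 p.2.2,
      K'.proj s = K.proj s := fun s hs => hR.proj_outside s (hcore s hs)
  have hrep := h.representativity_le hc h' hoff hle
  refine ⟨⟨⟨?_, ?_, ?_, ?_⟩, ?_, ?_⟩, ?_, ?_⟩
  · exact h.isAlternating h' (fun i => ⟨hnle i, hnk i⟩) hcoreK
      (fun s t hs ht => hR.over_outside s t (hcore s hs) (hcore t ht)) hR.over_inside hK.crossing
      hK.alternating
  · exact h.isWeaklyPrime h' hoff hle hK.weaklyPrime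
  · exact ⟨_, mem_range_self 1⟩
  · obtain ⟨s, hs⟩ := hK.crossing
    -- A crossing outside the rows survives unchanged. If the given crossing lies in row `i`, the
    -- first crossing of the shortened row takes its place, because `1 ≤ n' i`.
    by_cases hsc : s ∈ IsTwistSystem.core fun p : Fin m × (Bool × ℝ) => (T p.1).strand p.2.1 p.2.2
    · obtain ⟨⟨i, -, -⟩, -, -⟩ := hsc
      exact ⟨(T i).strand true (twistParam (n' i) 0),
        (h'.isCrossingAt_strand_iff (b := true)).2 (twistWave_twistParam (hn1 i))⟩
    · exact ⟨s, (h.isCrossingAt_iff_of_notMem_core h' hcoreK hsc).2 hs⟩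
  · exact h.isCheckerboardColorable h' hoff hK.checkerboard
  · exact hr.le.trans hrep
  · exact he.trans (h.edgeRepresentativity_le h' hoff hle)
  · exact hr.trans_le hrep
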